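/- **Conventions.** Let $E=\mathbf{C}^2$ be the natural representation of $\mathrm{SL}_2(\mathbf{C})$. A partition $\lambda$ (possibly empty) has parts $\lambda_1\ge\lambda_2\ge\cdots$ (with $\lambda_i=0$ for $i>\ell(\lambda)$), $\ell(\lambda)$ is its number of parts, $|\lambda|$ its size, $\lambda'$ its conjugate, $[\lambda]$ its set of boxes $(i,j)$. For a vector space $V$, $\nabla^\lambda V\subseteq\bigotimes_{i=1}^{\ell(\lambda)}\mathrm{Sym}^{\lambda_i}V$ is the span of all $F(t)=\sum_\tau \mathrm{sgn}(\tau) f(\tau\cdot t)$, where $t$ is a filling of $[\lambda]$ by vectors of $V$, $f(t)=\bigotimes_i\prod_j t_{(i,j)}$, and $\tau$ runs over the permutations of $[\lambda]$ preserving each column; so $\nabla^\lambda\mathrm{Sym}^\ell E$ is a representation of $\mathrm{SL}_2(\mathbf{C})$. The $Q$-character of a representation $U$ of $\mathrm{SL}_2(\mathbf{C})$ is the Laurent polynomial $\Psi_U$ such that $\Psi_U(Q)$ is the trace of $\mathrm{diag}(Q^{-1},Q)$ on $U$ for all $Q\in\mathbf{C}^\times$. Let $\mathrm{SSYT}_{\le\ell}(\lambda)$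 be the set of semistandard $\lambda$-tableaux with entries in $\{0,1,\dots,\ell\}$; the weight $|t|$ of a tableau is the sum of its entries; for $e\in\mathbf{Z}$, $\mathcal{S}_e^{\ell}(\lambda)$ is the set of $t\in\mathrm{SSYT}_{\le\ell}(\lambda)$ with $|t|=e$ (empty if $e<0$). The Schur polynomial is $s_\lambda(x_0,\dots,x_\ell)=\sum_{t\in\mathrm{SSYT}_{\le\ell}(\lambda)}\prod_{(i,j)\in[\lambda]}x_{t(i,j)}$. Put $b(\lambda)=\sum_{j}\binom{\lambda'_j}{2}$. Let $H(\lambda)$ be the multiset of hook lengths $(\lambda_i-i)+(\lambda'_j-j)+1$ and $C(\lambda)$ the multiset of contents $j-i$, for $(i,j)\in[\lambda]$; $C(\lambda)+a$ is obtained by adding $a$ to each element. With $\delta(\lambda)_j=\lambda_j-\lambda_{j+1}+1$, let $\Delta_\ell(\lambda)$ be the multiset of all $\delta(\lambda)_j+\cdots+\delta(\lambda)_{k-1}$ for $1\le j<k\le\ell+1$. For finite multisets $X,Z$ the difference multiset $X/Z$ is the function assigning to $x$ the multiplicity of $x$ in $X$ minus that in $Z$; two difference multisets are equal if these functions agree.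 **Theorem (Portmanteau).** Let $\lambda$ and $\mu$ be partitions and let $\ell,m\in\mathbf{N}_0$ be such that $\ell\ge\ell(\lambda)-1$ and $m\ge\ell(\mu)-1$. The following are equivalent: (a) $\lambda$ and $\mu$ are plethystically equivalent with respect to $\ell$ and $m$, i.e. $\ell\ge\ell(\lambda)-1$, $m\ge\ell(\mu)-1$ and the isomorphism in (b) holds; (b) $\nabla^\lambda\mathrm{Sym}^\ell E\cong\nabla^\mu\mathrm{Sym}^m E$ as representations of $\mathrm{SL}_2(\mathbf{C})$; (c) $\Psi_{\nabla^\lambda\mathrm{Sym}^\ell E}(Q)=\Psi_{\nabla^\mu\mathrm{Sym}^m E}(Q)$; (d) $q^{-\ell|\lambda|/2}s_\lambda(1,q,\dots,q^\ell)=q^{-m|\mu|/2}s_\mu(1,q,\dots,q^m)$; (e) $s_\lambda(1,q,\dots,q^\ell)=q^d s_\mu(1,q,\dots,q^m)$ for some $d\in\mathbf{Z}$; (f) $q^{-b(\lambda)}s_\lambda(1,q,\dots,q^\ell)=q^{-b(\mu)}s_\mu(1,q,\dots,q^m)$; (g) there exists $d\in\mathbf{Z}$ such that $|\mathcal{S}_{e+d}^{\ell}(\lambda)|=|\mathcal{S}_e^{m}(\mu)|$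 for all $e\in\mathbf{Z}$; (h) $(C(\lambda)+\ell+1)/H(\lambda)=(C(\mu)+m+1)/H(\mu)$; (i) $\Delta_\ell(\lambda)/\{1^\ell,2^{\ell-1},\dots,\ell\}=\Delta_m(\mu)/\{1^m,2^{m-1},\dots,m\}$. If any of these conditions holds then $-\frac{\ell|\lambda|}{2}+b(\lambda)=-\frac{m|\mu|}{2}+b(\mu)$, and any $d$ as in (e) or (g) equals $b(\lambda)-b(\mu)$. Moreover (whether or not the conditions hold) each side in (d) is centrally symmetric and unimodal about its constant term: the coefficients of $q^r$ and $q^{-r}$ agree for every $r\in\mathbf{Q}$, and, as the exponent increases in steps of $1$, the coefficients weakly increase as long as the exponent is at most $0$ and weakly decrease from the first exponent that is at least $0$. -/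

import Mathlib

open scoped TensorProduct LaurentPolynomial

noncomputable section

namespace Plethysm

/-! Partitions are Young diagrams: `lam.rowLen i` is the part of index `i` (starting from `0`, with
value `0` beyond the last part), `lam.colLen j` is the part of index `j` of the conjugate partition,
`lam.colLen 0` is the number of parts and `lam.card` is the size. Boxes are indexed from `(0, 0)`. -/

section SymmetricPowers

variable {V W U : Type} [AddCommGroup V] [Module ℂ V] [AddCommGroup W] [Module ℂ W]
  [AddCommGroup U] [Module ℂ U]

/-- The linear map `Symⁿ V → Symⁿ W` induced by a linear map `V → W`, that is,
`v₁ v₂ ⋯ vₙ ↦ (g v₁) (g v₂) ⋯ (g vₙ)`. -/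
def symMap (n : ℕ) (g : V →ₗ[ℂ] W) :
    SymmetricPower ℂ (Fin n) V →ₗ[ℂ] SymmetricPower ℂ (Fin n) W where
  toFun := AddCon.lift _
    ((SymmetricPower.mk ℂ (Fin n) W ∘ₗ PiTensorProduct.map (fun _ => g)).toAddMonoidHom) (by
      refine AddCon.addConGen_le.2 ?_
      rintro _ _ ⟨e, f⟩
      rw [AddCon.ker_rel]
      simp only [LinearMap.toAddMonoidHom_coe, LinearMap.comp_apply, PiTensorProduct.map_tprod]
      exact (SymmetricPower.tprod_equiv (R := ℂ) e (fun i => g (f i))).symm)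
  map_add' := map_add _
  map_smul' r x := by
    refine AddCon.induction_on x fun x => ?_
    exact LinearMap.map_smul
      (SymmetricPower.mk ℂ (Fin n) W ∘ₗ PiTensorProduct.map (fun _ => g)) r x

theorem symMap_tprod (n : ℕ) (g : V →ₗ[ℂ] W) (v : Fin n → V) :
    symMap n g (SymmetricPower.tprod ℂ v) = SymmetricPower.tprod ℂ (fun i => g (v i)) :=
  congrArg (SymmetricPower.mk ℂ (Fin n) W) (PiTensorProduct.map_tprod (fun _ => g) v)

theorem sym_hom_ext (n : ℕ) {a b : SymmetricPower ℂ (Fin n) V →ₗ[ℂ] W}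
    (h : ∀ v : Fin n → V, a (SymmetricPower.tprod ℂ v) = b (SymmetricPower.tprod ℂ v)) : a = b := by
  refine LinearMap.ext_on (SymmetricPower.span_tprod_eq_top ℂ (Fin n) V) ?_
  rintro _ ⟨v, rfl⟩
  exact h v

theorem symMap_one (n : ℕ) : symMap n (1 : V →ₗ[ℂ] V) = 1 :=
  sym_hom_ext n fun v => by simp [symMap_tprod]

theorem symMap_comp (n : ℕ) (g : W →ₗ[ℂ] U) (h : V →ₗ[ℂ] W) :
    symMap n (g ∘ₗ h) = symMap n g ∘ₗ symMap n h :=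
  sym_hom_ext n fun v => by simp [symMap_tprod]

/-- The representation `Symⁿ V` attached to a representation on `V`. -/
def symRep {G : Type} [Group G] (n : ℕ) (ρ : Representation ℂ G V) :
    Representation ℂ G (SymmetricPower ℂ (Fin n) V) where
  toFun g := symMap n (ρ g)
  map_one' := by rw [map_one, symMap_one]
  map_mul' g h := by rw [map_mul]; exact symMap_comp n (ρ g) (ρ h)

end SymmetricPowers

section SchurFunctor

variable (lam : YoungDiagram) (V : Type) [AddCommGroup V] [Module ℂ V]

/-- The tensor product over the rows `i` of `lam` of the symmetric powers `Sym^{lam_i} V`. -/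
abbrev RowTensor : Type :=
  ⨂[ℂ] i : Fin (lam.colLen 0), SymmetricPower ℂ (Fin (lam.rowLen i)) V

variable {lam V}

/-- For a filling `t` of the boxes of `lam` by vectors, the element `f(t)` of `RowTensor lam V`:
the tensor product over the rows of the symmetric products of the entries in the row. -/
def rowProduct (t : lam.cells → V) : RowTensor lam V :=
  PiTensorProduct.tprod ℂ fun i : Fin (lam.colLen 0) =>
    SymmetricPower.tprod ℂ fun j : Fin (lam.rowLen i) =>
      t ⟨(i, j), (YoungDiagram.mem_cells _).2 (YoungDiagram.mem_iff_lt_rowLen.2 j.2)⟩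

/-- The polytabloid `F(t) = ∑_τ sgn(τ) f(τ · t)`, the sum being over all permutations `τ` of the
boxes that preserve each column, and `(τ · t)(c) = t(τ⁻¹ c)`. -/
def polytabloid (t : lam.cells → V) : RowTensor lam V :=
  ∑ τ : Equiv.Perm lam.cells with ∀ c, (τ c).1.2 = c.1.2,
    (Equiv.Perm.sign τ : ℤ) • rowProduct fun c => t (τ⁻¹ c)

variable (lam V) in
/-- The Schur functor `∇^lam V`: the span of the polytabloids. All fillings by vectors of `V` are
allowed; as `F(t)` is multilinear in the entries of `t`, the fillings by elements of any fixed
basis of `V` have the same span. -/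
def schurModule : Submodule ℂ (RowTensor lam V) :=
  Submodule.span ℂ (Set.range (polytabloid (lam := lam) (V := V)))

variable {G : Type} [Group G]

/-- The diagonal action of `G` on `RowTensor lam V`. -/
def rowTensorRep (lam : YoungDiagram) (ρ : Representation ℂ G V) :
    Representation ℂ G (RowTensor lam V) where
  toFun g := PiTensorProduct.map fun i => symRep (lam.rowLen i) ρ g
  map_one' := by simp only [map_one]; exact PiTensorProduct.map_one
  map_mul' g h := by simp only [map_mul]; exact PiTensorProduct.map_mul _ _

theorem rowTensorRep_rowProduct (ρ : Representation ℂ G V) (g : G) (t : lam.cells → V) :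
    rowTensorRep lam ρ g (rowProduct t) = rowProduct fun c => ρ g (t c) := by
  refine (PiTensorProduct.map_tprod _ _).trans ?_
  exact congrArg _ (funext fun i => symMap_tprod _ _ _)

theorem rowTensorRep_polytabloid (ρ : Representation ℂ G V) (g : G) (t : lam.cells → V) :
    rowTensorRep lam ρ g (polytabloid t) = polytabloid fun c => ρ g (t c) := by
  simp only [polytabloid, map_sum, map_zsmul, rowTensorRep_rowProduct]

/-- The representation of `G` on `∇^lam V` attached to a representation of `G` on `V`. -/
def schurRep (lam : YoungDiagram) (ρ : Representation ℂ G V) :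
    Representation ℂ G (schurModule lam V) :=
  Subrepresentation.toRepresentation (ρ := rowTensorRep lam ρ)
    { toSubmodule := schurModule lam V
      apply_mem_toSubmodule := fun g v hv => by
        have h : schurModule lam V ≤ (schurModule lam V).comap (rowTensorRep lam ρ g) := by
          refine Submodule.span_le.2 ?_
          rintro _ ⟨t, rfl⟩
          refine Submodule.subset_span ⟨fun c => ρ g (t c), ?_⟩
          exact (rowTensorRep_polytabloid ρ g t).symm
        exact h hv }

end SchurFunctor

section SL2

/-- The special linear group `SL₂(ℂ)`. -/
abbrev SL2 : Type := Matrix.SpecialLinearGroup (Fin 2) ℂ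

/-- The natural representation `E = ℂ²` of `SL₂(ℂ)`. -/
def natRep : Representation ℂ SL2 (Fin 2 → ℂ) where
  toFun g := Matrix.toLin' g.1
  map_one' := by
    simp only [Matrix.SpecialLinearGroup.coe_one]; exact Matrix.toLin'_one
  map_mul' g h := by
    simp only [Matrix.SpecialLinearGroup.coe_mul]; exact Matrix.toLin'_mul _ _

/-- The representation `∇^lam Sym^l E` of `SL₂(ℂ)`. -/
def nablaSym (lam : YoungDiagram) (l : ℕ) :
    Representation ℂ SL2 (schurModule lam (SymmetricPower ℂ (Fin l) (Fin 2 → ℂ))) :=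
  schurRep lam (symRep l natRep)

/-- The diagonal matrix with entries `Q⁻¹` and `Q`. -/
def diagSL2 (Q : ℂˣ) : SL2 :=
  ⟨!![((Q⁻¹ : ℂˣ) : ℂ), 0; 0, (Q : ℂ)], by simp [Matrix.det_fin_two]⟩

/-- `Ψ` is the `Q`-character of the representation `ρ` of `SL₂(ℂ)`: the Laurent polynomial such
that `Ψ(Q)` is the trace of the diagonal matrix with entries `Q⁻¹` and `Q`, for all `Q ≠ 0`. -/
def IsQCharacter {V : Type} [AddCommMonoid V] [Module ℂ V] (ρ : Representation ℂ SL2 V)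
    (Ψ : ℂ[T;T⁻¹]) : Prop :=
  ∀ Q : ℂˣ, LinearMap.trace ℂ V (ρ (diagSL2 Q)) = LaurentPolynomial.eval₂ (RingHom.id ℂ) Q Ψ

/-- Plethystic equivalence of `lam` and `mu` with respect to `l` and `m`. -/
def PlethysticEquiv (lam : YoungDiagram) (l : ℕ) (mu : YoungDiagram) (m : ℕ) : Prop :=
  lam.colLen 0 ≤ l + 1 ∧ mu.colLen 0 ≤ m + 1 ∧
    Nonempty ((nablaSym lam l).Equiv (nablaSym mu m))

end SL2

section Tableaux

/-- Semistandard `lam`-tableaux with entries in `{0, 1, …, l}`. -/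
def SSYTLe (lam : YoungDiagram) (l : ℕ) : Type :=
  {t : SemistandardYoungTableau lam // ∀ i j, t i j ≤ l}

instance (lam : YoungDiagram) (l : ℕ) : Finite (SSYTLe lam l) := by
  refine Finite.of_injective
    (fun t => fun c : lam.cells => (⟨t.1 c.1.1 c.1.2, Nat.lt_succ_of_le (t.2 _ _)⟩ : Fin (l + 1)))
    ?_
  intro s t h
  refine Subtype.ext (SemistandardYoungTableau.ext fun i j => ?_)
  by_cases hc : (i, j) ∈ lam
  · exact congrArg Fin.val (congrFun h ⟨(i, j), (YoungDiagram.mem_cells _).2 hc⟩)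
  · rw [s.1.zeros hc, t.1.zeros hc]

instance (lam : YoungDiagram) (l : ℕ) : Fintype (SSYTLe lam l) := Fintype.ofFinite _

/-- The entry of a tableau in a box, as an element of `{0, 1, …, l}`. -/
def SSYTLe.entry {lam : YoungDiagram} {l : ℕ} (t : SSYTLe lam l) (c : ℕ × ℕ) : Fin (l + 1) :=
  ⟨t.1 c.1 c.2, Nat.lt_succ_of_le (t.2 _ _)⟩

/-- The weight of a tableau: the sum of its entries. -/
def SSYTLe.weight {lam : YoungDiagram} {l : ℕ} (t : SSYTLe lam l) : ℕ :=
  ∑ c ∈ lam.cells, (t.entry c : ℕ)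

/-- The number of semistandard `lam`-tableaux with entries in `{0, 1, …, l}` of weight `e`
(so `0` if `e` is negative). -/
def numTableaux (e : ℤ) (l : ℕ) (lam : YoungDiagram) : ℕ :=
  Nat.card {t : SSYTLe lam l // (t.weight : ℤ) = e}

/-- The Schur polynomial `s_lam(x_0, x_1, …, x_l)`. -/
def schurPoly (lam : YoungDiagram) (l : ℕ) : MvPolynomial (Fin (l + 1)) ℤ :=
  ∑ t : SSYTLe lam l, ∏ c ∈ lam.cells, MvPolynomial.X (t.entry c)

/-- The specialization `s_lam(1, q, …, q^l)`, for `q` in any commutative ring. -/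
def schurSpec {A : Type} [CommRing A] (q : A) (lam : YoungDiagram) (l : ℕ) : A :=
  MvPolynomial.aeval (fun k : Fin (l + 1) => q ^ (k : ℕ)) (schurPoly lam l)

/-- The minimum weight `b(lam)`. -/
def minWeight (lam : YoungDiagram) : ℕ :=
  ∑ j ∈ Finset.range (lam.rowLen 0), (lam.colLen j).choose 2

end Tableaux

section FractionalPowers

/-- Laurent polynomials in `q` with integer coefficients and rational exponents. -/
abbrev FracLaurent : Type := AddMonoidAlgebra ℤ ℚ

/-- The monomial `q ^ r`, for `r` rational. -/
def qPow (r : ℚ) : FracLaurent := AddMonoidAlgebra.single r 1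

/-- `q ^ (-l |lam| / 2) * s_lam(1, q, …, q ^ l)`. -/
def centredSchur (lam : YoungDiagram) (l : ℕ) : FracLaurent :=
  qPow (-((l : ℚ) * lam.card) / 2) * schurSpec (qPow 1) lam l

/-- Central symmetry about the constant term: `q ^ r` and `q ^ (-r)` have equal coefficients. -/
def CentrallySymmetric (f : FracLaurent) : Prop :=
  ∀ r : ℚ, f.coeff (-r) = f.coeff r

/-- Unimodality about the constant term: as the exponent increases in steps of one, the
coefficients weakly increase as long as the exponent is at most `0`, and weakly decrease from
the first exponent that is at least `0`. -/
def UnimodalAboutZero (f : FracLaurent) : Prop :=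
  (∀ r : ℚ, r ≤ 0 → f.coeff (r - 1) ≤ f.coeff r) ∧
    (∀ r : ℚ, 0 ≤ r → f.coeff (r + 1) ≤ f.coeff r)

end FractionalPowers

section Multisets

/-- The difference multiset `X / Z`, as the function giving the multiplicity of each element.
Two difference multisets are equal if all multiplicities agree. -/
def diffMultiset (X Z : Multiset ℤ) : ℤ → ℤ := fun x => (X.count x : ℤ) - (Z.count x : ℤ)

/-- The multiset of hook lengths. -/
def hookMultiset (lam : YoungDiagram) : Multiset ℤ :=
  lam.cells.val.map fun c =>
    ((lam.rowLen c.1 : ℤ) - ((c.1 : ℤ) + 1)) + ((lam.colLen c.2 : ℤ) - ((c.2 : ℤ) + 1)) + 1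

/-- The multiset of contents. -/
def contentMultiset (lam : YoungDiagram) : Multiset ℤ :=
  lam.cells.val.map fun c => (c.2 : ℤ) - (c.1 : ℤ)

/-- The multiset `X + a`, with `a` added to each element of `X`. -/
def shiftMultiset (X : Multiset ℤ) (a : ℤ) : Multiset ℤ := X.map fun x => x + a

/-- The differences `lam_j - lam_{j+1} + 1`. -/
def delta (lam : YoungDiagram) (j : ℕ) : ℤ := (lam.rowLen j : ℤ) - (lam.rowLen (j + 1) : ℤ) + 1

/-- The pyramid multiset: all sums `δ_j + δ_{j+1} + ⋯ + δ_{k-1}`, one for each pair `j < k` of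
row indices among the first `l + 1` rows. -/
def pyramid (lam : YoungDiagram) (l : ℕ) : Multiset ℤ :=
  ((Finset.range (l + 1) ×ˢ Finset.range (l + 1)).filter fun p => p.1 < p.2).val.map
    fun p => ∑ i ∈ Finset.Ico p.1 p.2, delta lam i

/-- The multiset `{1^l, 2^(l-1), …, l}`, in which `i + 1` has multiplicity `l - i`. -/
def staircase (l : ℕ) : Multiset ℤ :=
  ∑ i ∈ Finset.range l, Multiset.replicate (l - i) ((i : ℤ) + 1)

end Multisets

end Plethysm

end

/-! The conditions split into representation-theoretic ones, enumerative ones and product formulas,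
all linked by the weight generating function of semistandard tableaux.

Representations to characters. The polytabloids of semistandard tableaux form a basis of
$\nabla^\lambda V$: they span by Garnir straightening (`polytabloid_mem_span`) and are independent
by a triangularity argument (`polytabloid_linearIndependent`). For $V=\mathrm{Sym}^\ell E$ with its
monomial basis they are eigenvectors of the diagonal torus, so the $Q$-character is $\sum_t
Q^{2|t|-\ell|\lambda|}$ (`trace_nablaSym_diag`). Its coefficients `charMult` are the coefficients of
the centred specialization in (d).

Characters to representations. $\nabla^\lambda\mathrm{Sym}^\ell E$ is an equivariant quotient of a
tensor power of $E$. On that Hilbert space the operators $e$ and $f$ of $\mathfrak{sl}_2$ are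
adjoint, so the quotient can be replaced by the orthogonal complement of the kernel, which is
$\mathfrak{sl}_2$-stable and decomposes into strings $v, fv, \dots, f^nv$
(`isStringRep_of_surjective`, `exists_isStringBasis`). The multiset of string lengths determines the
representation, and the number of strings with top weight $N$ is the multiplicity of weight $N$
minus that of weight $N+2$; hence the character determines the representation
(`nonempty_equiv_of_charMult_eq`). Strings are centred at weight $0$, which also gives the symmetry
and unimodality.

Shifts. Weights of tableaux range from $b(\lambda)$ to $\ell|\lambda|-b(\lambda)$, the upper end
being the mirror image of the lower. A shift matching two weight distributions must match both ends,
so it is $b(\lambda)-b(\mu)$, and the same comparison yields the numerical identity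
(`numTableaux_shift_eq`).

Products. The bialternant formula (`tabSum_mul_vandermonde`) at $x_i=q^i$ is a quotient of two
Vandermonde determinants, so up to a power of $q$ the specialization is $\prod(1-q^x)$ over the
pyramid divided by the same product over the staircase (`schurSpec_mul_staircase`). Such a product,
up to a monomial, determines its multiset of positive exponents (`eq_of_oneSubProd_eq`), whence (e)
and (i) agree. Finally, row by row, hook lengths and pyramid entries together fill an interval
(`hook_row_add_rowDiff`), which identifies the difference multisets in (h) and (i). -/

noncomputable section

namespace Plethysm

/-! ### String decomposition of an $\mathfrak{sl}_2$-action with $e$ and $f$ adjoint. -/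

section SlTwo

open scoped InnerProductSpace

/-- Endomorphisms `e`, `f`, `h` satisfying the defining relations of `𝔰𝔩₂`. -/
structure SlTwoRelations {V : Type} [AddCommGroup V] [Module ℂ V] (e f h : Module.End ℂ V) :
    Prop where
  e_f : ∀ x, e (f x) - f (e x) = h x
  h_e : ∀ x, h (e x) = e (h x) + (2 : ℂ) • e x
  h_f : ∀ x, h (f x) = f (h x) - (2 : ℂ) • f x

/-- The basis `b` consists of the strings `v, f v, f² v, …, fⁿ v` generated by vectors `v`
of weight `n` killed by `e` and `f ^ (n + 1)`. -/
structure IsStringBasis {V : Type} [AddCommGroup V] [Module ℂ V] (e f h : Module.End ℂ V)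
    {d : ℕ} {n : Fin d → ℕ} (b : Module.Basis (Σ i, Fin (n i + 1)) ℂ V) : Prop where
  h_pow : ∀ i (k : ℕ), h ((f ^ k) (b ⟨i, 0⟩)) = ((n i : ℂ) - 2 * k) • (f ^ k) (b ⟨i, 0⟩)
  e_zero : ∀ i, e (b ⟨i, 0⟩) = 0
  e_pow : ∀ i (k : ℕ), e ((f ^ (k + 1)) (b ⟨i, 0⟩)) =
    (((k : ℂ) + 1) * ((n i : ℂ) - k)) • (f ^ k) (b ⟨i, 0⟩)
  f_pow : ∀ i, (f ^ (n i + 1)) (b ⟨i, 0⟩) = 0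
  apply : ∀ i k, b ⟨i, k⟩ = (f ^ (k : ℕ)) (b ⟨i, 0⟩)

section

variable {V : Type} [AddCommGroup V] [Module ℂ V] {e f h : Module.End ℂ V}

theorem SlTwoRelations.h_pow (r : SlTwoRelations e f h) {v : V} {c : ℂ} (hv : h v = c • v)
    (k : ℕ) : h ((f ^ k) v) = (c - 2 * k) • (f ^ k) v := by
  induction k with
  | zero => simpa using hv
  | succ k ih =>
    rw [pow_succ', Module.End.mul_apply, r.h_f, ih, map_smul, ← sub_smul]
    push_cast
    ring_nf

theorem SlTwoRelations.e_pow (r : SlTwoRelations e f h) {v : V} {c : ℂ} (hv : h v = c • v)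
    (ev : e v = 0) (k : ℕ) :
    e ((f ^ (k + 1)) v) = (((k : ℂ) + 1) * (c - k)) • (f ^ k) v := by
  induction k with
  | zero => simpa [ev, hv] using r.e_f v
  | succ k ih =>
    rw [pow_succ', Module.End.mul_apply, ← sub_add_cancel (e (f _)) (f (e ((f ^ (k + 1)) v))),
      r.e_f, ih, r.h_pow hv, map_smul, ← Module.End.mul_apply, ← pow_succ', ← add_smul]
    push_cast
    ring_nf

/-- If $n+1$ is the least exponent killing $v$, then $0=ef^{n+1}v=(n+1)(c-n)f^nv$ with $f^nv\neq0$,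
which forces $c=n$. -/
theorem SlTwoRelations.exists_weight (r : SlTwoRelations e f h) (hf : IsNilpotent f) {v : V}
    {c : ℂ} (hv : h v = c • v) (ev : e v = 0) (v0 : v ≠ 0) :
    ∃ n : ℕ, c = n ∧ (f ^ (n + 1)) v = 0 ∧ ∀ k ≤ n, (f ^ k) v ≠ 0 := by
  classical
  obtain ⟨M, hM⟩ := hf
  have hex : ∃ k, (f ^ k) v = 0 := ⟨M, by rw [hM]; rfl⟩
  have h0 : Nat.find hex ≠ 0 := fun h0 => v0 (by simpa [h0] using Nat.find_spec hex)
  obtain ⟨n, hn⟩ := Nat.exists_eq_succ_of_ne_zero h0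
  have hz : (f ^ (n + 1)) v = 0 := by simpa [hn] using Nat.find_spec hex
  have hne : ∀ k ≤ n, (f ^ k) v ≠ 0 := fun k hk => Nat.find_min hex (by omega)
  refine ⟨n, ?_, hz, hne⟩
  have := r.e_pow hv ev n
  rw [hz, map_zero, eq_comm, smul_eq_zero_iff_left (hne n le_rfl), mul_eq_zero] at this
  exact sub_eq_zero.1 (this.resolve_left (Nat.cast_add_one_ne_zero n))

end

variable {H : Type} [NormedAddCommGroup H] [InnerProductSpace ℂ H] {e f h : Module.End ℂ H}

theorem inner_pow_adjoint (adj : ∀ x y, ⟪e x, y⟫_ℂ = ⟪x, f y⟫_ℂ) (k : ℕ) (x y : H) :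
    ⟪(e ^ k) x, y⟫_ℂ = ⟪x, (f ^ k) y⟫_ℂ := by
  induction k generalizing x y with
  | zero => rfl
  | succ k ih => rw [pow_succ, Module.End.mul_apply, ih, adj, ← Module.End.mul_apply, ← pow_succ']

/-- Complete reducibility made explicit: $h$ is self-adjoint, so it has an orthonormal eigenbasis on
$\ker e$, and the strings generated by these eigenvectors are orthogonal and exhaust the space. -/
theorem exists_isStringBasis [FiniteDimensional ℂ H] (r : SlTwoRelations e f h)
    (adj : ∀ x y, ⟪e x, y⟫_ℂ = ⟪x, f y⟫_ℂ) (he : IsNilpotent e) :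
    ∃ (d : ℕ) (n : Fin d → ℕ) (b : Module.Basis (Σ i, Fin (n i + 1)) ℂ H),
      IsStringBasis e f h b := by
  classical
  have adj' : ∀ x y, ⟪f x, y⟫_ℂ = ⟪x, e y⟫_ℂ := fun x y => by
    rw [← inner_conj_symm, ← adj, inner_conj_symm]
  have hf : IsNilpotent f := by
    obtain ⟨M, hM⟩ := he
    refine ⟨M, LinearMap.ext fun x => ?_⟩
    rw [LinearMap.zero_apply, ← inner_self_eq_zero (𝕜 := ℂ), inner_pow_adjoint adj', hM]
    simp
  have hsym : ∀ x y, ⟪h x, y⟫_ℂ = ⟪x, h y⟫_ℂ := fun x y => by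
    rw [← r.e_f, ← r.e_f, inner_sub_left, inner_sub_right, adj, adj', adj', adj]
  have hP : ∀ x ∈ LinearMap.ker e, h x ∈ LinearMap.ker e := fun x hx => by
    rw [LinearMap.mem_ker] at hx ⊢
    simpa [hx] using (r.h_e x).symm
  let hh : Module.End ℂ (LinearMap.ker e) := h.restrict hP
  have hhsym : hh.IsSymmetric := fun x y => hsym x y
  let u := hhsym.eigenvectorBasis rfl
  have hu : ∀ i, h (u i) = ((hhsym.eigenvalues rfl i : ℝ) : ℂ) • (u i : H) := fun i =>
    congrArg Subtype.val (hhsym.apply_eigenvectorBasis rfl i)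
  have eu : ∀ i, e (u i) = 0 := fun i => (u i).2
  have u0 : ∀ i, (u i : H) ≠ 0 := fun i h0 => u.orthonormal.ne_zero i (Subtype.ext h0)
  choose n hn fn0 fne using fun i => r.exists_weight hf (hu i) (eu i) (u0 i)
  have hu' : ∀ i, h (u i) = (n i : ℂ) • (u i : H) := fun i => by rw [hu, hn]
  -- Going down a string by $f^k$ and back by $e^k$ only rescales the generator; this is all that
  -- orthogonality of the strings needs.
  have estep : ∀ i k, ∃ c : ℂ, (e ^ k) ((f ^ k) (u i : H)) = c • (u i : H) := fun i k => by
    induction k with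
    | zero => exact ⟨1, by simp⟩
    | succ k ih =>
      obtain ⟨c, hc⟩ := ih
      refine ⟨((k : ℂ) + 1) * ((n i : ℂ) - k) * c, ?_⟩
      rw [pow_succ e, Module.End.mul_apply, r.e_pow (hu' i) (eu i), map_smul, hc, smul_smul]
  -- Move $f^m$ across the inner product as $e^m$: the first $k$ factors return $f^ku_i$ to a
  -- multiple of $u_i$, and any further factor kills it. For $m=k$ the generators themselves are
  -- orthogonal.
  have ortho : ∀ i k j m, k ≤ m → (i, k) ≠ (j, m) →
      ⟪(f ^ m) (u j : H), (f ^ k) (u i : H)⟫_ℂ = 0 := fun i k j m hkm hne => by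
    rw [inner_pow_adjoint adj']
    obtain ⟨c, hc⟩ := estep i k
    rcases hkm.eq_or_lt with rfl | hlt
    · have hij : j ≠ i := fun hij => hne (by rw [hij])
      have : ⟪(u j : H), (u i : H)⟫_ℂ = 0 := u.orthonormal.2 hij
      rw [hc, inner_smul_right, this, mul_zero]
    · obtain ⟨t, rfl⟩ := Nat.exists_eq_add_of_lt hlt
      rw [show k + t + 1 = (t + 1) + k by ring, pow_add, Module.End.mul_apply, hc, map_smul,
        pow_succ, Module.End.mul_apply, eu]
      simp
  let w : (Σ i, Fin (n i + 1)) → H := fun p => (f ^ (p.2 : ℕ)) (u p.1 : H)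
  have hw0 : ∀ p, w p ≠ 0 := fun p => fne p.1 p.2 (Nat.lt_succ_iff.1 p.2.2)
  have hw : LinearIndependent ℂ w := by
    refine linearIndependent_of_ne_zero_of_inner_eq_zero hw0 ?_
    rintro ⟨i, k⟩ ⟨j, m⟩ hne
    have hne' : (i, (k : ℕ)) ≠ (j, (m : ℕ)) := by
      rintro h
      obtain ⟨rfl, h2⟩ := Prod.mk.inj h
      exact hne (by rw [Fin.ext h2])
    rcases le_total (k : ℕ) m with hkm | hkm
    · change ⟪(f ^ (k : ℕ)) (u i : H), (f ^ (m : ℕ)) (u j : H)⟫_ℂ = 0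
      rw [← inner_conj_symm, ortho i k j m hkm hne', map_zero]
    · exact ortho j m i k hkm hne'.symm
  let S := Submodule.span ℂ (Set.range w)
  have hmem : ∀ i k, (f ^ k) (u i : H) ∈ S := fun i k => by
    by_cases hk : k < n i + 1
    · exact Submodule.subset_span ⟨⟨i, ⟨k, hk⟩⟩, rfl⟩
    · obtain ⟨t, rfl⟩ := Nat.exists_eq_add_of_le (not_lt.1 hk)
      rw [add_comm, pow_add, Module.End.mul_apply, fn0, map_zero]
      exact S.zero_mem
  have hSf : ∀ x ∈ S, f x ∈ S := by
    have : S ≤ S.comap f := Submodule.span_le.2 (by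
      rintro _ ⟨p, rfl⟩
      change f ((f ^ (p.2 : ℕ)) (u p.1 : H)) ∈ S
      rw [← Module.End.mul_apply, ← pow_succ']
      exact hmem _ _)
    exact this
  -- The span of the strings is $f$-stable, so its complement is stable under the adjoint $e$.
  have hSe : ∀ x ∈ Sᗮ, e x ∈ Sᗮ := fun x hx => by
    rw [Submodule.mem_orthogonal] at hx ⊢
    intro y hy
    rw [← adj']
    exact hx _ (hSf y hy)
  have htop : ⊤ ≤ S := by
    rw [top_le_iff, ← Submodule.orthogonal_eq_bot_iff, Submodule.eq_bot_iff]
    intro x hx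
    -- Applying the nilpotent $e$ to a nonzero vector of the complement, the last nonzero vector
    -- lies in $\ker e$ and is orthogonal to all generators $u_i$, which form a basis of $\ker e$.
    by_contra hx0
    obtain ⟨M, hM⟩ := he
    have hex : ∃ k, (e ^ k) x = 0 := ⟨M, by rw [hM]; rfl⟩
    have h0 : Nat.find hex ≠ 0 := fun h0 => hx0 (by simpa [h0] using Nat.find_spec hex)
    obtain ⟨k, hk⟩ := Nat.exists_eq_succ_of_ne_zero h0
    have hz : (e ^ (k + 1)) x = 0 := by simpa [hk] using Nat.find_spec hex
    have hy0 : (e ^ k) x ≠ 0 := Nat.find_min hex (by omega)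
    have hyS : ∀ j, (e ^ j) x ∈ Sᗮ := fun j => by
      induction j with
      | zero => exact hx
      | succ j ih => rw [pow_succ', Module.End.mul_apply]; exact hSe _ ih
    have hker : e ((e ^ k) x) = 0 := by rw [← Module.End.mul_apply, ← pow_succ', hz]
    let y : LinearMap.ker e := ⟨(e ^ k) x, hker⟩
    have : y = 0 := by
      refine u.repr.injective (PiLp.ext fun i => ?_)
      rw [map_zero, u.repr_apply_apply]
      have := (Submodule.mem_orthogonal _ _).1 (hyS k) _ (hmem i 0)
      simpa using this
    exact hy0 (congrArg Subtype.val this)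
  refine ⟨_, n, Module.Basis.mk hw htop, ?_⟩
  have hb : ∀ i, Module.Basis.mk hw htop ⟨i, 0⟩ = (u i : H) := fun i => by
    simp [Module.Basis.mk_apply, w]
  constructor
  · intro i k; rw [hb]; exact r.h_pow (hu' i) k
  · intro i; rw [hb]; exact eu i
  · intro i k; rw [hb]; exact r.e_pow (hu' i) (eu i) k
  · intro i; rw [hb]; exact fn0 i
  · intro i k; rw [hb]; exact Module.Basis.mk_apply _ _ _

end SlTwo

end Plethysm
end

noncomputable section

namespace Plethysm

/-! ### Tensor powers of $\mathbf{C}^2$ as Kronecker products, and their derivations. -/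

section TensorPower

variable {ι : Type} [Fintype ι] [DecidableEq ι]

/-- The Kronecker product of a family of `2 × 2` matrices. -/
def kron : (ι → Matrix (Fin 2) (Fin 2) ℂ) →* Matrix (ι → Fin 2) (ι → Fin 2) ℂ where
  toFun g := Matrix.of fun s s' => ∏ i, g i (s i) (s' i)
  map_one' := by
    ext s s'
    simp only [Matrix.of_apply, Pi.one_apply, Matrix.one_apply, Finset.prod_boole,
      Finset.mem_univ, true_imp_iff, funext_iff]
  map_mul' g h := by
    ext s s'
    simp only [Matrix.of_apply, Pi.mul_apply, Matrix.mul_apply, ← Finset.prod_mul_distrib,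
      Finset.prod_univ_sum, Fintype.piFinset_univ]

theorem kron_apply (g : ι → Matrix (Fin 2) (Fin 2) ℂ) (s s' : ι → Fin 2) :
    kron g s s' = ∏ i, g i (s i) (s' i) := rfl

theorem kron_conjTranspose (g : ι → Matrix (Fin 2) (Fin 2) ℂ) :
    (kron g).conjTranspose = kron fun i => (g i).conjTranspose := by
  ext s s'
  simp [kron_apply, Matrix.conjTranspose_apply]

theorem kron_mulSingle_apply (i : ι) (a : Matrix (Fin 2) (Fin 2) ℂ) (s s' : ι → Fin 2) :
    kron (Pi.mulSingle i a) s s' = a (s i) (s' i) *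
      ∏ j ∈ Finset.univ.erase i, (1 : Matrix (Fin 2) (Fin 2) ℂ) (s j) (s' j) := by
  rw [kron_apply, ← Finset.mul_prod_erase _ _ (Finset.mem_univ i), Pi.mulSingle_eq_same]
  congr 1
  refine Finset.prod_congr rfl fun j hj => ?_
  rw [Pi.mulSingle_eq_of_ne (Finset.ne_of_mem_erase hj)]

/-- The Kronecker product with the matrix `a` in position `i` and identity matrices elsewhere. -/
def slot (i : ι) : Matrix (Fin 2) (Fin 2) ℂ →+* Matrix (ι → Fin 2) (ι → Fin 2) ℂ :=
  { kron.comp (MonoidHom.mulSingle (fun _ : ι => Matrix (Fin 2) (Fin 2) ℂ) i) with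
    map_zero' := by
      ext s s'
      exact (kron_mulSingle_apply i 0 s s').trans (by simp)
    map_add' := fun a b => by
      ext s s'
      refine (kron_mulSingle_apply i (a + b) s s').trans ?_
      rw [Matrix.add_apply, add_mul]
      exact (congrArg₂ (· + ·) (kron_mulSingle_apply i a s s')
        (kron_mulSingle_apply i b s s')).symm }

theorem slot_eq_kron (i : ι) (a : Matrix (Fin 2) (Fin 2) ℂ) :
    slot i a = kron (Pi.mulSingle i a) := rfl

theorem slot_smul (i : ι) (c : ℂ) (a : Matrix (Fin 2) (Fin 2) ℂ) :
    slot i (c • a) = c • slot i a := by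
  ext s s'
  rw [Matrix.smul_apply, slot_eq_kron, slot_eq_kron, kron_mulSingle_apply, kron_mulSingle_apply,
    Matrix.smul_apply, smul_eq_mul, smul_eq_mul, mul_assoc]

theorem slot_conjTranspose (i : ι) (a : Matrix (Fin 2) (Fin 2) ℂ) :
    (slot i a).conjTranspose = slot i a.conjTranspose := by
  rw [slot_eq_kron, kron_conjTranspose, slot_eq_kron]
  congr 1
  funext j
  by_cases hj : j = i
  · subst hj; simp
  · simp [Pi.mulSingle_eq_of_ne hj]

theorem slot_commute {i j : ι} (hij : i ≠ j) (a b : Matrix (Fin 2) (Fin 2) ℂ) :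
    Commute (slot i a) (slot j b) := by
  have := (Pi.mulSingle_commute (f := fun _ : ι => Matrix (Fin 2) (Fin 2) ℂ) hij a b).eq
  rw [Commute, SemiconjBy, slot_eq_kron, slot_eq_kron, ← map_mul, ← map_mul, this]

/-- The derivation of the tensor power induced by a `2 × 2` matrix. -/
def slotSum (a : Matrix (Fin 2) (Fin 2) ℂ) : Matrix (ι → Fin 2) (ι → Fin 2) ℂ := ∑ i, slot i a

theorem slotSum_smul (c : ℂ) (a : Matrix (Fin 2) (Fin 2) ℂ) :
    slotSum (ι := ι) (c • a) = c • slotSum a := by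
  simp [slotSum, slot_smul, Finset.smul_sum]

theorem slotSum_conjTranspose (a : Matrix (Fin 2) (Fin 2) ℂ) :
    (slotSum (ι := ι) a).conjTranspose = slotSum a.conjTranspose := by
  simp [slotSum, Matrix.conjTranspose_sum, slot_conjTranspose]

/-- Operators in different tensor factors commute, so only the diagonal terms of the double sum
survive. -/
theorem slotSum_commutator (a b : Matrix (Fin 2) (Fin 2) ℂ) :
    slotSum (ι := ι) a * slotSum b - slotSum b * slotSum a = slotSum (a * b - b * a) := by
  simp only [slotSum, Finset.sum_mul_sum]
  rw [Finset.sum_comm (f := fun i j => slot i b * slot j a), ← Finset.sum_sub_distrib]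
  refine Finset.sum_congr rfl fun i _ => ?_
  rw [← Finset.sum_sub_distrib, Finset.sum_eq_single i]
  · rw [map_sub, map_mul, map_mul]
  · intro j _ hj
    rw [(slot_commute hj.symm a b).eq, sub_self]
  · simp

theorem slot_sq_zero (i : ι) {a : Matrix (Fin 2) (Fin 2) ℂ} (ha : a * a = 0) :
    slot i a ^ 2 = 0 := by
  rw [pow_two, ← map_mul, ha, map_zero]

theorem slot_commute_of_sq_zero (i j : ι) (a : Matrix (Fin 2) (Fin 2) ℂ) :
    Commute (slot i a) (slot j a) := by
  by_cases hij : i = j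
  · rw [hij]
  · exact slot_commute hij a a

theorem isNilpotent_sum_slot (s : Finset ι) {a : Matrix (Fin 2) (Fin 2) ℂ} (ha : a * a = 0) :
    IsNilpotent (∑ i ∈ s, slot i a) :=
  Commute.isNilpotent_sum (fun i _ => ⟨2, slot_sq_zero i ha⟩)
    fun i j _ _ => slot_commute_of_sq_zero i j a

/-- The slots commute and square to zero, so the exponential is a product of the factors $1+a$, one
for each position in `s`. Inserting the slots one at a time avoids any multinomial expansion. -/
theorem exp_sum_slot (s : Finset ι) {a : Matrix (Fin 2) (Fin 2) ℂ} (ha : a * a = 0) :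
    IsNilpotent.exp (∑ i ∈ s, slot i a) = kron fun i => if i ∈ s then 1 + a else 1 := by
  induction s using Finset.induction_on with
  | empty => 
    rw [Finset.sum_empty, IsNilpotent.exp_zero]
    simp only [Finset.notMem_empty, if_false]
    exact (map_one kron).symm
  | insert i s hi ih =>
    rw [Finset.sum_insert hi, IsNilpotent.exp_add_of_commute
      (Commute.sum_right _ _ _ fun j _ => slot_commute_of_sq_zero i j a)
      ⟨2, slot_sq_zero i ha⟩ (isNilpotent_sum_slot s ha), ih,
      IsNilpotent.exp_eq_sum (slot_sq_zero i ha)]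
    have : ∑ k ∈ Finset.range 2, ((k.factorial : ℚ)⁻¹) • slot i a ^ k = slot i (1 + a) := by
      simp [Finset.sum_range_succ]
    rw [this, slot_eq_kron, ← map_mul]
    congr 1
    funext j
    by_cases hj : j = i
    · subst hj; simp [hi]
    · simp [hj]

theorem exp_slotSum {a : Matrix (Fin 2) (Fin 2) ℂ} (ha : a * a = 0) :
    IsNilpotent.exp (slotSum (ι := ι) a) = kron fun _ => 1 + a := by
  simpa [slotSum] using exp_sum_slot (Finset.univ : Finset ι) ha

theorem slotSum_diagonal (p q : ℂ) :
    slotSum (ι := ι) !![p, 0; 0, q] = Matrix.diagonal fun s => ∑ i, if s i = 0 then p else q := by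
  ext s s'
  rw [slotSum, Matrix.sum_apply, Matrix.diagonal_apply]
  have key : ∀ i, slot i !![p, 0; 0, q] s s' = if s = s' then (if s i = 0 then p else q) else 0 := by
    intro i
    rw [slot_eq_kron, kron_apply]
    split_ifs with h h0
    · subst h
      rw [Finset.prod_eq_single i (fun j _ hj => by simp [Pi.mulSingle_eq_of_ne hj]) (by simp)]
      simp [h0]
    · subst h
      rw [Finset.prod_eq_single i (fun j _ hj => by simp [Pi.mulSingle_eq_of_ne hj]) (by simp)]
      have : s i = 1 := by omega
      simp [this]
    · obtain ⟨j, hj⟩ := Function.ne_iff.1 h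
      refine Finset.prod_eq_zero (Finset.mem_univ j) ?_
      by_cases hji : j = i
      · subst hji
        rw [Pi.mulSingle_eq_same]
        generalize s j = x at hj
        generalize s' j = y at hj
        fin_cases x <;> fin_cases y <;> simp_all
      · rw [Pi.mulSingle_eq_of_ne hji, Matrix.one_apply_ne hj]
  simp only [key]
  split_ifs <;> simp

theorem kron_diagonal (p q : ℂ) :
    kron (fun _ : ι => !![p, 0; 0, q]) =
      Matrix.diagonal fun s => ∏ i, if s i = 0 then p else q := by
  ext s s'
  rw [kron_apply, Matrix.diagonal_apply]
  split_ifs with h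
  · subst h
    refine Finset.prod_congr rfl fun i _ => ?_
    generalize s i = x
    fin_cases x <;> simp
  · obtain ⟨j, hj⟩ := Function.ne_iff.1 h
    refine Finset.prod_eq_zero (Finset.mem_univ j) ?_
    generalize s j = x at hj
    generalize s' j = y at hj
    fin_cases x <;> fin_cases y <;> simp_all

end TensorPower

end Plethysm
end

noncomputable section

namespace Plethysm

/-! ### Representations of $\mathrm{SL}_2(\mathbf{C})$ with a string basis, and their classification
by string lengths. -/

section StringRep

/-- The upper unitriangular matrix with off-diagonal entry `x`. -/
def upperSL2 (x : ℂ) : SL2 := ⟨!![1, x; 0, 1], by simp [Matrix.det_fin_two]⟩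

/-- The lower unitriangular matrix with off-diagonal entry `x`. -/
def lowerSL2 (x : ℂ) : SL2 := ⟨!![1, 0; x, 1], by simp [Matrix.det_fin_two]⟩

theorem upperSL2_val (x : ℂ) : (upperSL2 x).1 = !![1, x; 0, 1] := rfl

theorem lowerSL2_val (x : ℂ) : (lowerSL2 x).1 = !![1, 0; x, 1] := rfl

/-- Unipotents generate: a matrix with rows $(a,b)$, $(c,d)$ and $c\ne0$ is an upper, a lower and an
upper unipotent with parameters $(a-1)/c$, $c$, $(d-1)/c$. If $c=0$ then $d\neq0$, and right
multiplication by a lower unipotent moves $d$ into the lower left corner. -/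
theorem sl2_induction {p : SL2 → Prop} (mul : ∀ g h, p g → p h → p (g * h))
    (upper : ∀ x, p (upperSL2 x)) (lower : ∀ x, p (lowerSL2 x)) (g : SL2) : p g := by
  have main : ∀ g : SL2, g.1 1 0 ≠ 0 → p g := by
    intro g hc
    have hdet := g.2
    rw [Matrix.det_fin_two] at hdet
    have : g = upperSL2 ((g.1 0 0 - 1) / g.1 1 0) * lowerSL2 (g.1 1 0) *
        upperSL2 ((g.1 1 1 - 1) / g.1 1 0) := by
      refine Subtype.ext ?_
      rw [Matrix.SpecialLinearGroup.coe_mul, Matrix.SpecialLinearGroup.coe_mul, upperSL2_val,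
        lowerSL2_val, upperSL2_val]
      conv_lhs => rw [Matrix.eta_fin_two g.1]
      rw [Matrix.mul_fin_two, Matrix.mul_fin_two]
      congr! 4
      · field_simp; ring
      · field_simp; linear_combination -hdet
      · ring
      · refine congrArg (fun z => ![z]) ?_
        field_simp
        ring
    rw [this]
    exact mul _ _ (mul _ _ (upper _) (lower _)) (upper _)
  by_cases hc : g.1 1 0 = 0
  · have h1 : p (g * lowerSL2 1) := by
      refine main _ fun h => ?_
      have hdet := g.2
      rw [Matrix.det_fin_two, hc] at hdet
      rw [Matrix.SpecialLinearGroup.coe_mul, lowerSL2_val, Matrix.mul_apply,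
        Fin.sum_univ_two, hc] at h
      simp only [Matrix.of_apply, Matrix.cons_val', Matrix.cons_val_zero, Matrix.cons_val_one,
        Matrix.cons_val_fin_one, mul_one, zero_add] at h
      simp [h] at hdet
    have : g = g * lowerSL2 1 * lowerSL2 (-1) := by
      have : lowerSL2 1 * lowerSL2 (-1) = 1 := by
        refine Subtype.ext ?_
        rw [Matrix.SpecialLinearGroup.coe_mul, lowerSL2_val, lowerSL2_val, Matrix.mul_fin_two]
        simp [Matrix.one_fin_two]
      rw [mul_assoc, this, mul_one]
    rw [this]
    exact mul _ _ h1 (lower _)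
  · exact main g hc

variable {V W : Type} [AddCommGroup V] [Module ℂ V] [AddCommGroup W] [Module ℂ W]

/-- The exponential series of `x e`, truncated at degree `M`. -/
def truncExp (M : ℕ) (e : Module.End ℂ V) (x : ℂ) : Module.End ℂ V :=
  ∑ j ∈ Finset.range M, (x ^ j / j.factorial) • e ^ j

theorem truncExp_apply (M : ℕ) (e : Module.End ℂ V) (x : ℂ) (v : V) :
    truncExp M e x v = ∑ j ∈ Finset.range M, (x ^ j / j.factorial) • (e ^ j) v := by
  simp [truncExp, LinearMap.sum_apply]

theorem truncExp_semiconj (M : ℕ) {e : Module.End ℂ V} {e' : Module.End ℂ W} (φ : V →ₗ[ℂ] W)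
    (h : ∀ v, φ (e v) = e' (φ v)) (x : ℂ) (v : V) :
    φ (truncExp M e x v) = truncExp M e' x (φ v) := by
  have hp : ∀ (j : ℕ) v, φ ((e ^ j) v) = (e' ^ j) (φ v) := fun j => by
    induction j with
    | zero => intro v; rfl
    | succ j ih => intro v; rw [pow_succ, Module.End.mul_apply, ih, h, ← Module.End.mul_apply,
        ← pow_succ]
  simp only [truncExp_apply, map_sum, map_smul, hp]

/-- A representation of `SL₂(ℂ)` obtained by exponentiating an `𝔰𝔩₂`-action with a string
basis. -/
structure IsStringRep (ρ : Representation ℂ SL2 V) {d : ℕ} (n : Fin d → ℕ) : Prop where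
  exists_basis : ∃ (e f h : Module.End ℂ V) (b : Module.Basis (Σ i, Fin (n i + 1)) ℂ V),
    IsStringBasis e f h b ∧
    (∃ M₀, ∀ M ≥ M₀, ∀ x, ρ (upperSL2 x) = truncExp M e x ∧ ρ (lowerSL2 x) = truncExp M f x) ∧
    ∀ (Q : ℂˣ) i k, ρ (diagSL2 Q) (b ⟨i, k⟩) =
      ((Q ^ (2 * (k : ℤ) - (n i : ℤ)) : ℂˣ) : ℂ) • b ⟨i, k⟩

theorem trace_of_basis_eigenvectors {κ : Type} [Fintype κ] (b : Module.Basis κ ℂ V)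
    (g : Module.End ℂ V) (c : κ → ℂ) (h : ∀ i, g (b i) = c i • b i) :
    LinearMap.trace ℂ V g = ∑ i, c i := by
  classical
  rw [LinearMap.trace_eq_matrix_trace ℂ b, Matrix.trace]
  refine Finset.sum_congr rfl fun i _ => ?_
  rw [Matrix.diag_apply, LinearMap.toMatrix_apply, h]
  simp

theorem IsStringRep.trace_diag {ρ : Representation ℂ SL2 V} {d : ℕ} {n : Fin d → ℕ}
    (h : IsStringRep ρ n) (Q : ℂˣ) : LinearMap.trace ℂ V (ρ (diagSL2 Q)) =
      ∑ p : Σ i, Fin (n i + 1), ((Q ^ (2 * (p.2 : ℤ) - (n p.1 : ℤ)) : ℂˣ) : ℂ) := by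
  obtain ⟨e, f, h, b, -, -, hd⟩ := h.exists_basis
  exact trace_of_basis_eigenvectors b _ _ fun p => hd Q p.1 p.2

/-- Matching the basis vectors of strings of equal length commutes with $f$ by construction. It
commutes with $e$ because the action of $e$ on a string depends only on its length, and then with
the generating unipotents, which are polynomials in $e$ or $f$. -/
theorem IsStringRep.nonempty_equiv {ρ : Representation ℂ SL2 V} {σ : Representation ℂ SL2 W}
    {d d' : ℕ} {n : Fin d → ℕ} {n' : Fin d' → ℕ} (hρ : IsStringRep ρ n) (hσ : IsStringRep σ n')
    (τ : Fin d ≃ Fin d') (hτ : ∀ i, n' (τ i) = n i) : Nonempty (ρ.Equiv σ) := by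
  obtain ⟨e, f, h, b, hb, ⟨M₁, hM₁⟩, -⟩ := hρ.exists_basis
  obtain ⟨e', f', h', b', hb', ⟨M₂, hM₂⟩, -⟩ := hσ.exists_basis
  let E : (Σ i, Fin (n i + 1)) ≃ Σ i, Fin (n' i + 1) :=
    Equiv.sigmaCongr τ fun i => finCongr (by rw [hτ])
  let φ : V ≃ₗ[ℂ] W := b.equiv b' E
  have hφ0 : ∀ i, φ (b ⟨i, 0⟩) = b' ⟨τ i, 0⟩ := fun i => by
    rw [Module.Basis.equiv_apply]
    congr 1
  have hφ : ∀ i (k : ℕ), φ ((f ^ k) (b ⟨i, 0⟩)) = (f' ^ k) (b' ⟨τ i, 0⟩) := fun i k => by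
    by_cases hk : k < n i + 1
    · have h1 := hb.apply i ⟨k, hk⟩
      have h2 := hb'.apply (τ i) ⟨k, by rw [hτ]; exact hk⟩
      simp only at h1 h2
      rw [← h1, ← h2, Module.Basis.equiv_apply]
      congr 1
    · obtain ⟨t, rfl⟩ := Nat.exists_eq_add_of_le (not_lt.1 hk)
      have h2 : (f' ^ (n i + 1)) (b' ⟨τ i, 0⟩) = 0 :=
        (congrArg (fun m => (f' ^ (m + 1)) (b' ⟨τ i, 0⟩)) (hτ i)).symm.trans (hb'.f_pow _)
      rw [add_comm, pow_add, Module.End.mul_apply, hb.f_pow, map_zero, map_zero, pow_add,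
        Module.End.mul_apply, h2, map_zero]
  have hf : ∀ v, φ (f v) = f' (φ v) := by
    intro v
    refine LinearMap.congr_fun (f := φ.toLinearMap ∘ₗ f) (g := f' ∘ₗ φ.toLinearMap)
      (b.ext fun ⟨i, k⟩ => ?_) v
    simp only [LinearMap.comp_apply, LinearEquiv.coe_coe, hb.apply i k]
    rw [hφ, ← Module.End.mul_apply, ← pow_succ', hφ, pow_succ', Module.End.mul_apply]
  have he : ∀ v, φ (e v) = e' (φ v) := by
    intro v
    refine LinearMap.congr_fun (f := φ.toLinearMap ∘ₗ e) (g := e' ∘ₗ φ.toLinearMap)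
      (b.ext fun ⟨i, k⟩ => ?_) v
    simp only [LinearMap.comp_apply, LinearEquiv.coe_coe, hb.apply i k]
    rcases (k : ℕ) with _ | k
    · rw [hφ]
      simp [hb.e_zero, hb'.e_zero]
    · have hc : ((n' (τ i) : ℕ) : ℂ) = n i := by rw [hτ]
      rw [hφ, hb.e_pow, hb'.e_pow, map_smul, hφ, hc]
  have hφg : ∀ g v, φ (ρ g v) = σ g (φ v) := by
    intro g
    refine sl2_induction (p := fun g => ∀ v, φ (ρ g v) = σ g (φ v)) ?_ ?_ ?_ g
    · intro g h hg hh v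
      rw [map_mul, map_mul, Module.End.mul_apply, Module.End.mul_apply, hg, hh]
    · intro x v
      rw [(hM₁ (max M₁ M₂) (le_max_left _ _) x).1, (hM₂ (max M₁ M₂) (le_max_right _ _) x).1]
      exact truncExp_semiconj _ φ.toLinearMap he x v
    · intro x v
      rw [(hM₁ (max M₁ M₂) (le_max_left _ _) x).2, (hM₂ (max M₁ M₂) (le_max_right _ _) x).2]
      exact truncExp_semiconj _ φ.toLinearMap hf x v
  exact ⟨Representation.Equiv.mk φ fun g => LinearMap.ext (hφg g)⟩

end StringRep

/-! ### Equivariant quotients of tensor powers. -/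

section TensorQuotient

open scoped InnerProductSpace

/-- Each linear functional reduces this to a scalar polynomial vanishing on all of $\mathbf{C}$. -/
theorem vector_polynomial_eq_zero {V : Type} [AddCommGroup V] [Module ℂ V] (M : ℕ) (w : ℕ → V)
    (h : ∀ x : ℂ, ∑ j ∈ Finset.range M, x ^ j • w j = 0) : ∀ j < M, w j = 0 := by
  intro j hj
  rw [← Module.forall_dual_apply_eq_zero_iff ℂ]
  intro ψ
  let p : Polynomial ℂ := ∑ j ∈ Finset.range M, Polynomial.monomial j (ψ (w j))
  have hp : p = 0 := Polynomial.funext fun x => by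
    have := congrArg ψ (h x)
    simpa [p, Polynomial.eval_finsetSum, mul_comm] using this
  have := congrArg (fun q => Polynomial.coeff q j) hp
  simpa [p, Polynomial.finsetSum_coeff, Polynomial.coeff_monomial, hj] using this

variable {ι : Type} [Fintype ι] [DecidableEq ι]

local notation "Tens" => EuclideanSpace ℂ (ι → Fin 2)

/-- Matrices as endomorphisms of Euclidean space. -/
def matEnd : Matrix (ι → Fin 2) (ι → Fin 2) ℂ ≃ₐ[ℂ] Module.End ℂ Tens :=
  Matrix.toLpLinAlgEquiv 2

theorem matEnd_diagonal_apply (c : (ι → Fin 2) → ℂ) (x : Tens) (s : ι → Fin 2) :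
    matEnd (Matrix.diagonal c) x s = c s * x s :=
  Matrix.mulVec_diagonal c x.ofLp s

/-- The action of `SL₂(ℂ)` on a tensor power of `ℂ²`. -/
def tensAct (g : SL2) : Module.End ℂ Tens := matEnd (kron fun _ => g.1)

theorem matEnd_slotSum_pow (a : Matrix (Fin 2) (Fin 2) ℂ) (ha : a * a = 0) :
    ∃ M₀, matEnd (slotSum (ι := ι) a) ^ M₀ = 0 := by
  obtain ⟨M, hM⟩ := isNilpotent_sum_slot (Finset.univ : Finset ι) ha
  exact ⟨M, by rw [← map_pow, slotSum, hM, map_zero]⟩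

theorem matEnd_kron_unipotent {a : Matrix (Fin 2) (Fin 2) ℂ} (ha : a * a = 0) {M : ℕ}
    (hM : matEnd (slotSum (ι := ι) a) ^ M = 0) (x : ℂ) :
    matEnd (kron fun _ : ι => 1 + x • a) = truncExp M (matEnd (slotSum a)) x := by
  have hxa : (x • a) * (x • a) = 0 := by simp [ha]
  have hpow : slotSum (ι := ι) (x • a) ^ M = 0 := by
    have : slotSum (ι := ι) a ^ M = 0 := by
      refine (matEnd (ι := ι)).injective ?_
      rw [map_pow, hM, map_zero]
    rw [slotSum_smul, smul_pow, this, smul_zero]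
  rw [← exp_slotSum hxa, IsNilpotent.exp_eq_sum hpow, map_sum, truncExp]
  refine Finset.sum_congr rfl fun j _ => ?_
  rw [slotSum_smul, smul_pow, ← map_pow, ← map_smul]
  congr 1
  rw [div_eq_inv_mul, mul_smul]
  -- `IsNilpotent.exp` carries rational coefficients, `truncExp` complex ones.
  have : ∀ B : Matrix (ι → Fin 2) (ι → Fin 2) ℂ,
      (j.factorial : ℚ)⁻¹ • B = ((j.factorial : ℂ)⁻¹) • B := fun B => by
    ext s s'
    simp [Rat.smul_def]
  exact this _

theorem matEnd_adjoint {A B : Matrix (ι → Fin 2) (ι → Fin 2) ℂ} (h : A.conjTranspose = B)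
    (x y : Tens) : ⟪matEnd A x, y⟫_ℂ = ⟪x, matEnd B y⟫_ℂ := by
  have := Matrix.toEuclideanLin_conjTranspose_eq_adjoint A
  rw [h] at this
  change ⟪Matrix.toEuclideanLin A x, y⟫_ℂ = ⟪x, Matrix.toEuclideanLin B y⟫_ℂ
  rw [this, LinearMap.adjoint_inner_right]

theorem slotSum_relations : SlTwoRelations
    (matEnd (slotSum (ι := ι) !![0, 1; 0, 0])) (matEnd (slotSum !![0, 0; 1, 0]))
    (matEnd (slotSum !![1, 0; 0, -1])) := by
  have key : ∀ a b c : Matrix (Fin 2) (Fin 2) ℂ, a * b - b * a = c → ∀ x : Tens,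
      matEnd (slotSum a) (matEnd (slotSum b) x) - matEnd (slotSum b) (matEnd (slotSum a) x) =
        matEnd (slotSum c) x := fun a b c h x => by
    rw [← h, ← slotSum_commutator, map_sub, map_mul, map_mul]
    rfl
  refine ⟨key _ _ _ (by simp), fun x => ?_, fun x => ?_⟩
  · rw [← sub_eq_iff_eq_add', key _ _ ((2 : ℂ) • !![0, 1; 0, 0])
      (by ext i j; fin_cases i <;> fin_cases j <;> norm_num [Matrix.mul_apply])]
    rw [slotSum_smul, map_smul]
    rfl
  · rw [sub_eq_add_neg, ← neg_smul, ← sub_eq_iff_eq_add', key _ _ ((-2 : ℂ) • !![0, 0; 1, 0])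
      (by ext i j; fin_cases i <;> fin_cases j <;> norm_num [Matrix.mul_apply])]
    rw [slotSum_smul, map_smul]
    rfl

theorem zpow_sum_eq_prod {κ G : Type} [CommGroup G] (g : G) (s : Finset κ) (a : κ → ℤ) :
    g ^ (∑ i ∈ s, a i) = ∏ i ∈ s, g ^ a i := by
  classical
  induction s using Finset.induction_on with
  | empty => simp
  | insert i s hi ih => rw [Finset.sum_insert hi, Finset.prod_insert hi, zpow_add, ih]

/-- Both $h$ and the torus are diagonal in the tensor basis. On the support of a vector of weight
$w$ the count of indices $0$ minus that of indices $1$ is $w$; since $Q^{-1}$ acts on the first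
basis vector, the scalar is $Q^{-w}$. -/
theorem tensAct_diag_of_weight {x : Tens} {w : ℤ}
    (hx : matEnd (slotSum !![1, 0; 0, -1]) x = (w : ℂ) • x) (Q : ℂˣ) :
    tensAct (diagSL2 Q) x = ((Q ^ (-w) : ℂˣ) : ℂ) • x := by
  have hA : (diagSL2 Q).1 = !![((Q⁻¹ : ℂˣ) : ℂ), 0; 0, (Q : ℂ)] := rfl
  ext s
  rw [tensAct, hA, kron_diagonal, matEnd_diagonal_apply, PiLp.smul_apply, smul_eq_mul]
  by_cases hs : x s = 0
  · rw [hs, mul_zero, mul_zero]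
  congr 1
  have h1 := congrArg (fun y : Tens => y s) hx
  simp only [slotSum_diagonal, matEnd_diagonal_apply, PiLp.smul_apply, smul_eq_mul] at h1
  have h2 : (∑ i, if s i = 0 then (1 : ℤ) else -1) = w := by
    have := mul_right_cancel₀ hs h1
    exact_mod_cast this
  rw [← h2, ← Finset.sum_neg_distrib, zpow_sum_eq_prod, Units.coe_prod]
  refine Finset.prod_congr rfl fun i _ => ?_
  split_ifs <;> simp

theorem isStringRep_of_surjective {V : Type} [AddCommGroup V] [Module ℂ V]
    (ρ : Representation ℂ SL2 V) (π : Tens →ₗ[ℂ] V) (hπ : Function.Surjective π)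
    (hρ : ∀ g x, π (tensAct g x) = ρ g (π x)) : ∃ (d : ℕ) (n : Fin d → ℕ), IsStringRep ρ n := by
  set e := matEnd (slotSum (ι := ι) !![0, 1; 0, 0]) with he
  set f := matEnd (slotSum (ι := ι) !![0, 0; 1, 0]) with hf
  set h := matEnd (slotSum (ι := ι) !![1, 0; 0, -1]) with hh
  have r : SlTwoRelations e f h := slotSum_relations
  have adj : ∀ x y, ⟪e x, y⟫_ℂ = ⟪x, f y⟫_ℂ := matEnd_adjoint (by
    rw [slotSum_conjTranspose]
    congr 1
    ext i j; fin_cases i <;> fin_cases j <;> simp [Matrix.conjTranspose_apply])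
  have adj' : ∀ x y, ⟪f x, y⟫_ℂ = ⟪x, e y⟫_ℂ := fun x y => by
    rw [← inner_conj_symm, ← adj, inner_conj_symm]
  have e2 : (!![0, 1; 0, 0] : Matrix (Fin 2) (Fin 2) ℂ) * !![0, 1; 0, 0] = 0 := by
    ext i j; fin_cases i <;> fin_cases j <;> simp
  have f2 : (!![0, 0; 1, 0] : Matrix (Fin 2) (Fin 2) ℂ) * !![0, 0; 1, 0] = 0 := by
    ext i j; fin_cases i <;> fin_cases j <;> simp
  obtain ⟨M₁, hM₁⟩ := matEnd_slotSum_pow (ι := ι) _ e2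
  obtain ⟨M₂, hM₂⟩ := matEnd_slotSum_pow (ι := ι) _ f2
  have upper : ∀ M ≥ M₁, ∀ x, tensAct (upperSL2 x) = truncExp M e x := fun M hM x => by
    rw [he, ← matEnd_kron_unipotent e2 (pow_eq_zero_of_le hM hM₁), tensAct, upperSL2_val]
    congr! 3
    ext i j; fin_cases i <;> fin_cases j <;> simp
  have lower : ∀ M ≥ M₂, ∀ x, tensAct (lowerSL2 x) = truncExp M f x := fun M hM x => by
    rw [hf, ← matEnd_kron_unipotent f2 (pow_eq_zero_of_le hM hM₂), tensAct, lowerSL2_val]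
    congr! 3
    ext i j; fin_cases i <;> fin_cases j <;> simp
  -- The kernel is stable under the unipotent group, hence under its infinitesimal generator: this
  -- is the coefficient of $x^1$ in a vector-valued polynomial that vanishes identically. The bound
  -- `M₀ + 2` keeps that coefficient within the truncation.
  have stable : ∀ (a : Module.End ℂ Tens) (u : ℂ → SL2) (M₀ : ℕ),
      (∀ M ≥ M₀, ∀ x, tensAct (u x) = truncExp M a x) →
      ∀ y, π y = 0 → π (a y) = 0 := fun a u M₀ hu y hy => by
    have := vector_polynomial_eq_zero (M₀ + 2)
      (fun j => ((j.factorial : ℂ)⁻¹) • π ((a ^ j) y)) (fun x => by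
        have h1 := hρ (u x) y
        rw [hy, map_zero, hu (M₀ + 2) (by omega), truncExp_apply, map_sum] at h1
        rw [← h1]
        refine Finset.sum_congr rfl fun j _ => ?_
        rw [map_smul, smul_smul, div_eq_mul_inv]) 1 (by omega)
    simpa using this
  -- The complement of the kernel is stable because $e$ and $f$ are adjoint to each other, and `π`
  -- maps it isomorphically onto the quotient. The string basis found there is transported along
  -- this isomorphism.
  let S := (LinearMap.ker π)ᗮ
  have hSe : ∀ x ∈ S, e x ∈ S := fun x hx => by
    rw [Submodule.mem_orthogonal] at hx ⊢
    intro y hy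
    rw [← adj']
    exact hx _ (stable f lowerSL2 M₂ lower y hy)
  have hSf : ∀ x ∈ S, f x ∈ S := fun x hx => by
    rw [Submodule.mem_orthogonal] at hx ⊢
    intro y hy
    rw [← adj]
    exact hx _ (stable e upperSL2 M₁ upper y hy)
  have hSh : ∀ x ∈ S, h x ∈ S := fun x hx => by
    rw [← r.e_f]
    exact S.sub_mem (hSe _ (hSf _ hx)) (hSf _ (hSe _ hx))
  let eS := e.restrict hSe
  let fS := f.restrict hSf
  let hS := h.restrict hSh
  have rS : SlTwoRelations eS fS hS :=
    ⟨fun x => Subtype.ext (r.e_f x), fun x => Subtype.ext (r.h_e x),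
      fun x => Subtype.ext (r.h_f x)⟩
  have heS : IsNilpotent eS := by
    refine ⟨M₁, LinearMap.ext fun x => Subtype.ext ?_⟩
    rw [Module.End.pow_restrict]
    simpa using LinearMap.congr_fun hM₁ x.1
  obtain ⟨d, n, b, hb⟩ := exists_isStringBasis rS (fun x y => adj x y) heS
  have hbij : Function.Bijective (π ∘ₗ S.subtype) := by
    constructor
    · rw [← LinearMap.ker_eq_bot, LinearMap.ker_eq_bot']
      intro x hx
      have hx' : (x : Tens) ∈ LinearMap.ker π := hx
      have := (Submodule.mem_orthogonal _ _).1 x.2 _ hx'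
      exact Subtype.ext (inner_self_eq_zero.1 this)
    · intro v
      obtain ⟨y, rfl⟩ := hπ v
      obtain ⟨k, hk, s, hs, rfl⟩ := (LinearMap.ker π).exists_add_mem_mem_orthogonal y
      refine ⟨⟨s, hs⟩, ?_⟩
      rw [map_add, LinearMap.mem_ker.1 hk, zero_add]
      rfl
  let θ : S ≃ₗ[ℂ] V := LinearEquiv.ofBijective _ hbij
  have hθ : ∀ s : S, θ s = π s := fun s => rfl
  have conj : ∀ (a : Module.End ℂ S) s, θ.conj a (θ s) = θ (a s) := fun a s => by
    simp [LinearEquiv.conj_apply]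
  have conj_pow : ∀ (a : Module.End ℂ S) (k : ℕ) s, (θ.conj a ^ k) (θ s) = θ ((a ^ k) s) :=
    fun a k s => by
      induction k with
      | zero => rfl
      | succ k ih => rw [pow_succ', Module.End.mul_apply, ih, conj, ← Module.End.mul_apply,
          ← pow_succ']
  have trunc : ∀ (a : Module.End ℂ Tens) (ha : ∀ x ∈ S, a x ∈ S) (u : SL2) (M : ℕ) (x : ℂ),
      tensAct u = truncExp M a x → ρ u = truncExp M (θ.conj (a.restrict ha)) x :=
    fun a ha u M x hu => by
      refine LinearMap.ext fun v => ?_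
      obtain ⟨s, rfl⟩ := θ.surjective v
      rw [hθ, ← hρ, hu]
      change _ = truncExp M _ x (θ.toLinearMap s)
      rw [← truncExp_semiconj M θ.toLinearMap (fun s => (conj _ s).symm)]
      change _ = π (S.subtype _)
      rw [truncExp_semiconj M S.subtype (e' := a) (fun s => rfl)]
      rfl
  refine ⟨d, n, ⟨θ.conj eS, θ.conj fS, θ.conj hS, b.map θ, ?_, ⟨max M₁ M₂, fun M hM x =>
    ⟨trunc e hSe _ M x (upper M ((le_max_left _ _).trans hM) x),
      trunc f hSf _ M x (lower M ((le_max_right _ _).trans hM) x)⟩⟩, ?_⟩⟩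
  · constructor
    · intro i k
      rw [b.map_apply, conj_pow, conj, hb.h_pow, map_smul]
    · intro i
      rw [b.map_apply, conj, hb.e_zero, map_zero]
    · intro i k
      rw [b.map_apply, conj_pow, conj, conj_pow, hb.e_pow, map_smul]
    · intro i
      rw [b.map_apply, conj_pow, hb.f_pow, map_zero]
    · intro i k
      rw [b.map_apply, b.map_apply, conj_pow, ← hb.apply]
  · intro Q i k
    have h1 := congrArg Subtype.val (hb.h_pow i k)
    rw [← hb.apply] at h1
    rw [b.map_apply, hθ, ← hρ, tensAct_diag_of_weight (w := (n i : ℤ) - 2 * k)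
      (by push_cast; exact h1), map_smul, neg_sub]

end TensorQuotient

end Plethysm
end

open scoped TensorProduct
noncomputable section

namespace Plethysm

/-! ### Multilinearity, column antisymmetry and Garnir relations for polytabloids. -/

section Polytabloids

theorem exists_equiv_of_card_fibers_eq {α β γ : Type} [Finite α] [Finite β] (f : α → γ)
    (g : β → γ) (h : ∀ c, Nat.card {a // f a = c} = Nat.card {b // g b = c}) :
    ∃ σ : α ≃ β, ∀ a, g (σ a) = f a :=
  ⟨Equiv.ofFiberEquiv fun c => (Finite.card_eq.1 (h c)).some, fun a =>
    Equiv.ofFiberEquiv_map _ a⟩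

theorem multilinear_mem_span {ι κ V W : Type} [Fintype ι] [Fintype κ] [AddCommGroup V]
    [Module ℂ V] [AddCommGroup W] [Module ℂ W] (m : MultilinearMap ℂ (fun _ : ι => V) W)
    (ε : κ → V) (hε : ⊤ ≤ Submodule.span ℂ (Set.range ε)) (t : ι → V) :
    m t ∈ Submodule.span ℂ (Set.range fun s : ι → κ => m fun i => ε (s i)) := by
  classical
  choose c hc using fun i =>
    (Submodule.mem_span_range_iff_exists_fun ℂ).1 (hε (Submodule.mem_top (x := t i)))
  rw [← funext hc, m.map_sum]
  refine Submodule.sum_mem _ fun s _ => ?_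
  rw [m.map_smul_univ]
  exact Submodule.smul_mem _ _ (Submodule.subset_span ⟨s, rfl⟩)

variable {lam : YoungDiagram} {V : Type} [AddCommGroup V] [Module ℂ V]

theorem mem_of_rowLen {i j : ℕ} (h : j < lam.rowLen i) : (i, j) ∈ lam.cells :=
  (YoungDiagram.mem_cells _).2 (YoungDiagram.mem_iff_lt_rowLen.2 h)

theorem cell_lt_rowLen (c : lam.cells) : c.1.2 < lam.rowLen c.1.1 :=
  YoungDiagram.mem_iff_lt_rowLen.1 ((YoungDiagram.mem_cells _).1 c.2)

theorem cell_lt_colLen (c : lam.cells) : c.1.1 < lam.colLen c.1.2 :=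
  YoungDiagram.mem_iff_lt_colLen.1 ((YoungDiagram.mem_cells _).1 c.2)

variable (lam) in
/-- The boxes of a Young diagram, indexed by row and position in the row. -/
def cellEquiv : (Σ i : Fin (lam.colLen 0), Fin (lam.rowLen i)) ≃ lam.cells where
  toFun p := ⟨(p.1, p.2), mem_of_rowLen p.2.2⟩
  invFun c := ⟨⟨c.1.1, (cell_lt_colLen c).trans_le (lam.colLen_anti _ _ (Nat.zero_le _))⟩,
    ⟨c.1.2, cell_lt_rowLen c⟩⟩
  left_inv _ := rfl
  right_inv _ := rfl

variable (lam V) in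
/-- `rowProduct` as a multilinear map. -/
def rowProductMulti : MultilinearMap ℂ (fun _ : lam.cells => V) (RowTensor lam V) :=
  MultilinearMap.domDomCongr (cellEquiv lam)
    (MultilinearMap.compMultilinearMap
      (PiTensorProduct.tprod ℂ
        (s := fun i : Fin (lam.colLen 0) => SymmetricPower ℂ (Fin (lam.rowLen i)) V))
      (fun _ => SymmetricPower.tprod ℂ))

/-- The sign of a permutation as a complex number. -/
def csign (τ : Equiv.Perm lam.cells) : ℂ := ((Equiv.Perm.sign τ : ℤ) : ℂ)

theorem csign_mul (σ τ : Equiv.Perm lam.cells) : csign (σ * τ) = csign σ * csign τ := by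
  simp [csign]

theorem csign_inv (σ : Equiv.Perm lam.cells) : csign σ⁻¹ = csign σ := by
  simp [csign]

theorem csign_swap {a b : lam.cells} (h : a ≠ b) : csign (Equiv.swap a b) = -1 := by
  simp [csign, Equiv.Perm.sign_swap h]

theorem csign_mul_self (σ : Equiv.Perm lam.cells) : csign σ * csign σ = 1 := by
  rw [csign, ← Int.cast_mul, ← Units.val_mul, Int.units_mul_self]
  simp

theorem csign_one : csign (1 : Equiv.Perm lam.cells) = 1 := by
  simp [csign]

theorem polytabloid_eq_sum (t : lam.cells → V) : polytabloid t =
    ∑ τ : Equiv.Perm lam.cells with ∀ c, (τ c).1.2 = c.1.2,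
      csign τ • rowProduct fun c => t (τ⁻¹ c) :=
  Finset.sum_congr rfl fun _ _ => (Int.cast_smul_eq_zsmul ℂ _ _).symm

variable (lam V) in
/-- `polytabloid` as a multilinear map. -/
def polytabloidMulti : MultilinearMap ℂ (fun _ : lam.cells => V) (RowTensor lam V) :=
  ∑ τ : Equiv.Perm lam.cells with ∀ c, (τ c).1.2 = c.1.2,
    csign τ • (rowProductMulti lam V).domDomCongr τ⁻¹

theorem polytabloidMulti_apply (t : lam.cells → V) :
    polytabloidMulti lam V t = polytabloid t := by
  rw [polytabloidMulti, sum_apply, polytabloid_eq_sum]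
  rfl

theorem rowProduct_swap (t : lam.cells → V) {a b : lam.cells} (hab : a.1.1 = b.1.1) :
    rowProduct (fun c => t (Equiv.swap a b c)) = rowProduct t := by
  refine congrArg (PiTensorProduct.tprod ℂ) (funext fun i => ?_)
  by_cases hi : a.1.1 = i
  · have ha : a.1.2 < lam.rowLen i := hi ▸ cell_lt_rowLen a
    have hb : b.1.2 < lam.rowLen i := hi ▸ hab ▸ cell_lt_rowLen b
    refine Eq.trans (congrArg (SymmetricPower.tprod ℂ) (funext fun j => ?_))
      (SymmetricPower.tprod_equiv (R := ℂ)
        (Equiv.swap (⟨a.1.2, ha⟩ : Fin (lam.rowLen i)) ⟨b.1.2, hb⟩)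
        (fun j : Fin (lam.rowLen i) => t ⟨(i, j), mem_of_rowLen j.2⟩))
    refine congrArg t ?_
    have ea : ∀ j : Fin (lam.rowLen i),
        (⟨(i, j), mem_of_rowLen j.2⟩ : lam.cells) = a ↔ j = ⟨a.1.2, ha⟩ := fun j => by
      rw [Subtype.ext_iff, Prod.ext_iff, Fin.ext_iff]
      simp [hi]
    have eb : ∀ j : Fin (lam.rowLen i),
        (⟨(i, j), mem_of_rowLen j.2⟩ : lam.cells) = b ↔ j = ⟨b.1.2, hb⟩ := fun j => by
      rw [Subtype.ext_iff, Prod.ext_iff, Fin.ext_iff]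
      simp [← hab, hi]
    rw [Equiv.swap_apply_def, Equiv.swap_apply_def]
    simp only [ea, eb]
    split_ifs
    · exact ((eb ⟨b.1.2, hb⟩).2 rfl).symm
    · exact ((ea ⟨a.1.2, ha⟩).2 rfl).symm
    · rfl
  · refine congrArg (SymmetricPower.tprod ℂ) (funext fun j => ?_)
    refine congrArg t (Equiv.swap_apply_of_ne_of_ne (fun h => hi ?_) (fun h => hi ?_))
    · rw [← h]
    · rw [hab, ← h]

/-- The permutation of the boxes preserves each column. -/
def ColPreserving (τ : Equiv.Perm lam.cells) : Prop := ∀ c, (τ c).1.2 = c.1.2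

theorem ColPreserving.inv {τ : Equiv.Perm lam.cells} (h : ColPreserving τ) :
    ColPreserving τ⁻¹ := fun c => by
  have := h (τ⁻¹ c)
  rw [← Equiv.Perm.mul_apply, mul_inv_cancel, Equiv.Perm.one_apply] at this
  exact this.symm

theorem ColPreserving.mul {σ τ : Equiv.Perm lam.cells} (hσ : ColPreserving σ)
    (hτ : ColPreserving τ) : ColPreserving (σ * τ) := fun c => by
  rw [Equiv.Perm.mul_apply, hσ, hτ]

theorem colPreserving_swap {a b : lam.cells} (h : a.1.2 = b.1.2) :
    ColPreserving (Equiv.swap a b) := fun c => by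
  rw [Equiv.swap_apply_def]
  split_ifs with h1 h2
  · rw [h1, h]
  · rw [h2, h]
  · rfl

theorem polytabloid_comp (t : lam.cells → V) {σ : Equiv.Perm lam.cells} (hσ : ColPreserving σ) :
    polytabloid (fun c => t (σ c)) = csign σ • polytabloid t := by
  rw [polytabloid_eq_sum, polytabloid_eq_sum, Finset.smul_sum]
  refine Finset.sum_equiv (Equiv.mulRight σ⁻¹) (fun τ => ?_) (fun τ _ => ?_)
  · simp only [Finset.mem_filter, Finset.mem_univ, true_and]
    refine ⟨fun h => ColPreserving.mul h hσ.inv, fun h => ?_⟩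
    have := ColPreserving.mul h hσ
    rwa [Equiv.coe_mulRight, inv_mul_cancel_right] at this
  · rw [Equiv.coe_mulRight, smul_smul, csign_mul, csign_inv, mul_comm (csign τ), ← mul_assoc,
      csign_mul_self, one_mul]
    simp

theorem polytabloid_swap (t : lam.cells → V) {a b : lam.cells} (hab : a ≠ b)
    (hcol : a.1.2 = b.1.2) : polytabloid (fun c => t (Equiv.swap a b c)) = -polytabloid t := by
  rw [polytabloid_comp t (colPreserving_swap hcol), csign_swap hab]
  exact neg_one_smul ℂ (polytabloid t)

theorem polytabloid_eq_zero (t : lam.cells → V) {a b : lam.cells} (hab : a ≠ b)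
    (hcol : a.1.2 = b.1.2) (ht : t a = t b) : polytabloid t = 0 := by
  have h := polytabloid_swap t hab hcol
  have : (fun c => t (Equiv.swap a b c)) = t := by
    funext c
    rw [Equiv.swap_apply_def]
    split_ifs with h1 h2
    · rw [h1, ht]
    · rw [h2, ht]
    · rfl
  rw [this] at h
  have h2 : (2 : ℂ) • polytabloid t = 0 := by
    rw [two_smul]
    nth_rewrite 1 [h]
    exact neg_add_cancel _
  exact (smul_eq_zero.1 h2).resolve_left two_ne_zero

open scoped Classical in
/-- The Garnir relations. -/
theorem garnir_relation (t : lam.cells → V) (D : Set lam.cells)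
    (hD : ∀ τ : Equiv.Perm lam.cells, ColPreserving τ →
      ∃ a ∈ D, ∃ b ∈ D, a ≠ b ∧ (τ a).1.1 = (τ b).1.1) :
    ∑ σ : Equiv.Perm lam.cells with ∀ c ∉ D, σ c = c,
      csign σ • polytabloid (fun c => t (σ c)) = 0 := by
  simp only [polytabloid_eq_sum, Finset.smul_sum]
  rw [Finset.sum_comm]
  refine Finset.sum_eq_zero fun τ hτ => ?_
  obtain ⟨a, ha, b, hb, hab, hrow⟩ := hD τ (Finset.mem_filter.1 hτ).2
  -- For fixed `τ`, two boxes of `D` end up in one row. Composing `σ` with their transposition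
  -- leaves the row product unchanged, by symmetry within that row, and flips the sign, so the terms
  -- cancel in pairs.
  refine Finset.sum_involution (fun σ _ => σ * Equiv.swap a b) ?_ ?_ ?_ ?_
  · intro σ _
    have : rowProduct (fun c => t ((σ * Equiv.swap a b) (τ⁻¹ c))) =
        rowProduct (fun c => t (σ (τ⁻¹ c))) := by
      rw [← rowProduct_swap (fun c => t (σ (τ⁻¹ c))) hrow]
      congr 1
      funext c
      have : τ⁻¹ (Equiv.swap (τ a) (τ b) c) = Equiv.swap a b (τ⁻¹ c) := by
        rw [Equiv.swap_apply_apply]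
        simp
      rw [this, Equiv.Perm.mul_apply]
    rw [this, csign_mul, csign_swap hab, mul_neg_one, neg_smul, add_neg_cancel]
  · intro σ _ _ h
    have h1 : Equiv.swap a b = 1 := mul_left_cancel (h.trans (mul_one σ).symm)
    exact hab (Equiv.swap_eq_one_iff.1 h1)
  · intro σ hσ
    simp only [Finset.mem_filter, Finset.mem_univ, true_and] at hσ ⊢
    intro c hc
    rw [Equiv.Perm.mul_apply, Equiv.swap_apply_of_ne_of_ne (ne_of_mem_of_not_mem ha hc).symm
      (ne_of_mem_of_not_mem hb hc).symm, hσ c hc]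
  · intro σ _
    rw [mul_assoc, Equiv.swap_mul_self, mul_one]

end Polytabloids

end Plethysm
end

open scoped TensorProduct
noncomputable section

namespace Plethysm

/-! ### Semistandard polytabloids span. -/

section Straightening

variable {lam : YoungDiagram} {V : Type} [AddCommGroup V] [Module ℂ V] {N : ℕ}

/-- The sum of the entries of a filling weighted by the row indices. -/
def rowWeight (t : lam.cells → Fin N) : ℕ := ∑ c, c.1.1 * (t c : ℕ)

/-- The sum of the entries of a filling weighted by the column indices. -/
def colWeight (t : lam.cells → Fin N) : ℕ := ∑ c, c.1.2 * (t c : ℕ)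

theorem rowWeight_le (t : lam.cells → Fin N) : rowWeight t ≤ ∑ c : lam.cells, c.1.1 * N :=
  Finset.sum_le_sum fun _ _ => Nat.mul_le_mul_left _ (t _).2.le

theorem colWeight_le (t : lam.cells → Fin N) : colWeight t ≤ ∑ c : lam.cells, c.1.2 * N :=
  Finset.sum_le_sum fun _ _ => Nat.mul_le_mul_left _ (t _).2.le

theorem sum_mul_swap_lt {w : lam.cells → ℕ} {t : lam.cells → Fin N} {a b : lam.cells}
    (hw : w a < w b) (ht : t b < t a) :
    ∑ c, w c * (t c : ℕ) < ∑ c, w c * (t (Equiv.swap a b c) : ℕ) := by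
  have hab : a ≠ b := fun h => by simp [h] at hw
  have hb : b ∈ (Finset.univ : Finset lam.cells).erase a := by simp [hab.symm]
  rw [← Finset.add_sum_erase _ _ (Finset.mem_univ a), ← Finset.add_sum_erase _ _ hb,
    ← Finset.add_sum_erase Finset.univ (fun c => w c * (t (Equiv.swap a b c) : ℕ))
      (Finset.mem_univ a), ← Finset.add_sum_erase _ _ hb]
  rw [Finset.sum_congr rfl (g := fun c => w c * (t c : ℕ)) (s₂ := (Finset.univ.erase a).erase b)
    (f := fun c => w c * (t (Equiv.swap a b c) : ℕ)) fun c hc => ?_]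
  · have ht' : (t b : ℕ) < t a := ht
    simp only [Equiv.swap_apply_left, Equiv.swap_apply_right]
    nlinarith
  · simp only [Finset.mem_erase, Finset.mem_univ, and_true] at hc
    rw [Equiv.swap_apply_of_ne_of_ne hc.2 hc.1]

/-- The filling is semistandard. -/
def IsSemistandard (t : lam.cells → Fin N) : Prop :=
  (∀ a b : lam.cells, a.1.1 = b.1.1 → b.1.2 = a.1.2 + 1 → t a ≤ t b) ∧
  ∀ a b : lam.cells, a.1.2 = b.1.2 → b.1.1 = a.1.1 + 1 → t a < t b

theorem IsSemistandard.row_le {t : lam.cells → Fin N} (ht : IsSemistandard t) (a b : lam.cells)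
    (hrow : a.1.1 = b.1.1) (hcol : a.1.2 ≤ b.1.2) : t a ≤ t b := by
  obtain ⟨⟨i, j⟩, ha⟩ := a
  obtain ⟨⟨i', j'⟩, hb⟩ := b
  obtain rfl : i = i' := hrow
  have hcol : j ≤ j' := hcol
  induction j', hcol using Nat.le_induction with
  | base => exact le_rfl
  | succ k hk ih =>
    have hk' : (i, k) ∈ lam.cells := by
      rw [YoungDiagram.mem_cells] at hb ⊢
      exact lam.up_left_mem le_rfl (Nat.le_succ k) hb
    exact (ih hk' hk).trans (ht.1 ⟨(i, k), hk'⟩ ⟨(i, k + 1), hb⟩ rfl rfl)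

theorem col_lt_of_adjacent {t : lam.cells → Fin N}
    (ht : ∀ a b : lam.cells, a.1.2 = b.1.2 → b.1.1 = a.1.1 + 1 → t a < t b) (a b : lam.cells)
    (hcol : a.1.2 = b.1.2) (hrow : a.1.1 < b.1.1) : t a < t b := by
  obtain ⟨⟨i, j⟩, ha⟩ := a
  obtain ⟨⟨i', j'⟩, hb⟩ := b
  obtain rfl : j = j' := hcol
  have hrow : i + 1 ≤ i' := hrow
  induction i', hrow using Nat.le_induction with
  | base => exact ht _ _ rfl rfl
  | succ k hk ih =>
    have hk' : (k, j) ∈ lam.cells := by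
      rw [YoungDiagram.mem_cells] at hb ⊢
      exact lam.up_left_mem (Nat.le_succ k) le_rfl hb
    exact (ih hk' hk).trans (ht ⟨(k, j), hk'⟩ ⟨(k + 1, j), hb⟩ rfl rfl)

/-- The semistandard tableau with a given semistandard filling. -/
def IsSemistandard.toSSYT {l : ℕ} {t : lam.cells → Fin (l + 1)} (ht : IsSemistandard t) :
    SSYTLe lam l :=
  ⟨{ entry := fun i j => if h : (i, j) ∈ lam.cells then t ⟨(i, j), h⟩ else 0
     row_weak' := fun {i j1 j2} hj h2 => by
      have h1 := lam.up_left_mem le_rfl hj.le h2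
      rw [dif_pos ((YoungDiagram.mem_cells _).2 h2), dif_pos ((YoungDiagram.mem_cells _).2 h1)]
      exact ht.row_le _ _ rfl hj.le
     col_strict' := fun {i1 i2 j} hi h2 => by
      have h1 := lam.up_left_mem hi.le le_rfl h2
      rw [dif_pos ((YoungDiagram.mem_cells _).2 h2), dif_pos ((YoungDiagram.mem_cells _).2 h1)]
      exact col_lt_of_adjacent ht.2 _ _ rfl hi
     zeros' := fun {i j} h => dif_neg fun h' => h ((YoungDiagram.mem_cells _).1 h') },
  fun i j => by
    change (if h : (i, j) ∈ lam.cells then ((t ⟨(i, j), h⟩ : Fin (l + 1)) : ℕ) else 0) ≤ l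
    split_ifs
    · exact Nat.lt_succ_iff.1 (t _).2
    · exact Nat.zero_le _⟩

theorem IsSemistandard.toSSYT_entry {l : ℕ} {t : lam.cells → Fin (l + 1)}
    (ht : IsSemistandard t) (c : lam.cells) : ht.toSSYT.entry c.1 = t c :=
  Fin.ext (dif_pos c.2)

theorem SSYTLe.isSemistandard {l : ℕ} (T : SSYTLe lam l) :
    IsSemistandard fun c : lam.cells => T.entry c.1 := by
  refine ⟨fun a b hr hc => ?_, fun a b hc hr => ?_⟩
  · change T.1 a.1.1 a.1.2 ≤ T.1 b.1.1 b.1.2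
    rw [hr]
    exact T.1.row_weak (by omega) ((YoungDiagram.mem_cells _).1 b.2)
  · change T.1 a.1.1 a.1.2 < T.1 b.1.1 b.1.2
    rw [hc]
    exact T.1.col_strict (by omega) ((YoungDiagram.mem_cells _).1 b.2)

/-- Entries of `D` in the left column are at least `t a`, those in the right column at most `t b`,
which is smaller. A permutation of `D` that mixes the columns therefore moves large entries to the
right. -/
theorem colWeight_lt_of_garnir {t : lam.cells → Fin N} {a b : lam.cells}
    (hcol : b.1.2 = a.1.2 + 1) (D : Set lam.cells)
    (hD : ∀ c ∈ D, (c.1.2 = a.1.2 ∧ t a ≤ t c) ∨ (c.1.2 = b.1.2 ∧ t c ≤ t b))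
    (hba : t b < t a) {σ : Equiv.Perm lam.cells} (hσ : ∀ c ∉ D, σ c = c)
    (hσc : ¬ ColPreserving σ) : colWeight t < colWeight fun c => t (σ c) := by
  have hmem : ∀ c, σ c ∈ D ↔ c ∈ D := fun c => by
    by_cases hc : c ∈ D
    · refine ⟨fun _ => hc, fun _ => by_contra fun h => h ?_⟩
      rwa [σ.injective (hσ _ h)]
    · rw [hσ c hc]
  -- An odd threshold for doubled entries: $2t-x$ is positive on the left part of `D` and negative
  -- on the right part. As `σ` permutes the boxes, subtracting $x$ does not affect the total, and
  -- the sum becomes termwise nonnegative.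
  set x : ℤ := 2 * (t a : ℕ) - 1
  have hba' : (t b : ℕ) < t a := hba
  have hre : ∑ c : lam.cells,
      ((c.1.2 : ℤ) - ((σ c).1.2 : ℤ)) * (2 * ((t (σ c) : ℕ) : ℤ) - x) =
      2 * ((colWeight fun c => t (σ c) : ℕ) : ℤ) - 2 * (colWeight t : ℕ) := by
    have h1 : ∑ c : lam.cells, ((σ c).1.2 : ℤ) * (2 * ((t (σ c) : ℕ) : ℤ) - x) =
        ∑ c : lam.cells, (c.1.2 : ℤ) * (2 * ((t c : ℕ) : ℤ) - x) :=
      Equiv.sum_comp σ (fun c => (c.1.2 : ℤ) * (2 * ((t c : ℕ) : ℤ) - x))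
    simp only [sub_mul (Nat.cast _ : ℤ)]
    rw [Finset.sum_sub_distrib, h1]
    simp only [colWeight, Nat.cast_sum, Nat.cast_mul, mul_sub, Finset.sum_sub_distrib,
      Finset.mul_sum, sub_sub_sub_cancel_right]
    congr 1 <;> exact Finset.sum_congr rfl fun c _ => by ring
  have hterm : ∀ c : lam.cells,
      0 ≤ ((c.1.2 : ℤ) - ((σ c).1.2 : ℤ)) * (2 * ((t (σ c) : ℕ) : ℤ) - x) ∧
      ((σ c).1.2 ≠ c.1.2 →
        0 < ((c.1.2 : ℤ) - ((σ c).1.2 : ℤ)) * (2 * ((t (σ c) : ℕ) : ℤ) - x)) := by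
    intro c
    by_cases hc : c ∈ D
    · have h1 := hD c hc
      have h2 := hD _ ((hmem c).2 hc)
      rw [hcol] at h1 h2
      have e1 : ∀ y : Fin N, t a ≤ y → (t a : ℕ) ≤ y := fun y h => h
      have e2 : ∀ y : Fin N, y ≤ t b → (y : ℕ) ≤ t b := fun y h => h
      rcases h2 with ⟨h2, h3⟩ | ⟨h2, h3⟩
      · have h3 := e1 _ h3
        rcases h1 with ⟨h1, -⟩ | ⟨h1, -⟩
        · rw [h1, h2]; simp
        · rw [h1, h2]; push_cast; rw [add_sub_cancel_left, one_mul]; omega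
      · have h3 := e2 _ h3
        rcases h1 with ⟨h1, -⟩ | ⟨h1, -⟩
        · rw [h1, h2]; push_cast; rw [sub_add_cancel_left, neg_one_mul]; omega
        · rw [h1, h2]; simp
    · rw [hσ c hc]; simp
  obtain ⟨c, hc⟩ := not_forall.1 hσc
  have := Finset.sum_pos' (fun c _ => (hterm c).1) ⟨c, Finset.mem_univ c, (hterm c).2 hc⟩
  rw [hre] at this
  omega

/-- The Garnir set has one box more than the left column, since the row of `a` and `b` is counted in
both columns, while a column permutation keeps all of its boxes in rows that meet the left column.
-/
theorem garnir_pigeonhole {a b : lam.cells} (hrow : a.1.1 = b.1.1) (hcol : b.1.2 = a.1.2 + 1)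
    (τ : Equiv.Perm lam.cells) (hτ : ColPreserving τ) :
    ∃ p ∈ {c : lam.cells | (c.1.2 = a.1.2 ∧ a.1.1 ≤ c.1.1) ∨ (c.1.2 = b.1.2 ∧ c.1.1 ≤ b.1.1)},
    ∃ q ∈ {c : lam.cells | (c.1.2 = a.1.2 ∧ a.1.1 ≤ c.1.1) ∨ (c.1.2 = b.1.2 ∧ c.1.1 ≤ b.1.1)},
      p ≠ q ∧ (τ p).1.1 = (τ q).1.1 := by
  set n := lam.colLen a.1.2 with hn
  -- The Garnir boxes from top to bottom: down the right column to the row of `a`, then down the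
  -- left column from that same row, whence the shift by one.
  have hmem : ∀ r : Fin (n + 1), (if (r : ℕ) ≤ a.1.1 then ((r : ℕ), b.1.2)
      else ((r : ℕ) - 1, a.1.2)) ∈ lam.cells := fun r => by
    split_ifs with h
    · rw [YoungDiagram.mem_cells]
      exact lam.up_left_mem (hrow ▸ h) le_rfl ((YoungDiagram.mem_cells _).1 b.2)
    · rw [YoungDiagram.mem_cells, YoungDiagram.mem_iff_lt_colLen]
      have := r.2
      omega
  let g : Fin (n + 1) → lam.cells := fun r => ⟨_, hmem r⟩
  have hgD : ∀ r, g r ∈ {c : lam.cells |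
      (c.1.2 = a.1.2 ∧ a.1.1 ≤ c.1.1) ∨ (c.1.2 = b.1.2 ∧ c.1.1 ≤ b.1.1)} := fun r => by
    by_cases h : (r : ℕ) ≤ a.1.1
    · right; simp only [g, if_pos h]; exact ⟨trivial, hrow ▸ h⟩
    · left; simp only [g, if_neg h]; exact ⟨trivial, by omega⟩
  have hginj : ∀ r s, g r = g s → r = s := fun r s h => by
    have h := congrArg Subtype.val h
    simp only [g] at h
    refine Fin.ext ?_
    split_ifs at h with h1 h2 h2 <;> rw [Prod.ext_iff] at h <;> simp only at h <;> omega
  have hlt : ∀ r, (τ (g r)).1.1 < n := fun r => by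
    refine (cell_lt_colLen _).trans_le (lam.colLen_anti _ _ ?_)
    rw [hτ]
    rcases hgD r with h | h
    · exact h.1.ge
    · rw [h.1, hcol]; exact Nat.le_succ _
  obtain ⟨r, s, hrs, h⟩ := Fintype.exists_ne_map_eq_of_card_lt
    (fun r => (⟨_, hlt r⟩ : Fin n)) (by simp)
  exact ⟨g r, hgD r, g s, hgD s, fun h => hrs (hginj _ _ h), congrArg Fin.val h⟩

/-- Straightening, by induction towards larger column weight and then larger row weight. A descent
inside a column is repaired by a swap, which raises the row weight only; a descent inside a row is
repaired by a Garnir relation, whose other terms have larger column weight. -/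
theorem polytabloid_mem_span {l : ℕ} (ε : Fin (l + 1) → V) (t : lam.cells → Fin (l + 1)) :
    polytabloid (fun c => ε (t c)) ∈ Submodule.span ℂ
      (Set.range fun T : SSYTLe lam l => polytabloid fun c : lam.cells => ε (T.entry c.1)) := by
  classical
  set S := Submodule.span ℂ
      (Set.range fun T : SSYTLe lam l => polytabloid fun c : lam.cells => ε (T.entry c.1))
  -- `K` exceeds every row weight, so $K\cdot$`colWeight` $+$ `rowWeight` encodes the lexicographic
  -- order in one number, bounded by `B`.
  set K := ∑ c : lam.cells, c.1.1 * (l + 1) + 1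
  set B := K * ∑ c : lam.cells, c.1.2 * (l + 1) + ∑ c : lam.cells, c.1.1 * (l + 1)
  have hB : ∀ s : lam.cells → Fin (l + 1), K * colWeight s + rowWeight s ≤ B := fun s =>
    Nat.add_le_add (Nat.mul_le_mul_left _ (colWeight_le s)) (rowWeight_le s)
  induction hm : B - (K * colWeight t + rowWeight t) using Nat.strong_induction_on
    generalizing t with
  | _ m ih =>
    subst hm
    have step : ∀ s : lam.cells → Fin (l + 1),
        K * colWeight t + rowWeight t < K * colWeight s + rowWeight s →
        polytabloid (fun c => ε (s c)) ∈ S := fun s hs =>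
      ih _ (by have := hB s; omega) s rfl
    by_cases h2 : ∀ a b : lam.cells, a.1.2 = b.1.2 → b.1.1 = a.1.1 + 1 → t a < t b
    · by_cases h1 : ∀ a b : lam.cells, a.1.1 = b.1.1 → b.1.2 = a.1.2 + 1 → t a ≤ t b
      · refine Submodule.subset_span ⟨IsSemistandard.toSSYT ⟨h1, h2⟩, ?_⟩
        exact congrArg polytabloid (funext fun c =>
          congrArg ε (IsSemistandard.toSSYT_entry ⟨h1, h2⟩ c))
      · push Not at h1
        obtain ⟨a, b, hrow, hcol, hba⟩ := h1
        have hle : ∀ p q : lam.cells, p.1.2 = q.1.2 → p.1.1 ≤ q.1.1 → t p ≤ t q := by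
          intro p q hc hr
          rcases hr.eq_or_lt with hr | hr
          · rw [Subtype.ext (Prod.ext hr hc)]
          · exact (col_lt_of_adjacent h2 p q hc hr).le
        obtain ⟨D, hD, hDτ⟩ : ∃ D : Set lam.cells,
            (∀ c ∈ D, (c.1.2 = a.1.2 ∧ t a ≤ t c) ∨ (c.1.2 = b.1.2 ∧ t c ≤ t b)) ∧
            ∀ τ : Equiv.Perm lam.cells, ColPreserving τ →
              ∃ p ∈ D, ∃ q ∈ D, p ≠ q ∧ (τ p).1.1 = (τ q).1.1 := by
          refine ⟨_, ?_, garnir_pigeonhole hrow hcol⟩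
          rintro c (⟨hc, hr⟩ | ⟨hc, hr⟩)
          · exact Or.inl ⟨hc, hle _ _ hc.symm hr⟩
          · exact Or.inr ⟨hc, hle _ _ hc hr⟩
        have hG := garnir_relation (fun c => ε (t c)) D hDτ
        rw [← Finset.sum_filter_add_sum_filter_not _ ColPreserving] at hG
        -- Signs cancel for the column-preserving `σ`, so these terms add up to a positive multiple
        -- of the given polytabloid, the identity being one of them; the multiple is invertible in
        -- characteristic zero.
        have hP : ∀ σ ∈ (Finset.univ.filter fun σ : Equiv.Perm lam.cells =>
            ∀ c ∉ D, σ c = c).filter ColPreserving,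
            csign σ • polytabloid (fun c => ε (t (σ c))) = polytabloid fun c => ε (t c) := by
          intro σ hσ
          rw [polytabloid_comp (fun c => ε (t c)) (Finset.mem_filter.1 hσ).2, smul_smul,
            csign_mul_self, one_smul]
        rw [Finset.sum_congr rfl hP, Finset.sum_const, ← Nat.cast_smul_eq_nsmul ℂ] at hG
        have hpos : (((Finset.univ.filter fun σ : Equiv.Perm lam.cells =>
            ∀ c ∉ D, σ c = c).filter ColPreserving).card : ℂ) ≠ 0 := by
          rw [Nat.cast_ne_zero, Finset.card_ne_zero]
          exact ⟨1, by simp [ColPreserving]⟩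
        rw [← S.smul_mem_iff hpos]
        rw [eq_neg_of_add_eq_zero_left hG]
        refine S.neg_mem (S.sum_mem fun σ hσ => S.smul_mem _ ?_)
        simp only [Finset.mem_filter, Finset.mem_univ, true_and] at hσ
        refine step (fun c => t (σ c)) ?_
        have h := colWeight_lt_of_garnir hcol D hD hba hσ.1 hσ.2
        have h' := rowWeight_le t
        calc K * colWeight t + rowWeight t < K * (colWeight t + 1) := by
              rw [mul_add]; omega
          _ ≤ K * colWeight (fun c => t (σ c)) := Nat.mul_le_mul_left _ h
          _ ≤ _ := Nat.le_add_right _ _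
    · push Not at h2
      obtain ⟨a, b, hcol, hrow, hba⟩ := h2
      have hab : a ≠ b := fun h => by rw [h] at hrow; omega
      rcases hba.eq_or_lt with hba | hba
      · rw [polytabloid_eq_zero _ hab hcol (by rw [hba])]
        exact S.zero_mem
      · have h := polytabloid_swap (fun c => ε (t c)) hab hcol
        rw [← S.neg_mem_iff, ← h]
        refine step (fun c => t (Equiv.swap a b c)) ?_
        have hr : rowWeight t < rowWeight fun c => t (Equiv.swap a b c) :=
          sum_mul_swap_lt (w := fun c => c.1.1) (by omega) hba
        have hc : colWeight (fun c => t (Equiv.swap a b c)) = colWeight t := by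
          rw [colWeight, colWeight, ← Equiv.sum_comp (Equiv.swap a b)]
          refine Finset.sum_congr rfl fun c _ => ?_
          rw [Equiv.swap_apply_self, colPreserving_swap hcol]
        rw [hc]
        omega

theorem schurModule_eq_span {l : ℕ} (ε : Fin (l + 1) → V)
    (hε : ⊤ ≤ Submodule.span ℂ (Set.range ε)) : schurModule lam V = Submodule.span ℂ
      (Set.range fun T : SSYTLe lam l => polytabloid fun c : lam.cells => ε (T.entry c.1)) := by
  refine le_antisymm (Submodule.span_le.2 ?_) (Submodule.span_le.2 ?_)
  · rintro _ ⟨t, rfl⟩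
    have := multilinear_mem_span (polytabloidMulti lam V) ε hε t
    rw [polytabloidMulti_apply] at this
    refine Submodule.span_le.2 ?_ this
    rintro _ ⟨s, rfl⟩
    simp only [polytabloidMulti_apply]
    exact polytabloid_mem_span ε s
  · rintro _ ⟨T, rfl⟩
    exact Submodule.subset_span ⟨_, rfl⟩

end Straightening

end Plethysm
end

open scoped TensorProduct
noncomputable section

namespace Plethysm

/-! ### Semistandard polytabloids are linearly independent. -/

section Independence

variable {lam : YoungDiagram} {V : Type} [AddCommGroup V] [Module ℂ V] {N : ℕ}

/-- Strict increase down a column gives $i\le$ the row of $\sigma(i,j)$, and both sides have the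
same sum over all boxes. -/
theorem perm_eq_one_of_col_strictMono {σ : Equiv.Perm lam.cells} (hσ : ColPreserving σ)
    (h : ∀ a b : lam.cells, a.1.2 = b.1.2 → b.1.1 = a.1.1 + 1 → (σ a).1.1 < (σ b).1.1) :
    σ = 1 := by
  have hle : ∀ (i j : ℕ) (hc : (i, j) ∈ lam.cells), i ≤ (σ ⟨(i, j), hc⟩).1.1 := by
    intro i j
    induction i with
    | zero => exact fun _ => Nat.zero_le _
    | succ i ih =>
      intro hc
      have hc' : (i, j) ∈ lam.cells := by
        rw [YoungDiagram.mem_cells] at hc ⊢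
        exact lam.up_left_mem (Nat.le_succ i) le_rfl hc
      exact (ih hc').trans_lt (h ⟨(i, j), hc'⟩ ⟨(i + 1, j), hc⟩ rfl rfl)
  have heq : ∀ c : lam.cells, c.1.1 = (σ c).1.1 := by
    have := (Finset.sum_eq_sum_iff_of_le (s := Finset.univ) (f := fun c : lam.cells => c.1.1)
      (g := fun c => (σ c).1.1) (fun c _ => hle c.1.1 c.1.2 c.2)).1
      (Equiv.sum_comp σ fun c : lam.cells => c.1.1).symm
    exact fun c => this c (Finset.mem_univ c)
  refine Equiv.ext fun c => Subtype.ext (Prod.ext (heq c).symm (hσ c))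

/-- The strict rearrangement inequality: column-strict entries are sorted in the same order as the
row indices, so any nontrivial permutation within columns lowers the sum of products. -/
theorem rowWeight_comp_lt {t : lam.cells → Fin N}
    (ht : ∀ a b : lam.cells, a.1.2 = b.1.2 → b.1.1 = a.1.1 + 1 → t a < t b)
    {σ : Equiv.Perm lam.cells} (hσ : ColPreserving σ) (h1 : σ ≠ 1) :
    rowWeight (fun c => t (σ c)) < rowWeight t := by
  set R := lam.colLen 0
  have hR : ∀ c : lam.cells, c.1.1 < R := fun c =>
    (cell_lt_colLen c).trans_le (lam.colLen_anti _ _ (Nat.zero_le _))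
  -- Adding the column index as a leading digit makes rows and entries monovary over the whole
  -- diagram, so the inequality is applied once and not column by column. The extra terms are
  -- unchanged by a column permutation and cancel.
  let f : lam.cells → ℕ := fun c => c.1.1 + R * c.1.2
  let g : lam.cells → ℕ := fun c => t c + N * c.1.2
  have hfg : Monovary f g := by
    intro a b hab
    have ha := hR a
    have hb := hR b
    have hta := (t a).2
    have htb := (t b).2
    simp only [f, g] at hab ⊢
    rcases lt_trichotomy a.1.2 b.1.2 with hc | hc | hc
    · have := Nat.mul_le_mul_left R (Nat.succ_le_of_lt hc)
      rw [Nat.succ_eq_add_one, mul_add] at this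
      omega
    · rw [hc] at hab ⊢
      rcases lt_trichotomy a.1.1 b.1.1 with hr | hr | hr
      · omega
      · omega
      · have := col_lt_of_adjacent ht b a hc.symm hr
        have : (t b : ℕ) < t a := this
        omega
    · have := Nat.mul_le_mul_left N (Nat.succ_le_of_lt hc)
      rw [Nat.succ_eq_add_one, mul_add] at this
      omega
  have hlt : ∑ c, f c * g (σ c) < ∑ c, f c * g c := by
    rw [hfg.sum_mul_comp_perm_lt_sum_mul_iff]
    intro hmv
    refine h1 (perm_eq_one_of_col_strictMono hσ fun a b hc hr => ?_)
    have hc' : (σ a).1.2 = (σ b).1.2 := by rw [hσ, hσ, hc]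
    by_contra hnot
    have hne : (σ b).1.1 ≠ (σ a).1.1 := fun h => by
      have := σ.injective (Subtype.ext (Prod.ext h hc'.symm))
      rw [this] at hr
      omega
    have hlt := col_lt_of_adjacent ht (σ b) (σ a) hc'.symm (lt_of_le_of_ne (not_lt.1 hnot) hne)
    have hlt' : (t (σ b) : ℕ) < t (σ a) := hlt
    have := hmv (i := b) (j := a) (by simp only [g, Function.comp_apply, hc']; omega)
    simp only [f, hc] at this
    omega
  have hcol : ∑ c : lam.cells, c.1.2 * (t (σ c) : ℕ) = ∑ c : lam.cells, c.1.2 * (t c : ℕ) := by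
    rw [← Equiv.sum_comp σ fun c : lam.cells => c.1.2 * (t c : ℕ)]
    exact Finset.sum_congr rfl fun c _ => by rw [hσ]
  have e1 : ∑ c, f c * g (σ c) = rowWeight (fun c => t (σ c)) +
      (R * ∑ c : lam.cells, c.1.2 * (t (σ c) : ℕ) + ∑ c, f c * (N * c.1.2)) := by
    rw [rowWeight, Finset.mul_sum, ← Finset.sum_add_distrib, ← Finset.sum_add_distrib]
    refine Finset.sum_congr rfl fun c _ => ?_
    simp only [f, g, hσ c]
    ring
  have e2 : ∑ c, f c * g c = rowWeight t +
      (R * ∑ c : lam.cells, c.1.2 * (t c : ℕ) + ∑ c, f c * (N * c.1.2)) := by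
    rw [rowWeight, Finset.mul_sum, ← Finset.sum_add_distrib, ← Finset.sum_add_distrib]
    refine Finset.sum_congr rfl fun c _ => ?_
    simp only [f, g]
    ring
  rw [e1, e2, hcol] at hlt
  omega

/-- The row content of a filling: the multiplicity of each entry in each row. -/
def rowContent (t : lam.cells → Fin N) : ℕ × Fin N →₀ ℕ :=
  ∑ c : lam.cells, Finsupp.single (c.1.1, t c) 1

theorem rowContent_apply (t : lam.cells → Fin N) (p : ℕ × Fin N) :
    rowContent t p = Nat.card {c : lam.cells // (c.1.1, t c) = p} := by
  classical
  rw [rowContent, Finsupp.finsetSum_apply, Nat.card_eq_fintype_card, Fintype.card_subtype,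
    Finset.card_filter]
  simp only [Finsupp.single_apply]

theorem rowWeight_eq_of_rowContent_eq {t s : lam.cells → Fin N}
    (h : rowContent t = rowContent s) : rowWeight t = rowWeight s := by
  have key : ∀ t : lam.cells → Fin N, rowWeight t =
      Finsupp.liftAddHom (fun p : ℕ × Fin N => AddMonoidHom.mulLeft (p.1 * (p.2 : ℕ)))
        (rowContent t) := fun t => by
    rw [rowContent, map_sum, rowWeight]
    refine Finset.sum_congr rfl fun c _ => ?_
    simp
  rw [key, key, h]

/-- A semistandard filling is determined by the multisets of its rows. If $s(c)<t(c)$, the boxes of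
the row of `s` up to and including $c$ have entries below $t(c)$, so they would be matched
injectively with the boxes of `t` strictly left of $c$, which are one fewer. -/
theorem eq_of_rowContent_eq {t s : lam.cells → Fin N} (ht : IsSemistandard t)
    (hs : IsSemistandard s) (h : rowContent t = rowContent s) : t = s := by
  have key : ∀ t s : lam.cells → Fin N, IsSemistandard t → IsSemistandard s →
      rowContent t = rowContent s → ∀ c, t c ≤ s c := by
    intro t s ht hs h c
    by_contra hlt
    rw [not_le] at hlt
    obtain ⟨σ, hσ⟩ := exists_equiv_of_card_fibers_eq (fun c : lam.cells => (c.1.1, s c))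
      (fun c : lam.cells => (c.1.1, t c)) fun p => by
        rw [← rowContent_apply, ← rowContent_apply, h]
    have hmem : ∀ j : Fin (c.1.2 + 1), (c.1.1, (j : ℕ)) ∈ lam.cells := fun j => by
      rw [YoungDiagram.mem_cells]
      exact lam.up_left_mem le_rfl (Nat.lt_succ_iff.1 j.2) ((YoungDiagram.mem_cells _).1 c.2)
    have hrow : ∀ j, (σ ⟨_, hmem j⟩).1.1 = c.1.1 := fun j =>
      (Prod.ext_iff.1 (hσ ⟨_, hmem j⟩)).1
    have hcol : ∀ j, (σ ⟨_, hmem j⟩).1.2 < c.1.2 := fun j => by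
      by_contra hge
      have h1 := ht.row_le c (σ ⟨_, hmem j⟩) (hrow j).symm (not_lt.1 hge)
      have h2 : t (σ ⟨_, hmem j⟩) = s ⟨_, hmem j⟩ := (Prod.ext_iff.1 (hσ ⟨_, hmem j⟩)).2
      have h3 := hs.row_le ⟨_, hmem j⟩ c rfl (Nat.lt_succ_iff.1 j.2)
      rw [h2] at h1
      exact absurd (h1.trans h3) (not_le.2 hlt)
    obtain ⟨j, k, hjk, he⟩ := Fintype.exists_ne_map_eq_of_card_lt
      (fun j => (⟨_, hcol j⟩ : Fin c.1.2)) (by simp)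
    have := σ.injective (Subtype.ext (Prod.ext ((hrow j).trans (hrow k).symm)
      (congrArg Fin.val he)))
    exact hjk (Fin.ext (congrArg (fun c : lam.cells => c.1.2) this))
  exact funext fun c => le_antisymm (key t s ht hs h c) (key s t hs ht h.symm c)

/-- The linear map `Symⁿ V → A` induced by a linear map from `V` to a commutative algebra. -/
def symLift {A : Type} [CommRing A] [Algebra ℂ A] (n : ℕ) (φ : V →ₗ[ℂ] A) :
    SymmetricPower ℂ (Fin n) V →ₗ[ℂ] A where
  toFun := AddCon.lift _
    (PiTensorProduct.lift
      ((MultilinearMap.mkPiAlgebra ℂ (Fin n) A).compLinearMap fun _ => φ)).toAddMonoidHom (by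
      refine AddCon.addConGen_le.2 ?_
      rintro _ _ ⟨e, f⟩
      rw [AddCon.ker_rel]
      simp only [LinearMap.toAddMonoidHom_coe, PiTensorProduct.lift.tprod,
        MultilinearMap.compLinearMap_apply, MultilinearMap.mkPiAlgebra_apply]
      exact (Equiv.prod_comp e fun i => φ (f i)).symm)
  map_add' := map_add _
  map_smul' r x := by
    refine AddCon.induction_on x fun x => ?_
    exact LinearMap.map_smul (PiTensorProduct.lift
      ((MultilinearMap.mkPiAlgebra ℂ (Fin n) A).compLinearMap fun _ => φ)) r x

theorem symLift_tprod {A : Type} [CommRing A] [Algebra ℂ A] (n : ℕ) (φ : V →ₗ[ℂ] A)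
    (v : Fin n → V) : symLift n φ (SymmetricPower.tprod ℂ v) = ∏ i, φ (v i) :=
  (PiTensorProduct.lift.tprod (R := ℂ) v).trans (by simp)

/-- The linear map from `RowTensor lam V` to polynomials sending a tensor product of symmetric
products of basis vectors to the corresponding product of variables. -/
def rowPolynomial (b : Module.Basis (Fin N) ℂ V) :
    RowTensor lam V →ₗ[ℂ] MvPolynomial (ℕ × Fin N) ℂ :=
  PiTensorProduct.lift ((MultilinearMap.mkPiAlgebra ℂ (Fin (lam.colLen 0))
    (MvPolynomial (ℕ × Fin N) ℂ)).compLinearMap fun i =>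
      symLift (lam.rowLen i) (b.constr ℂ fun k => MvPolynomial.X ((i : ℕ), k)))

theorem rowPolynomial_rowProduct (b : Module.Basis (Fin N) ℂ V) (t : lam.cells → Fin N) :
    rowPolynomial b (rowProduct fun c => b (t c)) = MvPolynomial.monomial (rowContent t) 1 := by
  rw [rowPolynomial, rowProduct, PiTensorProduct.lift.tprod,
    MultilinearMap.compLinearMap_apply, MultilinearMap.mkPiAlgebra_apply]
  simp only [symLift_tprod, Module.Basis.constr_basis]
  rw [rowContent, MvPolynomial.monomial_sum_one, ← Equiv.prod_comp (cellEquiv lam),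
    Fintype.prod_sigma]
  rfl

theorem coeff_rowPolynomial_polytabloid (b : Module.Basis (Fin N) ℂ V) (t : lam.cells → Fin N)
    (m : ℕ × Fin N →₀ ℕ) :
    (rowPolynomial b (polytabloid fun c => b (t c))).coeff m =
      ∑ τ : Equiv.Perm lam.cells with ∀ c, (τ c).1.2 = c.1.2,
        csign τ * if rowContent (fun c => t (τ⁻¹ c)) = m then 1 else 0 := by
  rw [polytabloid_eq_sum, map_sum, MvPolynomial.coeff_sum]
  refine Finset.sum_congr rfl fun τ _ => ?_
  rw [map_smul, rowPolynomial_rowProduct b fun c => t (τ⁻¹ c), MvPolynomial.coeff_smul,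
    MvPolynomial.coeff_monomial, smul_eq_mul]

/-- Triangularity for the row weight: among the tableaux in a relation take one, `T`, of maximal row
weight. A nontrivial column permutation strictly lowers row weight, so the row monomial of `T`
arises only from `T` itself with the identity permutation. -/
theorem polytabloid_linearIndependent {l : ℕ} (b : Module.Basis (Fin (l + 1)) ℂ V) :
    LinearIndependent ℂ
      (fun T : SSYTLe lam l => polytabloid fun c : lam.cells => b (T.entry c.1)) := by
  rw [Fintype.linearIndependent_iff]
  intro g hg
  by_contra hne
  push Not at hne
  obtain ⟨T₀, hT₀⟩ := hne
  let fill : SSYTLe lam l → lam.cells → Fin (l + 1) := fun T c => T.entry c.1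
  have hfill : ∀ T S, fill T = fill S → T = S := fun T S h => by
    refine Subtype.ext (SemistandardYoungTableau.ext fun i j => ?_)
    by_cases hc : (i, j) ∈ lam
    · exact congrArg Fin.val (congrFun h ⟨(i, j), (YoungDiagram.mem_cells _).2 hc⟩)
    · rw [S.1.zeros hc, T.1.zeros hc]
  obtain ⟨T, hT, hmax⟩ := (Finset.univ.filter fun T => g T ≠ 0).exists_max_image
    (fun T => rowWeight (fill T)) ⟨T₀, by simpa using hT₀⟩
  simp only [Finset.mem_filter, Finset.mem_univ, true_and] at hT hmax
  have h := congrArg (fun x => (rowPolynomial b x).coeff (rowContent (fill T))) hg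
  simp only [map_sum, map_smul, map_zero, MvPolynomial.coeff_sum, MvPolynomial.coeff_smul,
    MvPolynomial.coeff_zero] at h
  have key : ∀ (S : SSYTLe lam l) (τ : Equiv.Perm lam.cells), g S ≠ 0 → ColPreserving τ →
      rowContent (fun c => fill S (τ⁻¹ c)) = rowContent (fill T) → S = T ∧ τ = 1 := by
    intro S τ hS hτ he
    by_cases h1 : τ⁻¹ = 1
    · rw [h1] at he
      exact ⟨hfill _ _ (eq_of_rowContent_eq S.isSemistandard T.isSemistandard he),
        inv_eq_one.1 h1⟩
    · have := rowWeight_comp_lt S.isSemistandard.2 hτ.inv h1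
      have h2 := rowWeight_eq_of_rowContent_eq he
      have h3 := hmax S hS
      exact absurd (h2 ▸ this) (not_lt.2 h3)
  rw [Finset.sum_eq_single T] at h
  · have h2 := coeff_rowPolynomial_polytabloid b (fill T) (rowContent (fill T))
    rw [Finset.sum_eq_single 1] at h2
    · simp only [fill] at h h2
      rw [h2] at h
      simp [csign_one] at h
      exact hT h
    · intro τ hτ h1
      rw [if_neg fun he => h1 (key T τ hT (Finset.mem_filter.1 hτ).2 he).2, mul_zero]
    · intro h
      simp at h
  · intro S _ hS
    by_cases hgS : g S = 0
    · rw [hgS, zero_smul]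
    · have h2 := coeff_rowPolynomial_polytabloid b (fill S) (rowContent (fill T))
      rw [Finset.sum_eq_zero fun τ hτ => ?_] at h2
      · simp only [fill] at h2
        rw [h2, smul_zero]
      · rw [if_neg fun he => hS (key S τ hgS (Finset.mem_filter.1 hτ).2 he).1, mul_zero]
  · simp

/-- The basis of `∇^lam V` of polytabloids of semistandard tableaux. -/
def semistandardBasis {l : ℕ} (b : Module.Basis (Fin (l + 1)) ℂ V) :
    Module.Basis (SSYTLe lam l) ℂ (schurModule lam V) :=
  (Module.Basis.span (polytabloid_linearIndependent (lam := lam) b)).map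
    (LinearEquiv.ofEq _ _ (schurModule_eq_span b b.span_eq.ge).symm)

theorem semistandardBasis_apply {l : ℕ} (b : Module.Basis (Fin (l + 1)) ℂ V)
    (T : SSYTLe lam l) : (semistandardBasis b T : RowTensor lam V) =
      polytabloid fun c : lam.cells => b (T.entry c.1) := by
  simp [semistandardBasis, Module.Basis.span_apply]

end Independence

end Plethysm
end

noncomputable section

namespace Plethysm

/-! ### The monomial basis of $\mathrm{Sym}^\ell\mathbf{C}^2$. -/

section SymmetricPowerBasis

/-- The standard basis vector of `ℂ²`. -/
def stdVec (a : Fin 2) : Fin 2 → ℂ := Pi.single a 1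

/-- The product `e₀^(l-k) e₁^k` in `Sym^l ℂ²`. -/
def symVec (l : ℕ) (k : ℕ) : SymmetricPower ℂ (Fin l) (Fin 2 → ℂ) :=
  SymmetricPower.tprod ℂ fun j : Fin l => stdVec (if (j : ℕ) < k then 1 else 0)

theorem natRep_stdVec (g : SL2) (a : Fin 2) :
    natRep g (stdVec a) = ∑ a', g.1 a' a • stdVec a' := by
  ext i
  simp [natRep, stdVec, Finset.sum_apply, Pi.single_apply]

theorem natRep_diag_stdVec (Q : ℂˣ) (a : Fin 2) :
    natRep (diagSL2 Q) (stdVec a) = ((Q ^ (if a = 1 then (1 : ℤ) else -1) : ℂˣ) : ℂ) • stdVec a := by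
  rw [natRep_stdVec]
  fin_cases a <;> simp [diagSL2]

theorem symRep_diag_symVec (Q : ℂˣ) (l k : ℕ) (hk : k ≤ l) :
    symRep l natRep (diagSL2 Q) (symVec l k) =
      ((Q ^ (2 * (k : ℤ) - l) : ℂˣ) : ℂ) • symVec l k := by
  refine (symMap_tprod _ _ _).trans ?_
  simp only [natRep_diag_stdVec]
  rw [MultilinearMap.map_smul_univ, ← Units.coe_prod, ← zpow_sum_eq_prod, symVec]
  congr 3
  have : ∀ j : Fin l, (if (if (j : ℕ) < k then (1 : Fin 2) else 0) = 1 then (1 : ℤ) else -1) =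
      2 * (if (j : ℕ) < k then 1 else 0) - 1 := fun j => by split_ifs <;> simp_all
  simp only [this]
  rw [Finset.sum_sub_distrib, ← Finset.mul_sum,
    Fin.sum_univ_eq_sum_range (fun j => if j < k then (1 : ℤ) else 0), ← Finset.sum_filter]
  have : (Finset.range l).filter (· < k) = Finset.range k := by
    ext j; simp only [Finset.mem_filter, Finset.mem_range]; omega
  rw [this]
  simp

theorem symVec_ne_zero (l k : ℕ) : symVec l k ≠ 0 := by
  intro h
  -- The sum of coordinates takes the value $1$ on both standard vectors, so the induced functional
  -- does not vanish on a monomial.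
  have := congrArg (symLift l (LinearMap.proj (R := ℂ) (φ := fun _ : Fin 2 => ℂ) 0 +
    LinearMap.proj (R := ℂ) (φ := fun _ : Fin 2 => ℂ) 1)) h
  rw [symVec, symLift_tprod, map_zero, Finset.prod_eq_zero_iff] at this
  obtain ⟨j, -, hj⟩ := this
  generalize (if (j : ℕ) < k then (1 : Fin 2) else 0) = a at hj
  fin_cases a <;> simp [stdVec] at hj

/-- The vectors are eigenvectors of the torus element with $Q=2$, with distinct eigenvalues
$2^{2k-l}$. -/
theorem symVec_linearIndependent (l : ℕ) :
    LinearIndependent ℂ fun k : Fin (l + 1) => symVec l k := by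
  let Q : ℂˣ := Units.mk0 2 two_ne_zero
  refine Module.End.eigenvectors_linearIndependent' (symRep l natRep (diagSL2 Q))
    (fun k : Fin (l + 1) => ((Q ^ (2 * (k : ℤ) - l) : ℂˣ) : ℂ)) ?_ _ fun k => ?_
  · intro j k h
    simp only [Units.val_zpow_eq_zpow_val, Q, Units.val_mk0] at h
    have h' := congrArg (fun z : ℂ => ‖z‖) h
    simp only [norm_zpow, Complex.norm_ofNat] at h'
    have := zpow_right_injective₀ (a := (2 : ℝ)) (by norm_num) (by norm_num) h'
    exact Fin.ext (by omega)
  · rw [Module.End.hasEigenvector_iff, Module.End.mem_eigenspace_iff]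
    exact ⟨symRep_diag_symVec Q l k (Nat.lt_succ_iff.1 k.2), symVec_ne_zero l k⟩

theorem tprod_stdVec_eq_symVec (l : ℕ) (s : Fin l → Fin 2) :
    SymmetricPower.tprod ℂ (fun j => stdVec (s j)) = symVec l (Nat.card {j // s j = 1}) := by
  classical
  set k := Nat.card {j // s j = 1} with hk
  have hkl : k ≤ l := by
    have := Nat.card_le_card_of_injective (fun j : {j // s j = 1} => j.1) Subtype.val_injective
    rwa [Nat.card_fin] at this
  have h1 : Nat.card {j : Fin l // (if (j : ℕ) < k then (1 : Fin 2) else 0) = 1} = k := by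
    rw [Nat.card_eq_fintype_card, Fintype.card_subtype]
    have : (Finset.univ.filter fun j : Fin l => (if (j : ℕ) < k then (1 : Fin 2) else 0) = 1) =
        Finset.univ.map (Fin.castLEEmb hkl) := by
      ext j
      simp only [Finset.mem_filter, Finset.mem_univ, true_and, Finset.mem_map]
      constructor
      · intro h
        have : (j : ℕ) < k := by by_contra hj; simp [hj] at h
        exact ⟨⟨j, this⟩, rfl⟩
      · rintro ⟨i, rfl⟩
        simp
    rw [this]
    simp
  have compl : ∀ f : Fin l → Fin 2, Nat.card {j // f j = 0} + Nat.card {j // f j = 1} = l := by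
    intro f
    rw [Nat.card_eq_fintype_card, Nat.card_eq_fintype_card, Fintype.card_subtype,
      Fintype.card_subtype]
    have := Finset.card_filter_add_card_filter_not (s := (Finset.univ : Finset (Fin l)))
      (fun j => f j = 0)
    rw [Finset.card_univ, Fintype.card_fin] at this
    convert this using 4
    omega
  obtain ⟨σ, hσ⟩ := exists_equiv_of_card_fibers_eq s
    (fun j : Fin l => if (j : ℕ) < k then (1 : Fin 2) else 0) fun a => by
      have hs := compl s
      have ht := compl fun j : Fin l => if (j : ℕ) < k then (1 : Fin 2) else 0
      have : a = 0 ∨ a = 1 := by omega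
      rcases this with rfl | rfl <;> omega
  rw [symVec, ← SymmetricPower.tprod_equiv (R := ℂ) σ fun j : Fin l =>
    stdVec (if (j : ℕ) < k then 1 else 0)]
  exact congrArg _ (funext fun j => congrArg stdVec (hσ j).symm)

theorem stdVec_span : ⊤ ≤ Submodule.span ℂ (Set.range stdVec) := by
  have := (Pi.basisFun ℂ (Fin 2)).span_eq
  rw [← this]
  refine Submodule.span_mono ?_
  rintro _ ⟨a, rfl⟩
  exact ⟨a, by simp [stdVec]⟩

theorem symVec_span (l : ℕ) :
    ⊤ ≤ Submodule.span ℂ (Set.range fun k : Fin (l + 1) => symVec l k) := by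
  rw [← SymmetricPower.span_tprod_eq_top ℂ (Fin l) (Fin 2 → ℂ), Submodule.span_le]
  rintro _ ⟨v, rfl⟩
  refine Submodule.span_le.2 ?_ (multilinear_mem_span _ stdVec stdVec_span v)
  rintro _ ⟨s, rfl⟩
  refine Submodule.subset_span ⟨⟨Nat.card {j // s j = 1}, ?_⟩, ?_⟩
  · have := Nat.card_le_card_of_injective (fun j : {j // s j = 1} => j.1) Subtype.val_injective
    rw [Nat.card_fin] at this
    omega
  · exact (tprod_stdVec_eq_symVec l s).symm

/-- The basis `e₀^(l-k) e₁^k` of `Sym^l ℂ²`. -/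
def symBasis (l : ℕ) :
    Module.Basis (Fin (l + 1)) ℂ (SymmetricPower ℂ (Fin l) (Fin 2 → ℂ)) :=
  Module.Basis.mk (symVec_linearIndependent l) (symVec_span l)

theorem symBasis_apply (l : ℕ) (k : Fin (l + 1)) : symBasis l k = symVec l k :=
  Module.Basis.mk_apply _ _ _

end SymmetricPowerBasis

/-! ### The character of $\nabla^\lambda\mathrm{Sym}^\ell E$, and its presentation as a quotient of
a tensor power. -/

section Character

variable (lam : YoungDiagram) (l : ℕ)

/-- The space `∇^lam Sym^l ℂ²`. -/
abbrev NablaSpace : Type := schurModule lam (SymmetricPower ℂ (Fin l) (Fin 2 → ℂ))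

/-- The exponent `2 |t| - l |lam|` of the contribution of a tableau `t` to the character. -/
def SSYTLe.charExp {lam : YoungDiagram} {l : ℕ} (t : SSYTLe lam l) : ℤ :=
  2 * (t.weight : ℤ) - l * lam.card

theorem nablaSym_diag_semistandardBasis (Q : ℂˣ) (T : SSYTLe lam l) :
    nablaSym lam l (diagSL2 Q) (semistandardBasis (symBasis l) T) =
      ((Q ^ T.charExp : ℂˣ) : ℂ) • semistandardBasis (symBasis l) T := by
  refine Subtype.ext ?_
  change rowTensorRep lam (symRep l natRep) (diagSL2 Q)
    (semistandardBasis (symBasis l) T : RowTensor lam _) =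
      ((Q ^ T.charExp : ℂˣ) : ℂ) • (semistandardBasis (symBasis l) T : RowTensor lam _)
  rw [semistandardBasis_apply, rowTensorRep_polytabloid, ← polytabloidMulti_apply,
    ← polytabloidMulti_apply]
  simp only [symBasis_apply]
  have : ∀ c : lam.cells, symRep l natRep (diagSL2 Q) (symVec l (T.entry c.1)) =
      ((Q ^ (2 * ((T.entry c.1 : ℕ) : ℤ) - l) : ℂˣ) : ℂ) • symVec l (T.entry c.1) := fun c =>
    symRep_diag_symVec Q l _ (Nat.lt_succ_iff.1 (T.entry c.1).2)
  simp only [this]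
  rw [MultilinearMap.map_smul_univ, ← Units.coe_prod, ← zpow_sum_eq_prod]
  congr 3
  rw [Finset.sum_coe_sort lam.cells fun c => 2 * ((T.entry c : ℕ) : ℤ) - l,
    Finset.sum_sub_distrib, ← Finset.mul_sum, SSYTLe.charExp, SSYTLe.weight]
  simp [YoungDiagram.card, mul_comm]

theorem trace_nablaSym_diag (Q : ℂˣ) : LinearMap.trace ℂ _ (nablaSym lam l (diagSL2 Q)) =
    ∑ T : SSYTLe lam l, ((Q ^ T.charExp : ℂˣ) : ℂ) :=
  trace_of_basis_eigenvectors (V := NablaSpace lam l) (semistandardBasis (symBasis l))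
    (nablaSym lam l (diagSL2 Q)) (fun T => ((Q ^ T.charExp : ℂˣ) : ℂ))
    (nablaSym_diag_semistandardBasis lam l Q)

/-- The polytabloid of a filling by products of vectors of `ℂ²`, as a multilinear map. -/
def productPolytabloid : MultilinearMap ℂ
    (fun _ : Σ _ : lam.cells, Fin l => (Fin 2 → ℂ))
    (RowTensor lam (SymmetricPower ℂ (Fin l) (Fin 2 → ℂ))) :=
  (polytabloidMulti lam (SymmetricPower ℂ (Fin l) (Fin 2 → ℂ))).compMultilinearMap
    fun _ => SymmetricPower.tprod ℂ

theorem productPolytabloid_apply (v : (Σ _ : lam.cells, Fin l) → Fin 2 → ℂ) :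
    productPolytabloid lam l v =
      polytabloid fun c => SymmetricPower.tprod ℂ fun j => v ⟨c, j⟩ :=
  polytabloidMulti_apply _

theorem rowTensorRep_productPolytabloid (g : SL2) (v : (Σ _ : lam.cells, Fin l) → Fin 2 → ℂ) :
    rowTensorRep lam (symRep l natRep) g (productPolytabloid lam l v) =
      productPolytabloid lam l fun p => natRep g (v p) := by
  rw [productPolytabloid_apply, productPolytabloid_apply, rowTensorRep_polytabloid]
  exact congrArg polytabloid (funext fun c => symMap_tprod _ _ _)

/-- The value of `productPolytabloid` at standard basis vectors, as an element of
`∇^lam Sym^l ℂ²`. -/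
def stdPolytabloid (s : (Σ _ : lam.cells, Fin l) → Fin 2) : NablaSpace lam l :=
  ⟨productPolytabloid lam l fun p => stdVec (s p), by
    rw [productPolytabloid_apply]; exact Submodule.subset_span ⟨_, rfl⟩⟩

/-- The map from a tensor power of `ℂ²` onto `∇^lam Sym^l ℂ²`. -/
def tensorToNabla : EuclideanSpace ℂ ((Σ _ : lam.cells, Fin l) → Fin 2) →ₗ[ℂ]
    NablaSpace lam l where
  toFun x := ∑ s, x s • stdPolytabloid lam l s
  map_add' x y := by simp only [PiLp.add_apply, add_smul, Finset.sum_add_distrib]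
  map_smul' c x := by
    simp only [PiLp.smul_apply, smul_eq_mul, mul_smul, Finset.smul_sum, RingHom.id_apply]

theorem coe_tensorToNabla (x : EuclideanSpace ℂ ((Σ _ : lam.cells, Fin l) → Fin 2)) :
    (tensorToNabla lam l x : RowTensor lam _) =
      ∑ s, x s • productPolytabloid lam l fun p => stdVec (s p) := by
  simp [tensorToNabla, stdPolytabloid]

theorem tensorToNabla_surjective : Function.Surjective (tensorToNabla lam l) := by
  rw [← LinearMap.range_eq_top, ← top_le_iff, ← (semistandardBasis (symBasis l)).span_eq,
    Submodule.span_le]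
  rintro _ ⟨T, rfl⟩
  -- For each box with entry $k$ take $k$ factors $e_1$ followed by $l-k$ factors $e_0$; their
  -- symmetric product is the corresponding basis vector.
  refine ⟨EuclideanSpace.single (fun p => if (p.2 : ℕ) < T.entry p.1.1 then 1 else 0) 1,
    Subtype.ext ?_⟩
  rw [coe_tensorToNabla, semistandardBasis_apply,
    Finset.sum_eq_single (fun p => if (p.2 : ℕ) < T.entry p.1.1 then 1 else 0)]
  · simp only [symBasis_apply]
    rw [productPolytabloid_apply]
    simp
    rfl
  · intro s _ hs
    simp [hs]
  · simp

theorem tensorToNabla_tensAct (g : SL2)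
    (x : EuclideanSpace ℂ ((Σ _ : lam.cells, Fin l) → Fin 2)) :
    tensorToNabla lam l (tensAct g x) = nablaSym lam l g (tensorToNabla lam l x) := by
  refine Subtype.ext ?_
  change _ = rowTensorRep lam (symRep l natRep) g (tensorToNabla lam l x : RowTensor lam _)
  rw [coe_tensorToNabla, coe_tensorToNabla, map_sum]
  simp only [map_smul, rowTensorRep_productPolytabloid, natRep_stdVec]
  have h1 : ∀ s, tensAct g x s = ∑ s', (∏ p, g.1 (s p) (s' p)) * x s' := fun s => by
    change (Matrix.mulVec (kron fun _ => g.1) x.ofLp) s = _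
    rw [Matrix.mulVec, dotProduct]
    rfl
  simp only [h1, Finset.sum_smul]
  rw [Finset.sum_comm]
  refine Finset.sum_congr rfl fun s' _ => ?_
  rw [MultilinearMap.map_sum, Finset.smul_sum]
  refine Finset.sum_congr rfl fun s _ => ?_
  rw [MultilinearMap.map_smul_univ, smul_smul, mul_comm]

theorem exists_isStringRep_nablaSym : 
    ∃ (d : ℕ) (n : Fin d → ℕ), IsStringRep (V := NablaSpace lam l) (nablaSym lam l) n :=
  isStringRep_of_surjective (V := NablaSpace lam l) _ _ (tensorToNabla_surjective lam l) (tensorToNabla_tensAct lam l)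

end Character

end Plethysm
end

noncomputable section

namespace Plethysm

/-! ### The bialternant formula, by the branching rule. -/

section Bialternant

variable {A : Type} [CommRing A]

theorem det_columns_sum {N : ℕ} (x : Fin N → A) (S : Fin N → Finset ℕ) (c : Fin N → ℕ → A) :
    (Matrix.of fun i j : Fin N => ∑ b ∈ S j, c j b * x i ^ b).det =
      ∑ β ∈ Fintype.piFinset S, (∏ j, c j (β j)) *
        (Matrix.of fun i j : Fin N => x i ^ β j).det := by
  rw [← Matrix.det_transpose]
  have h := (Matrix.detRowAlternating (R := A) (n := Fin N)).toMultilinearMap.map_sum_finset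
    (fun j b => c j b • fun i => x i ^ b) S
  refine Eq.trans ?_ (h.trans (Finset.sum_congr rfl fun β _ => ?_))
  · congr 1
    ext j i
    simp [Matrix.transpose_apply, Finset.sum_apply]
  · rw [MultilinearMap.map_smul_univ, smul_eq_mul]
    congr 1
    exact Matrix.det_transpose (Matrix.of fun i j : Fin N => x i ^ β j)

theorem pow_sub_mul_pow_eq (x y : A) {a b : ℕ} (hab : a ≤ b) :
    x ^ b - y ^ (b - a) * x ^ a = (x - y) * ∑ k ∈ Finset.Ico a b, y ^ (b - 1 - k) * x ^ k := by
  obtain ⟨n, rfl⟩ := Nat.exists_eq_add_of_le hab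
  rw [Finset.sum_Ico_eq_sum_range, Nat.add_sub_cancel_left]
  have h := (Commute.all x y).mul_geom_sum₂ n
  have h2 : ∑ k ∈ Finset.range n, y ^ (a + n - 1 - (a + k)) * x ^ (a + k) =
      x ^ a * ∑ k ∈ Finset.range n, x ^ k * y ^ (n - 1 - k) := by
    rw [Finset.mul_sum]
    refine Finset.sum_congr rfl fun k _ => ?_
    rw [show a + n - 1 - (a + k) = n - 1 - k by omega, pow_add]
    ring
  rw [h2, mul_left_comm, h, pow_add]
  ring

/-- The branching rule for alternants. With $y$ the last variable, subtract from each column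
$y^{a_{j+1}-a_j}$ times the preceding one: the last row becomes $(y^{a_0},0,\dots,0)$ and each
remaining entry is $x_i-y$ times a geometric sum over the exponents in $[a_j,a_{j+1})$. Expanding
these sums by multilinearity gives the smaller alternants. -/
theorem det_pow_succ {N : ℕ} (x : Fin (N + 1) → A) (a : Fin (N + 1) → ℕ) (ha : Monotone a) :
    (Matrix.of fun i j => x i ^ a j).det =
      (∏ i : Fin N, (x (Fin.last N) - x i.castSucc)) *
      ∑ β ∈ Fintype.piFinset fun j : Fin N => Finset.Ico (a j.castSucc) (a j.succ),
        x (Fin.last N) ^ (a 0 + ∑ j : Fin N, (a j.succ - 1 - β j)) *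
          (Matrix.of fun i j : Fin N => x i.castSucc ^ β j).det := by
  set y := x (Fin.last N)
  let B : Matrix (Fin (N + 1)) (Fin (N + 1)) A := Matrix.of fun i =>
    Fin.cons (x i ^ a 0) fun j : Fin N =>
      x i ^ a j.succ - y ^ (a j.succ - a j.castSucc) * x i ^ a j.castSucc
  have hmono : ∀ j : Fin N, a j.castSucc ≤ a j.succ := fun j => ha (Fin.castSucc_lt_succ).le
  have hB : (Matrix.of fun i j => x i ^ a j).det = B.det := by
    refine Matrix.det_eq_of_forall_col_eq_smul_add_pred
      (fun j : Fin N => y ^ (a j.succ - a j.castSucc)) (fun i => by simp [B]) (fun i j => ?_)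
    simp [B]
  have hlast : ∀ j : Fin N, B (Fin.last N) j.succ = 0 := fun j => by
    simp only [B, Matrix.of_apply, Fin.cons_succ]
    rw [← pow_add, Nat.sub_add_cancel (hmono j), sub_self]
  rw [hB, Matrix.det_succ_row B (Fin.last N), Fin.sum_univ_succ, Finset.sum_eq_zero
    (fun j _ => by rw [hlast, mul_zero, zero_mul]), add_zero]
  have hsub : B.submatrix (Fin.last N).succAbove (Fin.succAbove 0) =
      Matrix.of fun i j : Fin N => (x i.castSucc - y) *
        ∑ b ∈ Finset.Ico (a j.castSucc) (a j.succ), y ^ (a j.succ - 1 - b) * x i.castSucc ^ b := by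
    ext i j
    simp only [B, Matrix.submatrix_apply, Fin.succAbove_last, Fin.succAbove_zero, Matrix.of_apply,
      Fin.cons_succ]
    exact pow_sub_mul_pow_eq _ _ (hmono j)
  rw [hsub]
  have hscale := Matrix.det_mul_column (fun i : Fin N => x i.castSucc - y)
    (Matrix.of fun i j : Fin N =>
      ∑ b ∈ Finset.Ico (a j.castSucc) (a j.succ), y ^ (a j.succ - 1 - b) * x i.castSucc ^ b)
  simp only [Matrix.of_apply] at hscale
  rw [hscale, det_columns_sum (fun i : Fin N => x i.castSucc)]
  have hsign : ∏ i : Fin N, (y - x i.castSucc) = (-1) ^ N * ∏ i : Fin N, (x i.castSucc - y) := by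
    have : ∀ i : Fin N, y - x i.castSucc = (-1) * (x i.castSucc - y) := fun i => by ring
    simp only [this, Finset.prod_mul_distrib]
    simp
  have hB0 : B (Fin.last N) 0 = y ^ a 0 := by simp [B, y]
  rw [hsign, hB0]
  simp only [Fin.val_last, Fin.val_zero, add_zero]
  rw [mul_assoc, mul_assoc]
  congr 1
  rw [mul_left_comm]
  congr 1
  rw [Finset.mul_sum]
  refine Finset.sum_congr rfl fun β _ => ?_
  rw [pow_add, Finset.prod_pow_eq_pow_sum, mul_assoc]

theorem det_vandermonde_succ {N : ℕ} (x : Fin (N + 1) → A) :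
    (Matrix.of fun i j : Fin (N + 1) => x i ^ (j : ℕ)).det =
      (∏ i : Fin N, (x (Fin.last N) - x i.castSucc)) *
        (Matrix.of fun i j : Fin N => x i.castSucc ^ (j : ℕ)).det := by
  rw [det_pow_succ x (fun j => (j : ℕ)) (fun i j h => h)]
  congr 1
  have : (Fintype.piFinset fun j : Fin N => Finset.Ico (j.castSucc : ℕ) (j.succ : ℕ)) =
      {(fun j => (j : ℕ) : Fin N → ℕ)} := by
    ext β
    simp only [Fintype.mem_piFinset, Finset.mem_Ico, Finset.mem_singleton, Fin.val_castSucc,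
      Fin.val_succ, funext_iff]
    exact forall_congr' fun j => by omega
  rw [this, Finset.sum_singleton]
  simp

/-- A semistandard filling of the diagram with row lengths `r 0 ≥ r 1 ≥ ⋯ ≥ r (N - 1)` with
entries less than `N`, extended by zero. -/
structure IsTab {N : ℕ} (r : Fin N → ℕ) (T : Fin N → ℕ → ℕ) : Prop where
  row_le : ∀ i j₁ j₂, j₁ ≤ j₂ → j₂ < r i → T i j₁ ≤ T i j₂
  col_lt : ∀ i₁ i₂ j, i₁ < i₂ → j < r i₂ → T i₁ j < T i₂ j
  eq_zero : ∀ i j, r i ≤ j → T i j = 0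
  lt : ∀ i j, j < r i → T i j < N

theorem finite_isTab {N : ℕ} (r : Fin N → ℕ) : {T | IsTab r T}.Finite := by
  refine Set.Finite.of_finite_image (f := fun T : Fin N → ℕ → ℕ =>
    fun p : Σ i, Fin (r i) => T p.1 p.2) ?_ ?_
  · refine Set.Finite.subset (Set.Finite.pi' (t := fun _ : Σ i, Fin (r i) => Set.Iio N)
      fun _ => Set.finite_Iio N) ?_
    rintro _ ⟨T, hT, rfl⟩ p
    exact hT.lt _ _ p.2.2
  · intro T hT S hS h
    funext i j
    by_cases hj : j < r i
    · exact congrFun h ⟨i, ⟨j, hj⟩⟩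
    · rw [hT.eq_zero i j (not_lt.1 hj), hS.eq_zero i j (not_lt.1 hj)]

/-- The semistandard fillings of the diagram with row lengths `r`. -/
def tabs {N : ℕ} (r : Fin N → ℕ) : Finset (Fin N → ℕ → ℕ) := (finite_isTab r).toFinset

theorem mem_tabs {N : ℕ} {r : Fin N → ℕ} {T : Fin N → ℕ → ℕ} : T ∈ tabs r ↔ IsTab r T := by
  simp [tabs]

/-- The Schur polynomial of the diagram with row lengths `r`. -/
def tabSum {N : ℕ} (x : ℕ → A) (r : Fin N → ℕ) : A :=
  ∑ T ∈ tabs r, ∏ i, ∏ j ∈ Finset.range (r i), x (T i j)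

theorem lt_card_filter_range_iff {n : ℕ} {p : ℕ → Prop} [DecidablePred p]
    (hp : ∀ i j, i ≤ j → j < n → p j → p i) {j : ℕ} (hj : j < n) :
    j < ((Finset.range n).filter p).card ↔ p j := by
  constructor
  · intro h
    by_contra hnot
    have : (Finset.range n).filter p ⊆ Finset.range j := fun k hk => by
      rw [Finset.mem_filter, Finset.mem_range] at hk
      rw [Finset.mem_range]
      by_contra hjk
      exact hnot (hp j k (not_lt.1 hjk) hk.1 hk.2)
    have := Finset.card_le_card this
    rw [Finset.card_range] at this
    omega
  · intro h
    have : Finset.range (j + 1) ⊆ (Finset.range n).filter p := fun k hk => by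
      rw [Finset.mem_range] at hk
      rw [Finset.mem_filter, Finset.mem_range]
      exact ⟨by omega, hp k j (by omega) hj h⟩
    have := Finset.card_le_card this
    rw [Finset.card_range] at this
    omega

variable {N : ℕ} {r : Fin (N + 1) → ℕ}

theorem IsTab.le {r : Fin N → ℕ} (hr : Antitone r) {T : Fin N → ℕ → ℕ} (hT : IsTab r T)
    (i : Fin N) {j : ℕ} (hj : j < r i) : (i : ℕ) ≤ T i j := by
  obtain ⟨i, hi⟩ := i
  induction i with
  | zero => exact Nat.zero_le _
  | succ i ih =>
    have hlt : (⟨i, by omega⟩ : Fin N) < ⟨i + 1, hi⟩ := Fin.mk_lt_mk.2 (Nat.lt_succ_self i)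
    exact (ih _ (hj.trans_le (hr hlt.le))).trans_lt (hT.col_lt _ _ j hlt hj)

/-- The numbers of entries less than `N` in the first `N` rows of a filling. -/
def rowCut (r : Fin (N + 1) → ℕ) (T : Fin (N + 1) → ℕ → ℕ) (i : Fin N) : ℕ :=
  ((Finset.range (r i.castSucc)).filter fun j => T i.castSucc j < N).card

theorem lt_rowCut_iff {T : Fin (N + 1) → ℕ → ℕ} (hT : IsTab r T) (i : Fin N) {j : ℕ}
    (hj : j < r i.castSucc) : j < rowCut r T i ↔ T i.castSucc j < N :=
  lt_card_filter_range_iff (fun _ _ h1 h2 h => (hT.row_le _ _ _ h1 h2).trans_lt h) hj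

/-- Interlacing: entries are at most `N`, so by column strictness a box with another box below it
has an entry smaller than `N`. -/
theorem rowCut_mem (hr : Antitone r) {T : Fin (N + 1) → ℕ → ℕ} (hT : IsTab r T) (i : Fin N) :
    rowCut r T i ∈ Finset.Icc (r i.succ) (r i.castSucc) := by
  rw [Finset.mem_Icc]
  constructor
  · rw [rowCut, ← Finset.card_range (r i.succ)]
    refine Finset.card_le_card fun j hj => ?_
    rw [Finset.mem_range] at hj
    rw [Finset.mem_filter, Finset.mem_range]
    have h1 := hT.col_lt i.castSucc i.succ j Fin.castSucc_lt_succ hj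
    have h2 := hT.lt _ _ hj
    exact ⟨hj.trans_le (hr Fin.castSucc_lt_succ.le), by omega⟩
  · exact (Finset.card_filter_le _ _).trans (Finset.card_range _).le

/-- The filling of a diagram with row lengths `m` obtained by removing the other entries. -/
def cutTab (m : Fin N → ℕ) (T : Fin (N + 1) → ℕ → ℕ) : Fin N → ℕ → ℕ :=
  fun i j => if j < m i then T i.castSucc j else 0

/-- The filling of a diagram with row lengths `r` obtained by adding entries `N`. -/
def extendTab (r : Fin (N + 1) → ℕ) (m : Fin N → ℕ) (T : Fin N → ℕ → ℕ) :
    Fin (N + 1) → ℕ → ℕ :=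
  Fin.snoc (α := fun _ => ℕ → ℕ)
    (fun i j => if j < m i then T i j else if j < r i.castSucc then N else 0)
    (fun j => if j < r (Fin.last N) then N else 0)

theorem extendTab_castSucc (m : Fin N → ℕ) (T : Fin N → ℕ → ℕ) (i : Fin N) (j : ℕ) :
    extendTab r m T i.castSucc j =
      if j < m i then T i j else if j < r i.castSucc then N else 0 := by
  rw [extendTab, Fin.snoc_castSucc]

theorem extendTab_last (m : Fin N → ℕ) (T : Fin N → ℕ → ℕ) (j : ℕ) :
    extendTab r m T (Fin.last N) j = if j < r (Fin.last N) then N else 0 := by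
  rw [extendTab, Fin.snoc_last]

variable {m : Fin N → ℕ}

theorem isTab_cutTab (hm : ∀ i, m i ∈ Finset.Icc (r i.succ) (r i.castSucc))
    {T : Fin (N + 1) → ℕ → ℕ} (hT : IsTab r T) (hcut : rowCut r T = m) :
    IsTab m (cutTab m T) := by
  subst hcut
  have hle : ∀ i, rowCut r T i ≤ r i.castSucc := fun i => (Finset.mem_Icc.1 (hm i)).2
  constructor
  · intro i j₁ j₂ h1 h2
    rw [cutTab, cutTab, if_pos h2, if_pos (h1.trans_lt h2)]
    exact hT.row_le _ _ _ h1 (h2.trans_le (hle i))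
  · intro i₁ i₂ j hi hj
    have hjr := hj.trans_le (hle i₂)
    have h1 := hT.col_lt i₁.castSucc i₂.castSucc j (Fin.castSucc_lt_castSucc_iff.2 hi) hjr
    rw [cutTab, cutTab, if_pos hj]
    split_ifs with h
    · exact h1
    · omega
  · intro i j hj
    rw [cutTab, if_neg (not_lt.2 hj)]
  · intro i j hj
    rw [cutTab, if_pos hj]
    exact (lt_rowCut_iff hT i (hj.trans_le (hle i))).1 hj

theorem isTab_extendTab (hr : Antitone r) (hm : ∀ i, m i ∈ Finset.Icc (r i.succ) (r i.castSucc))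
    {T : Fin N → ℕ → ℕ} (hT : IsTab m T) : IsTab r (extendTab r m T) := by
  have hm1 : ∀ i, r i.succ ≤ m i := fun i => (Finset.mem_Icc.1 (hm i)).1
  have hm2 : ∀ i, m i ≤ r i.castSucc := fun i => (Finset.mem_Icc.1 (hm i)).2
  constructor
  · intro i j₁ j₂ h1 h2
    induction i using Fin.lastCases with
    | last => rw [extendTab_last, extendTab_last, if_pos h2, if_pos (h1.trans_lt h2)]
    | cast i =>
      rw [extendTab_castSucc, extendTab_castSucc, if_pos h2, if_pos (h1.trans_lt h2)]
      split_ifs with h3 h4 h4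
      · exact hT.row_le _ _ _ h1 h4
      · exact (hT.lt _ _ h3).le
      · omega
      · exact le_rfl
  · intro i₁ i₂ j hi hj
    induction i₁ using Fin.lastCases with
    | last => exact absurd hi (not_lt.2 (Fin.le_last i₂))
    | cast i₁ =>
      have h1 : j < m i₁ :=
        hj.trans_le ((hr (Fin.castSucc_lt_iff_succ_le.1 hi)).trans (hm1 i₁))
      rw [extendTab_castSucc, if_pos h1]
      induction i₂ using Fin.lastCases with
      | last =>
        rw [extendTab_last, if_pos hj]
        exact hT.lt _ _ h1
      | cast i₂ =>
        rw [extendTab_castSucc]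
        split_ifs with h2
        · exact hT.col_lt _ _ _ (Fin.castSucc_lt_castSucc_iff.1 hi) h2
        · exact hT.lt _ _ h1
  · intro i j hj
    induction i using Fin.lastCases with
    | last => rw [extendTab_last, if_neg (not_lt.2 hj)]
    | cast i =>
      rw [extendTab_castSucc, if_neg (not_lt.2 ((hm2 i).trans hj)), if_neg (not_lt.2 hj)]
  · intro i j hj
    induction i using Fin.lastCases with
    | last => rw [extendTab_last, if_pos hj]; exact Nat.lt_succ_self N
    | cast i =>
      rw [extendTab_castSucc]
      split_ifs with h
      · exact (hT.lt _ _ h).trans (Nat.lt_succ_self N)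
      · exact Nat.lt_succ_self N

theorem rowCut_extendTab (hm : ∀ i, m i ∈ Finset.Icc (r i.succ) (r i.castSucc))
    {T : Fin N → ℕ → ℕ} (hT : IsTab m T) : rowCut r (extendTab r m T) = m := by
  funext i
  have hm2 := (Finset.mem_Icc.1 (hm i)).2
  rw [rowCut]
  convert Finset.card_range (m i) using 2
  ext j
  rw [Finset.mem_filter, Finset.mem_range, Finset.mem_range, extendTab_castSucc]
  constructor
  · rintro ⟨h1, h2⟩
    by_contra h3
    rw [if_neg h3, if_pos h1] at h2
    omega
  · intro h
    rw [if_pos h]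
    exact ⟨by omega, hT.lt _ _ h⟩

theorem prod_extendTab (x : ℕ → A) (hm : ∀ i, m i ∈ Finset.Icc (r i.succ) (r i.castSucc))
    (T : Fin N → ℕ → ℕ) :
    ∏ i, ∏ j ∈ Finset.range (r i), x (extendTab r m T i j) =
      x N ^ (r (Fin.last N) + ∑ i : Fin N, (r i.castSucc - m i)) *
        ∏ i, ∏ j ∈ Finset.range (m i), x (T i j) := by
  rw [Fin.prod_univ_castSucc, pow_add, ← Finset.prod_pow_eq_pow_sum, mul_comm, mul_assoc,
    ← Finset.prod_mul_distrib]
  congr 1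
  · rw [← Finset.card_range (r (Fin.last N)), ← Finset.prod_const]
    simp only [Finset.card_range]
    refine Finset.prod_congr rfl fun j hj => ?_
    rw [extendTab_last, if_pos (Finset.mem_range.1 hj)]
  · refine Finset.prod_congr rfl fun i _ => ?_
    rw [← Finset.prod_range_mul_prod_Ico _ (Finset.mem_Icc.1 (hm i)).2, mul_comm]
    congr 1
    · rw [← Nat.card_Ico, ← Finset.prod_const]
      refine Finset.prod_congr rfl fun j hj => ?_
      rw [Finset.mem_Ico] at hj
      rw [extendTab_castSucc, if_neg (not_lt.2 hj.1), if_pos hj.2]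
    · refine Finset.prod_congr rfl fun j hj => ?_
      rw [extendTab_castSucc, if_pos (Finset.mem_range.1 hj)]

theorem cutTab_extendTab {T : Fin N → ℕ → ℕ} (hT : IsTab m T) :
    cutTab m (extendTab r m T) = T := by
  funext i j
  rw [cutTab, extendTab_castSucc]
  split_ifs with h
  · rfl
  · exact (hT.eq_zero i j (not_lt.1 h)).symm

theorem extendTab_cutTab (hr : Antitone r)
    (hm : ∀ i, m i ∈ Finset.Icc (r i.succ) (r i.castSucc))
    {T : Fin (N + 1) → ℕ → ℕ} (hT : IsTab r T) (hcut : rowCut r T = m) :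
    extendTab r m (cutTab m T) = T := by
  subst hcut
  funext i j
  induction i using Fin.lastCases with
  | last =>
    rw [extendTab_last]
    split_ifs with h
    · have h1 := hT.le hr _ h
      have h2 := hT.lt _ _ h
      rw [Fin.val_last] at h1
      omega
    · exact (hT.eq_zero _ _ (not_lt.1 h)).symm
  | cast i =>
    rw [extendTab_castSucc]
    split_ifs with h1 h2
    · rw [cutTab, if_pos h1]
    · rw [lt_rowCut_iff hT i h2] at h1
      have := hT.lt _ _ h2
      omega
    · exact (hT.eq_zero _ _ (not_lt.1 h2)).symm

/-- The branching rule for tableaux: removing the entries `N` leaves a tableau whose shape `m`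
interlaces with `r`, and the removed boxes are recovered from the two shapes. -/
theorem tabSum_succ (x : ℕ → A) (hr : Antitone r) :
    tabSum x r = ∑ m ∈ Fintype.piFinset fun i : Fin N => Finset.Icc (r i.succ) (r i.castSucc),
      x N ^ (r (Fin.last N) + ∑ i : Fin N, (r i.castSucc - m i)) * tabSum x m := by
  rw [tabSum, ← Finset.sum_fiberwise_of_maps_to (g := rowCut r)
    (t := Fintype.piFinset fun i : Fin N => Finset.Icc (r i.succ) (r i.castSucc))
    fun T hT => Fintype.mem_piFinset.2 (rowCut_mem hr (mem_tabs.1 hT))]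
  refine Finset.sum_congr rfl fun m hm => ?_
  rw [Fintype.mem_piFinset] at hm
  rw [tabSum, Finset.mul_sum]
  refine Finset.sum_bij' (fun T _ => cutTab m T) (fun T _ => extendTab r m T) ?_ ?_ ?_ ?_ ?_
  · intro T hT
    rw [Finset.mem_filter, mem_tabs] at hT
    exact mem_tabs.2 (isTab_cutTab hm hT.1 hT.2)
  · intro T hT
    rw [mem_tabs] at hT
    rw [Finset.mem_filter, mem_tabs]
    exact ⟨isTab_extendTab hr hm hT, rowCut_extendTab hm hT⟩
  · intro T hT
    rw [Finset.mem_filter, mem_tabs] at hT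
    exact extendTab_cutTab hr hm hT.1 hT.2
  · intro T hT
    exact cutTab_extendTab (mem_tabs.1 hT)
  · intro T hT
    rw [Finset.mem_filter, mem_tabs] at hT
    rw [← prod_extendTab x hm, extendTab_cutTab hr hm hT.1 hT.2]

/-- The bialternant formula. -/
theorem tabSum_mul_vandermonde (x : ℕ → A) {N : ℕ} (r : Fin N → ℕ) (hr : Antitone r) :
    tabSum x r * (Matrix.of fun i j : Fin N => x i ^ (j : ℕ)).det =
      (Matrix.of fun i j : Fin N => x i ^ (r j.rev + j)).det := by
  induction N with
  | zero =>
    have : tabs r = {fun _ _ => 0} := by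
      ext T
      rw [mem_tabs, Finset.mem_singleton]
      exact ⟨fun _ => funext fun i => i.elim0, fun _ =>
        ⟨fun i => i.elim0, fun i => i.elim0, fun i => i.elim0, fun i => i.elim0⟩⟩
    simp [tabSum, this]
  | succ N ih =>
    rw [det_vandermonde_succ fun i : Fin (N + 1) => x i, det_pow_succ (fun i : Fin (N + 1) => x i)
      (fun j => r j.rev + j) (fun i j h => Nat.add_le_add (hr (Fin.rev_le_rev.2 h)) h),
      mul_left_comm]
    congr 1
    rw [tabSum_succ x hr, Finset.sum_mul]
    -- Adding the staircase turns the closed interlacing intervals for `m` into the half-open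
    -- exponent intervals of `det_pow_succ`, so the two branching rules match term by term.
    refine Finset.sum_bij' (fun m _ j => m j.rev + j) (fun β _ i => β i.rev - i.rev)
      ?_ ?_ ?_ ?_ ?_
    · intro m hm
      rw [Fintype.mem_piFinset] at hm ⊢
      intro j
      have := Finset.mem_Icc.1 (hm j.rev)
      rw [Finset.mem_Ico, Fin.rev_castSucc, Fin.rev_succ, Fin.val_castSucc, Fin.val_succ]
      omega
    · intro β hβ
      rw [Fintype.mem_piFinset] at hβ ⊢
      intro i
      have := Finset.mem_Ico.1 (hβ i.rev)
      rw [Fin.rev_castSucc, Fin.rev_succ, Fin.val_castSucc, Fin.val_succ, Fin.rev_rev] at this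
      rw [Finset.mem_Icc]
      omega
    · intro m hm
      funext i
      simp
    · intro β hβ
      rw [Fintype.mem_piFinset] at hβ
      funext j
      have := Finset.mem_Ico.1 (hβ j)
      rw [Fin.val_castSucc] at this
      simp only [Fin.rev_rev]
      omega
    · intro m hm
      rw [Fintype.mem_piFinset] at hm
      have hm1 : ∀ i, r i.succ ≤ m i := fun i => (Finset.mem_Icc.1 (hm i)).1
      have hm2 : ∀ i, m i ≤ r i.castSucc := fun i => (Finset.mem_Icc.1 (hm i)).2
      have hanti : Antitone m := by
        intro i₁ i₂ h
        rcases h.eq_or_lt with rfl | h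
        · exact le_rfl
        · exact (hm2 i₂).trans ((hr (Fin.succ_le_castSucc_iff.2 h)).trans (hm1 i₁))
      have h := ih m hanti
      simp only [Fin.val_last, Fin.val_castSucc]
      rw [mul_assoc, h]
      congr 2
      rw [Fin.rev_zero, Fin.val_zero, add_zero]
      congr 1
      rw [← Equiv.sum_comp Fin.revPerm]
      refine Finset.sum_congr rfl fun j _ => ?_
      have := hm2 j.rev
      rw [Fin.revPerm_apply, Fin.rev_succ, Fin.val_succ]
      omega

theorem sum_ssyt_eq_tabSum (x : ℕ → A) (lam : YoungDiagram) (l : ℕ) (hl : lam.colLen 0 ≤ l + 1) :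
    ∑ t : SSYTLe lam l, ∏ c ∈ lam.cells, x (t.entry c) =
      tabSum x fun i : Fin (l + 1) => lam.rowLen i := by
  have hrow : ∀ {i j : ℕ}, (i, j) ∈ lam → i < l + 1 := fun h =>
    (YoungDiagram.mem_iff_lt_colLen.1 (lam.up_left_mem le_rfl (Nat.zero_le _) h)).trans_le hl
  refine Finset.sum_bij (fun t _ i j => t.1 i j) ?_ ?_ ?_ ?_
  · intro t _
    rw [mem_tabs]
    refine ⟨fun i j₁ j₂ h1 h2 => ?_, fun i₁ i₂ j h1 h2 => ?_, fun i j h => ?_, fun i j _ => ?_⟩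
    · exact t.1.row_weak_of_le h1 (YoungDiagram.mem_iff_lt_rowLen.2 h2)
    · exact t.1.col_strict h1 (YoungDiagram.mem_iff_lt_rowLen.2 h2)
    · exact t.1.zeros fun h' => absurd (YoungDiagram.mem_iff_lt_rowLen.1 h') (not_lt.2 h)
    · exact Nat.lt_succ_of_le (t.2 _ _)
  · intro t _ s _ h
    refine Subtype.ext (SemistandardYoungTableau.ext fun i j => ?_)
    by_cases hc : (i, j) ∈ lam
    · exact congrFun (congrFun h ⟨i, hrow hc⟩) j
    · rw [s.1.zeros hc, t.1.zeros hc]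
  · intro T hT
    rw [mem_tabs] at hT
    let t : SemistandardYoungTableau lam :=
      { entry := fun i j => if h : i < l + 1 then T ⟨i, h⟩ j else 0
        row_weak' := fun {i j1 j2} hj h2 => by
          rw [dif_pos (hrow h2), dif_pos (hrow h2)]
          exact hT.row_le _ _ _ hj.le (YoungDiagram.mem_iff_lt_rowLen.1 h2)
        col_strict' := fun {i1 i2 j} hi h2 => by
          have h3 := hrow h2
          rw [dif_pos h3, dif_pos (hi.trans h3)]
          exact hT.col_lt _ _ _ hi (YoungDiagram.mem_iff_lt_rowLen.1 h2)
        zeros' := fun {i j} h => by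
          split_ifs with hi
          · refine hT.eq_zero _ _ (not_lt.1 fun h' => h (YoungDiagram.mem_iff_lt_rowLen.2 h'))
          · rfl }
    refine ⟨⟨t, fun i j => ?_⟩, Finset.mem_univ _, ?_⟩
    · change (if h : i < l + 1 then T ⟨i, h⟩ j else 0) ≤ l
      split_ifs with h
      · by_cases hj : j < lam.rowLen i
        · exact Nat.lt_succ_iff.1 (hT.lt ⟨i, h⟩ j hj)
        · rw [hT.eq_zero ⟨i, h⟩ j (not_lt.1 hj)]
          exact Nat.zero_le _
      · exact Nat.zero_le _
    · funext i j
      exact dif_pos i.2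
  · intro t _
    rw [Finset.prod_sigma']
    refine Finset.prod_bij' (fun c hc => ⟨⟨c.1, hrow ((YoungDiagram.mem_cells _).1 hc)⟩, c.2⟩)
      (fun p _ => (p.1, p.2)) ?_ ?_ ?_ ?_ ?_
    · intro c hc
      simp only [Finset.mem_sigma, Finset.mem_univ, true_and, Finset.mem_range]
      exact YoungDiagram.mem_iff_lt_rowLen.1 ((YoungDiagram.mem_cells _).1 hc)
    · intro p hp
      simp only [Finset.mem_sigma, Finset.mem_univ, true_and, Finset.mem_range] at hp
      exact mem_of_rowLen hp
    · intro c _; rfl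
    · intro p _; rfl
    · intro c _; rfl

end Bialternant

end Plethysm
end

noncomputable section

namespace Plethysm

/-! ### Hook lengths, contents and the pyramid. -/

section HookPyramid

theorem map_val_eq_sum_singleton {ι : Type} (s : Finset ι) (f : ι → ℤ) :
    s.val.map f = ∑ i ∈ s, {f i} := by
  exact (Multiset.sum_map_singleton _).symm.trans
    (congrArg Multiset.sum (Multiset.map_map (fun a : ℤ => ({a} : Multiset ℤ)) f s.val))

/-- The differences of the strictly decreasing sequence `lam_i - i`. -/
def rowDiff (lam : YoungDiagram) (i k : ℕ) : ℤ :=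
  ((lam.rowLen i : ℤ) - i) - ((lam.rowLen k : ℤ) - k)

theorem sum_Ico_delta (lam : YoungDiagram) {i k : ℕ} (h : i ≤ k) :
    ∑ j ∈ Finset.Ico i k, delta lam j = rowDiff lam i k := by
  induction k, h using Nat.le_induction with
  | base => simp [rowDiff]
  | succ k h ih =>
    rw [Finset.sum_Ico_succ_top h, ih, rowDiff, rowDiff, delta]
    push_cast
    ring

theorem pyramid_eq_sum (lam : YoungDiagram) (l : ℕ) :
    pyramid lam l = ∑ i ∈ Finset.range (l + 1), ∑ k ∈ Finset.Ioc i l, {rowDiff lam i k} := by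
  rw [pyramid, map_val_eq_sum_singleton, Finset.sum_sigma']
  refine Finset.sum_bij' (fun p _ => ⟨p.1, p.2⟩) (fun p _ => (p.1, p.2)) ?_ ?_ ?_ ?_ ?_
  · intro p hp
    simp only [Finset.mem_filter, Finset.mem_product, Finset.mem_range, Finset.mem_sigma,
      Finset.mem_Ioc] at hp ⊢
    omega
  · intro p hp
    simp only [Finset.mem_filter, Finset.mem_product, Finset.mem_range, Finset.mem_sigma,
      Finset.mem_Ioc] at hp ⊢
    omega
  · intro p _; rfl
  · intro p _; rfl
  · intro p hp
    simp only [Finset.mem_filter] at hp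
    rw [sum_Ico_delta lam hp.2.le]

theorem rowDiff_pos (lam : YoungDiagram) {i k : ℕ} (h : i < k) : 0 < rowDiff lam i k := by
  have := lam.rowLen_anti i k h.le
  rw [rowDiff]
  omega

theorem pos_of_mem_pyramid {lam : YoungDiagram} {l : ℕ} {x : ℤ} (hx : x ∈ pyramid lam l) :
    0 < x := by
  rw [pyramid, Multiset.mem_map] at hx
  obtain ⟨p, hp, rfl⟩ := hx
  have h := (Finset.mem_filter.1 hp).2
  rw [sum_Ico_delta lam h.le]
  exact rowDiff_pos lam h

theorem pos_of_mem_staircase {l : ℕ} {x : ℤ} (hx : x ∈ staircase l) : 0 < x := by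
  rw [staircase, Multiset.mem_sum] at hx
  obtain ⟨i, -, h⟩ := hx
  rw [Multiset.eq_of_mem_replicate h]
  positivity

theorem staircase_eq_sum (l : ℕ) :
    staircase l = ∑ i ∈ Finset.range (l + 1), ∑ x ∈ Finset.range (l - i), {(x : ℤ) + 1} := by
  have hsucc : ∀ l, staircase (l + 1) =
      staircase l + ∑ x ∈ Finset.range (l + 1), {(x : ℤ) + 1} := fun l => by
    have h : ∀ i ∈ Finset.range (l + 1), Multiset.replicate (l + 1 - i) ((i : ℤ) + 1) =
        Multiset.replicate (l - i) ((i : ℤ) + 1) + {(i : ℤ) + 1} := fun i hi => by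
      rw [Nat.succ_sub (Nat.lt_succ_iff.1 (Finset.mem_range.1 hi)), Multiset.replicate_succ,
        ← Multiset.singleton_add, add_comm]
    rw [staircase, Finset.sum_congr rfl h, Finset.sum_add_distrib, Finset.sum_range_succ]
    simp [staircase]
  rw [← Finset.sum_range_reflect]
  have h : ∀ j ∈ Finset.range (l + 1), ∑ x ∈ Finset.range (l - (l + 1 - 1 - j)),
      ({(x : ℤ) + 1} : Multiset ℤ) = ∑ x ∈ Finset.range j, {(x : ℤ) + 1} := fun j hj => by
    rw [Finset.mem_range] at hj
    rw [show l - (l + 1 - 1 - j) = j by omega]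
  rw [Finset.sum_congr rfl h]
  induction l with
  | zero => simp [staircase]
  | succ l ih =>
    rw [Finset.sum_range_succ, ← ih, hsucc]
    intro j hj
    rw [Finset.mem_range] at hj
    rw [show l - (l + 1 - 1 - j) = j by omega]

/-- This lets the Vandermonde denominator be treated as the numerator for the empty diagram. -/
theorem pyramid_bot (l : ℕ) : pyramid ⊥ l = staircase l := by
  rw [pyramid_eq_sum, staircase_eq_sum]
  refine Finset.sum_congr rfl fun i _ => ?_
  refine Finset.sum_bij' (fun k _ => k - i - 1) (fun x _ => x + i + 1) ?_ ?_ ?_ ?_ ?_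
  all_goals
    intro k hk
    simp only [Finset.mem_Ioc, Finset.mem_range] at hk ⊢
  · omega
  · omega
  · omega
  · omega
  · have h : ∀ n, YoungDiagram.rowLen ⊥ n = 0 := fun n => by
      by_contra h0
      exact YoungDiagram.notMem_bot _ (YoungDiagram.mem_iff_lt_rowLen.2 (Nat.pos_of_ne_zero h0))
    rw [rowDiff, h, h]
    congr 1
    omega

/-- The hook length of a box. -/
def hook (lam : YoungDiagram) (i j : ℕ) : ℤ :=
  ((lam.rowLen i : ℤ) - ((i : ℤ) + 1)) + ((lam.colLen j : ℤ) - ((j : ℤ) + 1)) + 1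

theorem sum_cells {M : Type} [AddCommMonoid M] (lam : YoungDiagram) {l : ℕ}
    (hl : lam.colLen 0 ≤ l + 1) (f : ℕ → ℕ → M) :
    ∑ c ∈ lam.cells, f c.1 c.2 =
      ∑ i ∈ Finset.range (l + 1), ∑ j ∈ Finset.range (lam.rowLen i), f i j := by
  rw [Finset.sum_sigma']
  refine Finset.sum_bij' (fun p _ => ⟨p.1, p.2⟩) (fun p _ => (p.1, p.2)) ?_ ?_ ?_ ?_ ?_
  · intro c hc
    have hc' := (YoungDiagram.mem_cells _).1 hc
    simp only [Finset.mem_sigma, Finset.mem_range]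
    exact ⟨(YoungDiagram.mem_iff_lt_colLen.1
      (lam.up_left_mem le_rfl (Nat.zero_le _) hc')).trans_le hl,
      YoungDiagram.mem_iff_lt_rowLen.1 hc'⟩
  · intro p hp
    simp only [Finset.mem_sigma, Finset.mem_range] at hp
    exact mem_of_rowLen hp.2
  · intro p _; rfl
  · intro p _; rfl
  · intro p _; rfl

/-- The hook lengths of row `i` and the differences to the later rows are pairwise distinct, lie
between $1$ and $l-i+\lambda_i$, and have that number in total. -/
theorem hook_row_add_rowDiff (lam : YoungDiagram) {l : ℕ} (hl : lam.colLen 0 ≤ l + 1) {i : ℕ}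
    (hi : i ≤ l) :
    ∑ j ∈ Finset.range (lam.rowLen i), {hook lam i j} + ∑ k ∈ Finset.Ioc i l, {rowDiff lam i k} =
      ∑ x ∈ Finset.range (l - i + lam.rowLen i), ({(x : ℤ) + 1} : Multiset ℤ) := by
  have hcol : ∀ j, lam.colLen j ≤ l + 1 := fun j => (lam.colLen_anti 0 j (Nat.zero_le _)).trans hl
  have hiff : ∀ a b, a < lam.colLen b ↔ b < lam.rowLen a := fun a b =>
    YoungDiagram.mem_iff_lt_colLen.symm.trans YoungDiagram.mem_iff_lt_rowLen
  let F : ℕ ⊕ ℕ → ℤ := Sum.elim (hook lam i) (rowDiff lam i)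
  let S := (Finset.range (lam.rowLen i)).disjSum (Finset.Ioc i l)
  have hinj : Set.InjOn F S := by
    rintro (j | k) h1 (j' | k') h2 h
    · refine congrArg _ ?_
      simp only [F, Sum.elim_inl, hook] at h
      rcases lt_trichotomy j j' with h3 | h3 | h3
      · have := lam.colLen_anti _ _ h3.le
        omega
      · exact h3
      · have := lam.colLen_anti _ _ h3.le
        omega
    -- The hook minus the difference is $(\lambda'_j-k')+(\lambda_{k'}-j)-1$. Since $k'<\lambda'_j$
    -- iff $j<\lambda_{k'}$, it is at least $1$ or at most $-1$.
    · exfalso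
      simp only [F, Sum.elim_inl, Sum.elim_inr, hook, rowDiff] at h
      have := hiff k' j
      omega
    · exfalso
      simp only [F, Sum.elim_inl, Sum.elim_inr, hook, rowDiff] at h
      have := hiff k j'
      omega
    · refine congrArg _ ?_
      simp only [F, Sum.elim_inr, rowDiff] at h
      rcases lt_trichotomy k k' with h3 | h3 | h3
      · have := lam.rowLen_anti _ _ h3.le
        omega
      · exact h3
      · have := lam.rowLen_anti _ _ h3.le
        omega
  let G : ℕ → ℤ := fun x => (x : ℤ) + 1
  have hG : Function.Injective G := fun a b h => by simp only [G] at h; omega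
  have himg : S.image F = (Finset.range (l - i + lam.rowLen i)).image G := by
    refine Finset.eq_of_subset_of_card_le ?_ ?_
    · intro y hy
      rw [Finset.mem_image] at hy ⊢
      obtain ⟨p, hp, rfl⟩ := hy
      have hb : 0 < F p ∧ F p ≤ ((l - i + lam.rowLen i : ℕ) : ℤ) := by
        rcases p with j | k
        · have hj := Finset.mem_range.1 (Finset.inl_mem_disjSum.1 hp)
          have h1 := (hiff i j).2 hj
          have h2 := hcol j
          simp only [F, Sum.elim_inl, hook]
          omega
        · have hk := Finset.mem_Ioc.1 (Finset.inr_mem_disjSum.1 hp)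
          have h1 := lam.rowLen_anti _ _ hk.1.le
          simp only [F, Sum.elim_inr, rowDiff]
          omega
      refine ⟨(F p - 1).toNat, Finset.mem_range.2 ?_, ?_⟩
      · omega
      · simp only [G]
        omega
    · rw [Finset.card_image_of_injective _ hG, Finset.card_image_of_injOn hinj,
        Finset.card_disjSum, Finset.card_range, Finset.card_range, Nat.card_Ioc, add_comm]
  have h := Finset.sum_disjSum (Finset.range (lam.rowLen i)) (Finset.Ioc i l)
    fun p => ({F p} : Multiset ℤ)
  refine h.symm.trans ?_
  rw [← Finset.sum_image (g := F) (f := fun y => ({y} : Multiset ℤ)) hinj, himg,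
    Finset.sum_image hG.injOn]

/-- In row `i` the interval $1,\dots,l-i+\lambda_i$ also splits at $l-i$: the lower part is the
staircase, the upper part the contents shifted by $l+1$. -/
theorem hookMultiset_add_pyramid (lam : YoungDiagram) {l : ℕ} (hl : lam.colLen 0 ≤ l + 1) :
    hookMultiset lam + pyramid lam l =
      shiftMultiset (contentMultiset lam) ((l : ℤ) + 1) + staircase l := by
  have h1 : hookMultiset lam = ∑ i ∈ Finset.range (l + 1),
      ∑ j ∈ Finset.range (lam.rowLen i), {hook lam i j} := by
    rw [hookMultiset, map_val_eq_sum_singleton]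
    exact sum_cells lam hl fun i j => ({hook lam i j} : Multiset ℤ)
  have h2 : shiftMultiset (contentMultiset lam) ((l : ℤ) + 1) = ∑ i ∈ Finset.range (l + 1),
      ∑ j ∈ Finset.range (lam.rowLen i), {(j : ℤ) - i + (l + 1)} := by
    rw [shiftMultiset, contentMultiset, Multiset.map_map, map_val_eq_sum_singleton]
    exact sum_cells lam hl fun i j => ({(j : ℤ) - i + (l + 1)} : Multiset ℤ)
  rw [h1, h2, pyramid_eq_sum, staircase_eq_sum, ← Finset.sum_add_distrib,
    ← Finset.sum_add_distrib]
  refine Finset.sum_congr rfl fun i hi => ?_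
  have hi := Nat.lt_succ_iff.1 (Finset.mem_range.1 hi)
  rw [hook_row_add_rowDiff lam hl hi, Finset.sum_range_add, add_comm]
  congr 1
  refine Finset.sum_congr rfl fun j _ => ?_
  congr 1
  push_cast [Nat.cast_sub hi]
  ring

theorem diffMultiset_eq_of_add_eq {X Z X' Z' : Multiset ℤ} (h : Z + X' = X + Z') :
    diffMultiset X Z = diffMultiset X' Z' := by
  funext x
  have := congrArg (Multiset.count x) h
  rw [Multiset.count_add, Multiset.count_add] at this
  rw [diffMultiset, diffMultiset]
  omega

theorem diffMultiset_eq_iff {X Z X' Z' : Multiset ℤ} :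
    diffMultiset X Z = diffMultiset X' Z' ↔ X + Z' = X' + Z := by
  constructor
  · intro h
    ext x
    have := congrFun h x
    rw [diffMultiset, diffMultiset] at this
    rw [Multiset.count_add, Multiset.count_add]
    omega
  · intro h
    exact diffMultiset_eq_of_add_eq (by rw [h, add_comm])

theorem diff_content_hook (lam : YoungDiagram) {l : ℕ} (hl : lam.colLen 0 ≤ l + 1) :
    diffMultiset (shiftMultiset (contentMultiset lam) ((l : ℤ) + 1)) (hookMultiset lam) =
      diffMultiset (pyramid lam l) (staircase l) :=
  diffMultiset_eq_of_add_eq (hookMultiset_add_pyramid lam hl)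

end HookPyramid

/-! ### Products of $1-q^x$ and the specialized Schur polynomial. -/

section OneSubProd

open LaurentPolynomial

/-- The product of the Laurent polynomials `1 - q ^ x`. -/
def oneSubProd (X : Multiset ℤ) : ℤ[T;T⁻¹] := (X.map fun x => 1 - T x).prod

theorem oneSubProd_add (X Y : Multiset ℤ) :
    oneSubProd (X + Y) = oneSubProd X * oneSubProd Y := by
  rw [oneSubProd, Multiset.map_add, Multiset.prod_add]; rfl

theorem oneSubProd_cons (x : ℤ) (X : Multiset ℤ) :
    oneSubProd (x ::ₘ X) = (1 - T x) * oneSubProd X := by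
  rw [oneSubProd, Multiset.map_cons, Multiset.prod_cons]; rfl

theorem T_inj {a b : ℤ} (h : (T a : ℤ[T;T⁻¹]) = T b) : a = b := by
  have := congrArg (fun f => f.coeff b) h
  simpa using this

theorem oneSubProd_ne_zero {X : Multiset ℤ} (hX : ∀ x ∈ X, 0 < x) : oneSubProd X ≠ 0 := by
  refine Multiset.prod_ne_zero fun h => ?_
  obtain ⟨x, hx, h0⟩ := Multiset.mem_map.1 h
  have h1 := hX x hx
  have := T_inj ((T_zero (R := ℤ)).trans (sub_eq_zero.1 h0))
  omega

/-- The factor for $x$ vanishes at a primitive $M$-th root of unity iff $M\mid x$, and for $0<x\le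
M$ this means $x=M$. -/
theorem eval_oneSubProd_eq_zero_iff {X : Multiset ℤ} {M : ℕ}
    (hX : ∀ x ∈ X, 0 < x ∧ x ≤ M) {ζ : ℂˣ} (hζ : IsPrimitiveRoot ζ M) :
    eval₂ (Int.castRingHom ℂ) ζ (oneSubProd X) = 0 ↔ (M : ℤ) ∈ X := by
  rw [oneSubProd, map_multiset_prod, Multiset.prod_eq_zero_iff, Multiset.map_map, Multiset.mem_map]
  have key : ∀ x : ℤ, (eval₂ (Int.castRingHom ℂ) ζ ∘ fun x => (1 - T x : ℤ[T;T⁻¹])) x = 0 ↔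
      (M : ℤ) ∣ x := fun x => by
    rw [Function.comp_apply, map_sub, map_one, eval₂_T, sub_eq_zero, eq_comm, Units.val_eq_one,
      hζ.zpow_eq_one_iff_dvd]
  constructor
  · rintro ⟨x, hx, h⟩
    have h1 := hX x hx
    have h2 := Int.le_of_dvd h1.1 ((key x).1 h)
    rwa [le_antisymm h2 h1.2]
  · intro h
    exact ⟨M, h, (key _).2 dvd_rfl⟩

/-- Evaluation at a primitive root of unity whose order is the largest element present shows that
this element lies in both multisets; cancel its factor and induct. The monomial is a unit and never
vanishes there. -/
theorem eq_of_oneSubProd_eq {X Y : Multiset ℤ} (hX : ∀ x ∈ X, 0 < x) (hY : ∀ x ∈ Y, 0 < x)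
    {d : ℤ} (h : oneSubProd X = T d * oneSubProd Y) : X = Y := by
  induction hn : Multiset.card (X + Y) using Nat.strong_induction_on generalizing X Y with
  | _ n ih =>
    rcases Multiset.empty_or_exists_mem (X + Y) with h0 | ⟨z, hz⟩
    · have h1 := congrArg Multiset.card h0
      rw [Multiset.card_add, Multiset.card_zero, Nat.add_eq_zero_iff] at h1
      rw [Multiset.card_eq_zero.1 h1.1, Multiset.card_eq_zero.1 h1.2]
    obtain ⟨M, hM, hmax⟩ : ∃ M ∈ X + Y, ∀ x ∈ X + Y, x ≤ M := by
      obtain ⟨M, h1, h2⟩ := (X + Y).toFinset.exists_max_image id ⟨z, Multiset.mem_toFinset.2 hz⟩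
      exact ⟨M, Multiset.mem_toFinset.1 h1, fun x hx => h2 x (Multiset.mem_toFinset.2 hx)⟩
    have hpos : 0 < M := (Multiset.mem_add.1 hM).elim (hX M) (hY M)
    lift M to ℕ using hpos.le
    have hpos' : 0 < M := by exact_mod_cast hpos
    have : NeZero M := ⟨hpos'.ne'⟩
    obtain ⟨ζ, hζ⟩ : ∃ ζ : ℂˣ, IsPrimitiveRoot ζ M := by
      have h1 := Complex.isPrimitiveRoot_exp M hpos'.ne'
      exact ⟨(h1.isUnit hpos'.ne').unit, IsPrimitiveRoot.coe_units_iff.1 h1⟩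
    have hiff : (M : ℤ) ∈ X ↔ (M : ℤ) ∈ Y := by
      rw [← eval_oneSubProd_eq_zero_iff
          (fun x hx => ⟨hX x hx, hmax x (Multiset.mem_add.2 (Or.inl hx))⟩) hζ,
        ← eval_oneSubProd_eq_zero_iff
          (fun x hx => ⟨hY x hx, hmax x (Multiset.mem_add.2 (Or.inr hx))⟩) hζ, h, map_mul,
        eval₂_T, mul_eq_zero_iff_left (Units.ne_zero _)]
    have hMX : (M : ℤ) ∈ X := (Multiset.mem_add.1 hM).elim id hiff.2
    obtain ⟨X', rfl⟩ := Multiset.exists_cons_of_mem hMX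
    obtain ⟨Y', rfl⟩ := Multiset.exists_cons_of_mem (hiff.1 hMX)
    rw [oneSubProd_cons, oneSubProd_cons, mul_left_comm] at h
    have h1 : (1 - T (M : ℤ) : ℤ[T;T⁻¹]) ≠ 0 := fun h0 => by
      have := T_inj ((T_zero (R := ℤ)).trans (sub_eq_zero.1 h0))
      omega
    rw [ih _ ?_ (fun x hx => hX x (Multiset.mem_cons_of_mem hx))
      (fun x hx => hY x (Multiset.mem_cons_of_mem hx)) (mul_left_cancel₀ h1 h) rfl]
    rw [← hn]
    simp only [Multiset.card_add, Multiset.card_cons]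
    omega

/-- After transposition this is a Vandermonde determinant in the powers $q^{a_j}$, and the
differences $a_j-a_i$ are the pyramid entries. The sign depends only on `l`, so it is kept as a
product to be cancelled against the denominator. -/
theorem det_qPow (lam : YoungDiagram) (l : ℕ) : ∃ e : ℤ,
    (Matrix.of fun i j : Fin (l + 1) =>
      ((T 1 : ℤ[T;T⁻¹]) ^ (i : ℕ)) ^ (lam.rowLen j.rev + j)).det =
      T e * ((∏ i : Fin (l + 1), ∏ _j ∈ Finset.Ioi i, (-1)) * oneSubProd (pyramid lam l)) := by
  let a : Fin (l + 1) → ℤ := fun j => ((lam.rowLen j.rev + j : ℕ) : ℤ)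
  have hdet : (Matrix.of fun i j : Fin (l + 1) =>
      ((T 1 : ℤ[T;T⁻¹]) ^ (i : ℕ)) ^ (lam.rowLen j.rev + j)).det =
      ∏ i, ∏ j ∈ Finset.Ioi i, (T (a j) - T (a i)) := by
    rw [← Matrix.det_vandermonde, ← Matrix.det_transpose]
    congr 1
    ext1 i j
    rw [Matrix.transpose_apply, Matrix.of_apply, Matrix.vandermonde_apply, ← pow_mul, mul_comm,
      pow_mul, T_pow, mul_one]
  have hfac : ∀ i j, (T (a j) - T (a i) : ℤ[T;T⁻¹]) = T (a i) * ((-1) * (1 - T (a j - a i))) :=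
    fun i j => by
      have : (T (a j) : ℤ[T;T⁻¹]) = T (a i) * T (a j - a i) := by
        rw [← T_add, add_sub_cancel]
      rw [this]
      ring
  have hT : ∀ (ι : Type) (s : Finset ι) (f : ι → ℤ),
      ∏ i ∈ s, (T (f i) : ℤ[T;T⁻¹]) = T (∑ i ∈ s, f i) := fun ι s f => by
    classical
    induction s using Finset.induction_on with
    | empty => simp
    | insert i s hi ih => rw [Finset.prod_insert hi, Finset.sum_insert hi, ih, T_add]
  refine ⟨∑ i, ∑ _j ∈ Finset.Ioi i, a i, ?_⟩
  rw [hdet]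
  simp only [hfac, Finset.prod_mul_distrib, hT]
  congr 2
  have hpyr : oneSubProd (pyramid lam l) =
      ∏ i ∈ Finset.range (l + 1), ∏ k ∈ Finset.Ioc i l, (1 - T (rowDiff lam i k)) := by
    rw [pyramid, oneSubProd, Multiset.map_map]
    change ∏ p ∈ _, (_ : ℤ[T;T⁻¹]) = _
    rw [Finset.prod_sigma']
    refine Finset.prod_bij' (fun p _ => ⟨p.1, p.2⟩) (fun p _ => (p.1, p.2)) ?_ ?_ ?_ ?_ ?_
    · intro p hp
      simp only [Finset.mem_filter, Finset.mem_product, Finset.mem_range, Finset.mem_sigma,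
        Finset.mem_Ioc] at hp ⊢
      omega
    · intro p hp
      simp only [Finset.mem_filter, Finset.mem_product, Finset.mem_range, Finset.mem_sigma,
        Finset.mem_Ioc] at hp ⊢
      omega
    · intro p _; rfl
    · intro p _; rfl
    · intro p hp
      simp only [Finset.mem_filter] at hp
      rw [Function.comp_apply, sum_Ico_delta lam hp.2.le]
  rw [hpyr, Finset.prod_sigma', Finset.prod_sigma']
  refine Finset.prod_bij' (fun p _ => ⟨(p.2.rev : ℕ), (p.1.rev : ℕ)⟩)
    (fun p hp => ⟨Fin.rev (Fin.ofNat (l + 1) p.2), Fin.rev (Fin.ofNat (l + 1) p.1)⟩) ?_ ?_ ?_ ?_ ?_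
  · rintro ⟨i, j⟩ hp
    simp only [Finset.mem_sigma, Finset.mem_univ, true_and, Finset.mem_Ioi, Finset.mem_range,
      Finset.mem_Ioc, Fin.val_rev, Fin.lt_def] at hp ⊢
    omega
  · rintro ⟨i, k⟩ hp
    simp only [Finset.mem_sigma, Finset.mem_univ, true_and, Finset.mem_Ioi, Finset.mem_range,
      Finset.mem_Ioc, Fin.rev_lt_rev] at hp ⊢
    rw [Fin.lt_def, Fin.val_ofNat, Fin.val_ofNat, Nat.mod_eq_of_lt hp.1,
      Nat.mod_eq_of_lt (by omega)]
    exact hp.2.1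
  · rintro ⟨i, j⟩ hp
    have h : ∀ i : Fin (l + 1), Fin.rev (Fin.ofNat (l + 1) (i.rev : ℕ)) = i := fun i => by
      rw [Fin.ofNat_val_eq_self, Fin.rev_rev]
    simp only [h]
  · rintro ⟨i, k⟩ hp
    simp only [Finset.mem_sigma, Finset.mem_range, Finset.mem_Ioc] at hp
    simp only [Fin.rev_rev, Fin.val_ofNat]
    rw [Nat.mod_eq_of_lt hp.1, Nat.mod_eq_of_lt (by omega)]
  · rintro ⟨i, j⟩ hp
    congr 2
    simp only [a, rowDiff, Fin.val_rev]
    have := i.2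
    have := j.2
    omega

theorem schurSpec_eq_sum {A : Type} [CommRing A] (q : A) (lam : YoungDiagram) (l : ℕ) :
    schurSpec q lam l = ∑ t : SSYTLe lam l, q ^ t.weight := by
  rw [schurSpec, schurPoly, map_sum]
  refine Finset.sum_congr rfl fun t _ => ?_
  rw [map_prod, SSYTLe.weight, ← Finset.prod_pow_eq_pow_sum]
  exact Finset.prod_congr rfl fun c _ => MvPolynomial.aeval_X _ _

theorem schurSpec_mul_staircase (lam : YoungDiagram) {l : ℕ} (hl : lam.colLen 0 ≤ l + 1) :
    ∃ e : ℤ, schurSpec (T 1 : ℤ[T;T⁻¹]) lam l * oneSubProd (staircase l) =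
      T e * oneSubProd (pyramid lam l) := by
  have h1 : schurSpec (T 1 : ℤ[T;T⁻¹]) lam l =
      tabSum (fun i => (T 1 : ℤ[T;T⁻¹]) ^ i) fun i : Fin (l + 1) => lam.rowLen i := by
    rw [← sum_ssyt_eq_tabSum _ lam l hl, schurSpec_eq_sum]
    refine Finset.sum_congr rfl fun t _ => ?_
    rw [SSYTLe.weight, ← Finset.prod_pow_eq_pow_sum]
  have h2 := tabSum_mul_vandermonde (fun i => (T 1 : ℤ[T;T⁻¹]) ^ i)
    (fun i : Fin (l + 1) => lam.rowLen i) fun i j h => lam.rowLen_anti _ _ h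
  obtain ⟨e, he⟩ := det_qPow lam l
  obtain ⟨e', he'⟩ := det_qPow ⊥ l
  have hbot : ∀ n, YoungDiagram.rowLen ⊥ n = 0 := fun n => by
    by_contra h0
    exact YoungDiagram.notMem_bot _ (YoungDiagram.mem_iff_lt_rowLen.2 (Nat.pos_of_ne_zero h0))
  simp only [hbot, zero_add] at he'
  rw [pyramid_bot] at he'
  rw [← h1, he, he'] at h2
  have hs : (∏ i : Fin (l + 1), ∏ _j ∈ Finset.Ioi i, (-1 : ℤ[T;T⁻¹])) ≠ 0 :=
    Finset.prod_ne_zero_iff.2 fun i _ => Finset.prod_ne_zero_iff.2 fun j _ =>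
      neg_ne_zero.2 one_ne_zero
  refine ⟨e - e', mul_left_cancel₀ hs (mul_left_cancel₀ (isUnit_T e').ne_zero ?_)⟩
  rw [show T e' * (_ * (T (e - e') * oneSubProd (pyramid lam l))) =
      (T e' * T (e - e')) * ((∏ i : Fin (l + 1), ∏ _j ∈ Finset.Ioi i, (-1 : ℤ[T;T⁻¹])) *
        oneSubProd (pyramid lam l)) by ring, ← T_add, add_sub_cancel, ← h2]
  ring

theorem exists_T_mul_schurSpec_iff {lam mu : YoungDiagram} {l m : ℕ} (hl : lam.colLen 0 ≤ l + 1)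
    (hm : mu.colLen 0 ≤ m + 1) :
    (∃ d : ℤ, schurSpec (T 1 : ℤ[T;T⁻¹]) lam l = T d * schurSpec (T 1) mu m) ↔
      diffMultiset (pyramid lam l) (staircase l) = diffMultiset (pyramid mu m) (staircase m) := by
  rw [diffMultiset_eq_iff]
  obtain ⟨e, he⟩ := schurSpec_mul_staircase lam hl
  obtain ⟨e', he'⟩ := schurSpec_mul_staircase mu hm
  have hpos : ∀ (nu : YoungDiagram) (a b : ℕ), ∀ x ∈ pyramid nu a + staircase b, 0 < x :=
    fun nu a b x hx => (Multiset.mem_add.1 hx).elim pos_of_mem_pyramid pos_of_mem_staircase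
  have hunit : ∀ a : ℤ, (T (-a) * T a : ℤ[T;T⁻¹]) = 1 := fun a => by
    rw [← T_add, neg_add_cancel, T_zero]
  constructor
  · rintro ⟨d, hd⟩
    refine eq_of_oneSubProd_eq (hpos _ _ _) (hpos _ _ _) (d := -e + d + e') ?_
    rw [oneSubProd_add, oneSubProd_add, T_add, T_add]
    rw [hd] at he
    linear_combination (-oneSubProd (pyramid lam l) * oneSubProd (staircase m)) * hunit e +
      (-T (-e) * oneSubProd (staircase m)) * he +
      (T (-e) * T d * oneSubProd (staircase l)) * he'
  · intro h
    have h' := congrArg oneSubProd h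
    rw [oneSubProd_add, oneSubProd_add] at h'
    refine ⟨e - e', ?_⟩
    have hne := mul_ne_zero (oneSubProd_ne_zero fun _ => pos_of_mem_staircase (l := l))
      (oneSubProd_ne_zero fun _ => pos_of_mem_staircase (l := m))
    refine mul_right_cancel₀ hne ?_
    rw [sub_eq_add_neg, T_add]
    linear_combination oneSubProd (staircase m) * he -
      (T e * T (-e') * oneSubProd (staircase l)) * he' + T e * h' -
      (T e * oneSubProd (pyramid mu m) * oneSubProd (staircase l)) * hunit e'

end OneSubProd

end Plethysm
end

noncomputable section

namespace Plethysm

/-! ### Recovering multiplicities from sums of powers. -/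

section Fibers

theorem natCast_card_fiber {R α γ : Type} [AddCommMonoidWithOne R] [Fintype α] [DecidableEq γ]
    (f : α → γ) (c : γ) :
    ((Nat.card {a // f a = c} : ℕ) : R) = ∑ a, if f a = c then 1 else 0 := by
  rw [Finset.sum_boole, Nat.card_eq_fintype_card, Fintype.card_subtype]

theorem coeff_sum_single {M α : Type} [Fintype α] (f : α → M) (c : M) :
    (∑ a, AddMonoidAlgebra.single (f a) (1 : ℤ)).coeff c = Nat.card {a // f a = c} := by
  classical
  rw [AddMonoidAlgebra.coeff_sum, Finsupp.finsetSum_apply, natCast_card_fiber]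
  exact Finset.sum_congr rfl fun a _ => Finsupp.single_apply

/-- Dedekind's independence of characters, applied to the homomorphisms $Q\mapsto Q^w$, which are
already distinct at $Q=2$. -/
theorem card_fiber_eq_of_sum_zpow_eq {α β : Type} [Fintype α] [Fintype β] (f : α → ℤ) (g : β → ℤ)
    (h : ∀ Q : ℂˣ, ∑ a, ((Q ^ f a : ℂˣ) : ℂ) = ∑ b, ((Q ^ g b : ℂˣ) : ℂ)) (w : ℤ) :
    Nat.card {a // f a = w} = Nat.card {b // g b = w} := by
  let χ : ℤ → ℂˣ →* ℂ := fun w => (Units.coeHom ℂ).comp (zpowGroupHom w)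
  have hinj : Function.Injective χ := fun a b hab => by
    have h2 := DFunLike.congr_fun hab (Units.mk0 2 two_ne_zero)
    simp only [χ, MonoidHom.comp_apply, zpowGroupHom_apply, Units.coeHom_apply,
      Units.val_zpow_eq_zpow_val, Units.val_mk0] at h2
    have h3 := congrArg (fun z : ℂ => ‖z‖) h2
    simp only [norm_zpow, Complex.norm_ofNat] at h3
    exact zpow_right_injective₀ two_pos (by norm_num) h3
  have hli := ((linearIndependent_monoidHom ℂˣ ℂ).comp χ hinj).finsuppLinearCombination_injective
  have hsum : ∀ {γ : Type} [Fintype γ] (k : γ → ℤ),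
      Finsupp.linearCombination ℂ ((fun φ : ℂˣ →* ℂ => (φ : ℂˣ → ℂ)) ∘ χ)
        (∑ c, Finsupp.single (k c) (1 : ℂ)) = fun Q : ℂˣ => ∑ c, ((Q ^ k c : ℂˣ) : ℂ) :=
    fun k => by
      funext Q
      simp [χ, Finset.sum_apply]
  have heq : ∑ a, Finsupp.single (f a) (1 : ℂ) = ∑ b, Finsupp.single (g b) (1 : ℂ) :=
    hli (by rw [hsum, hsum]; exact funext h)
  have hval : ∀ {γ : Type} [Fintype γ] (k : γ → ℤ),
      (∑ c, Finsupp.single (k c) (1 : ℂ)) w = (Nat.card {c // k c = w} : ℕ) := fun k => by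
    rw [natCast_card_fiber, Finsupp.finsetSum_apply]
    exact Finset.sum_congr rfl fun c _ => Finsupp.single_apply
  have := DFunLike.congr_fun heq w
  rw [hval, hval] at this
  exact_mod_cast this

/-- A string with top weight $n$ meets weight $w$ at most once, and does so exactly when $|w|\le n$
and $n\equiv w$ modulo $2$. -/
theorem card_string_fiber {d : ℕ} (n : Fin d → ℕ) (w : ℤ) :
    Nat.card {p : Σ i, Fin (n i + 1) // 2 * (p.2 : ℤ) - n p.1 = w} =
      Nat.card {i : Fin d // w.natAbs ≤ n i ∧ Even ((n i : ℤ) + w)} := by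
  refine Nat.card_congr (Equiv.ofBijective (fun p => ⟨p.1.1, ?_⟩) ⟨?_, ?_⟩)
  · have h1 := p.2
    have h2 := p.1.2.2
    exact ⟨by omega, (p.1.2 : ℤ), by omega⟩
  · rintro ⟨⟨i, k⟩, hp⟩ ⟨⟨i', k'⟩, hq⟩ h
    obtain rfl : i = i' := congrArg Subtype.val h
    have : k = k' := Fin.ext (by simp only at hp hq; omega)
    rw [Subtype.mk.injEq, this]
  · rintro ⟨i, h, k, hk⟩
    refine ⟨⟨⟨i, ⟨k.toNat, ?_⟩⟩, ?_⟩, rfl⟩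
    · omega
    · simp only
      omega

end Fibers

/-! ### Weight multiplicities determine the representation. -/

section CharacterCounts

variable (lam : YoungDiagram) (l : ℕ)

/-- The multiplicity of `Q ^ w` in the `Q`-character of `∇^lam Sym^l ℂ²`. -/
def charMult (w : ℤ) : ℕ := Nat.card {t : SSYTLe lam l // t.charExp = w}

/-- The torus trace computed in the semistandard basis and in a string basis. -/
theorem exists_string_multiplicities : ∃ (d : ℕ) (n : Fin d → ℕ),
    IsStringRep (V := NablaSpace lam l) (nablaSym lam l) n ∧
      ∀ w, charMult lam l w = Nat.card {i : Fin d // w.natAbs ≤ n i ∧ Even ((n i : ℤ) + w)} := by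
  obtain ⟨d, n, h⟩ := exists_isStringRep_nablaSym lam l
  refine ⟨d, n, h, fun w => ?_⟩
  rw [← card_string_fiber]
  refine card_fiber_eq_of_sum_zpow_eq _ (fun p : Σ i, Fin (n i + 1) => 2 * (p.2 : ℤ) - n p.1)
    (fun Q => ?_) w
  exact (trace_nablaSym_diag lam l Q).symm.trans
    (IsStringRep.trace_diag (V := NablaSpace lam l) h Q)

theorem charMult_neg (w : ℤ) : charMult lam l (-w) = charMult lam l w := by
  obtain ⟨d, n, -, h⟩ := exists_string_multiplicities lam l
  rw [h, h]
  refine Nat.card_congr (Equiv.subtypeEquivRight fun i => ?_)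
  rw [Int.natAbs_neg, ← sub_eq_add_neg, Int.even_sub, Int.even_add]

/-- For $w\ge-1$ one has $|w|\le|w+2|$, so every string through weight $w+2$ passes through $w$. -/
theorem charMult_add_two_le {w : ℤ} (hw : -1 ≤ w) :
    charMult lam l (w + 2) ≤ charMult lam l w := by
  obtain ⟨d, n, -, h⟩ := exists_string_multiplicities lam l
  rw [h, h]
  refine Nat.card_mono (Set.toFinite _) ?_
  rintro i ⟨h1, h2⟩
  refine ⟨by omega, ?_⟩
  obtain ⟨k, hk⟩ := h2
  exact ⟨k - 1, by omega⟩

variable {lam l} {mu : YoungDiagram} {m : ℕ}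

theorem nonempty_equiv_of_charMult_eq (h : ∀ w, charMult lam l w = charMult mu m w) :
    Nonempty ((nablaSym lam l).Equiv (nablaSym mu m)) := by
  obtain ⟨d, n, hn, hc⟩ := exists_string_multiplicities lam l
  obtain ⟨d', n', hn', hc'⟩ := exists_string_multiplicities mu m
  -- A string through weight $N\ge0$ either has top weight $N$ or continues to $N+2$; the difference
  -- of two multiplicities therefore counts the strings of each length.
  have key : ∀ {d : ℕ} (n : Fin d → ℕ) (N : ℕ),
      Nat.card {i : Fin d // (N : ℤ).natAbs ≤ n i ∧ Even ((n i : ℤ) + N)} =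
        Nat.card {i // n i = N} +
          Nat.card {i : Fin d // ((N : ℤ) + 2).natAbs ≤ n i ∧ Even ((n i : ℤ) + (N + 2))} :=
    fun {d} n N => by
      classical
      rw [Nat.card_eq_fintype_card, Nat.card_eq_fintype_card, Nat.card_eq_fintype_card,
        Fintype.card_subtype, Fintype.card_subtype, Fintype.card_subtype,
        ← Finset.card_union_of_disjoint]
      · congr 1
        ext i
        simp only [Finset.mem_filter, Finset.mem_univ, true_and, Finset.mem_union]
        constructor
        · rintro ⟨h1, k, hk⟩
          rcases eq_or_ne (n i) N with h2 | h2
          · exact Or.inl h2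
          · exact Or.inr ⟨by omega, k + 1, by omega⟩
        · rintro (h1 | ⟨h1, k, hk⟩)
          · exact ⟨by omega, N, by omega⟩
          · exact ⟨by omega, k - 1, by omega⟩
      · rw [Finset.disjoint_filter]
        rintro i - h1 ⟨h2, -⟩
        omega
  obtain ⟨τ, hτ⟩ := exists_equiv_of_card_fibers_eq n n' fun N => by
    have h1 := key n N
    have h2 := key n' N
    rw [← hc, ← hc] at h1
    rw [← hc', ← hc', ← h, ← h] at h2
    omega
  exact IsStringRep.nonempty_equiv (V := NablaSpace lam l) (W := NablaSpace mu m) hn hn' τ hτ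

theorem exists_isQCharacter_of_equiv (φ : (nablaSym lam l).Equiv (nablaSym mu m)) :
    ∃ Ψ : LaurentPolynomial ℂ, IsQCharacter (nablaSym lam l) Ψ ∧ IsQCharacter (nablaSym mu m) Ψ := by
  have hΨ : IsQCharacter (nablaSym lam l)
      (∑ t : SSYTLe lam l, LaurentPolynomial.T t.charExp) := fun Q => by
    rw [trace_nablaSym_diag, map_sum]
    exact Finset.sum_congr rfl fun t _ => (LaurentPolynomial.eval₂_T _ _ _).symm
  refine ⟨_, hΨ, fun Q => ?_⟩
  rw [← hΨ Q, ← Representation.Equiv.conj_apply_self (diagSL2 Q) φ]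
  exact LinearMap.trace_conj' (M := NablaSpace lam l) (N := NablaSpace mu m) _ _

theorem charMult_eq_of_isQCharacter {Ψ : LaurentPolynomial ℂ}
    (h : IsQCharacter (nablaSym lam l) Ψ) (h' : IsQCharacter (nablaSym mu m) Ψ) (w : ℤ) :
    charMult lam l w = charMult mu m w :=
  card_fiber_eq_of_sum_zpow_eq _ _ (fun Q => by
    rw [← trace_nablaSym_diag, ← trace_nablaSym_diag, h Q, h' Q]) w

end CharacterCounts

/-! ### Extreme weights of semistandard tableaux. -/

section MinimumWeight

variable {lam : YoungDiagram} {l : ℕ}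

theorem minWeight_eq_sum (lam : YoungDiagram) : minWeight lam = ∑ c ∈ lam.cells, c.1 := by
  have h : ∀ j, (lam.colLen j).choose 2 = ∑ i ∈ Finset.range (lam.colLen j), i := fun j => by
    rw [Finset.sum_range_id, Nat.choose_two_right]
  simp only [minWeight, h]
  rw [Finset.sum_sigma']
  refine Finset.sum_bij' (fun p _ => (p.2, p.1)) (fun c _ => ⟨c.2, c.1⟩) ?_ ?_ ?_ ?_ ?_
  · intro p hp
    simp only [Finset.mem_sigma, Finset.mem_range] at hp
    exact (YoungDiagram.mem_cells _).2 (YoungDiagram.mem_iff_lt_colLen.2 hp.2)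
  · intro c hc
    have hc' := (YoungDiagram.mem_cells _).1 hc
    simp only [Finset.mem_sigma, Finset.mem_range]
    exact ⟨YoungDiagram.mem_iff_lt_rowLen.1 (lam.up_left_mem (Nat.zero_le _) le_rfl hc'),
      YoungDiagram.mem_iff_lt_colLen.1 hc'⟩
  · intro p _; rfl
  · intro c _; rfl
  · intro p _; rfl

theorem le_entry (t : SemistandardYoungTableau lam) {i j : ℕ} (h : (i, j) ∈ lam) : i ≤ t i j := by
  induction i with
  | zero => exact Nat.zero_le _
  | succ i ih =>
    exact (ih (lam.up_left_mem (Nat.le_succ i) le_rfl h)).trans_lt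
      (t.col_strict (Nat.lt_succ_self i) h)

theorem minWeight_le_weight (t : SSYTLe lam l) : minWeight lam ≤ t.weight := by
  rw [minWeight_eq_sum, SSYTLe.weight]
  exact Finset.sum_le_sum fun c hc => le_entry t.1 ((YoungDiagram.mem_cells _).1 hc)

theorem exists_weight_eq_minWeight (hl : lam.colLen 0 ≤ l + 1) :
    ∃ t : SSYTLe lam l, t.weight = minWeight lam := by
  refine ⟨⟨SemistandardYoungTableau.highestWeight lam, fun i j => ?_⟩, ?_⟩
  · rw [SemistandardYoungTableau.highestWeight_apply]
    split_ifs with h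
    · exact Nat.lt_succ_iff.1 ((YoungDiagram.mem_iff_lt_colLen.1
        (lam.up_left_mem le_rfl (Nat.zero_le _) h)).trans_le hl)
    · exact Nat.zero_le _
  · rw [minWeight_eq_sum]
    refine Finset.sum_congr rfl fun c hc => ?_
    exact if_pos ((YoungDiagram.mem_cells _).1 hc)

theorem exists_charExp_eq_neg (t : SSYTLe lam l) : ∃ s : SSYTLe lam l, s.charExp = -t.charExp := by
  have h : 0 < charMult lam l t.charExp := Nat.card_pos_iff.2 ⟨⟨t, rfl⟩, inferInstance⟩
  rw [← charMult_neg] at h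
  obtain ⟨⟨s, hs⟩⟩ := (Nat.card_pos_iff.1 h).1
  exact ⟨s, hs⟩

/-- The upper bound is the reflection of the lower one under the symmetry of the character, so no
complementation of tableaux is needed. -/
theorem weight_le (t : SSYTLe lam l) :
    (t.weight : ℤ) ≤ l * lam.card - minWeight lam := by
  obtain ⟨s, hs⟩ := exists_charExp_eq_neg t
  have := minWeight_le_weight s
  rw [SSYTLe.charExp, SSYTLe.charExp] at hs
  omega

theorem exists_weight_eq_max (hl : lam.colLen 0 ≤ l + 1) :
    ∃ t : SSYTLe lam l, (t.weight : ℤ) = l * lam.card - minWeight lam := by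
  obtain ⟨t, ht⟩ := exists_weight_eq_minWeight hl
  obtain ⟨s, hs⟩ := exists_charExp_eq_neg t
  refine ⟨s, ?_⟩
  rw [SSYTLe.charExp, SSYTLe.charExp] at hs
  omega

end MinimumWeight

/-! ### Comparing the enumerative conditions. -/

section Comparison

variable {lam mu : YoungDiagram} {l m : ℕ}

theorem exists_weight_equiv {d : ℤ}
    (h : ∀ e : ℤ, numTableaux (e + d) l lam = numTableaux e m mu) :
    ∃ σ : SSYTLe lam l ≃ SSYTLe mu m, ∀ t, (t.weight : ℤ) = (σ t).weight + d := by
  obtain ⟨σ, hσ⟩ := exists_equiv_of_card_fibers_eq (fun t : SSYTLe lam l => (t.weight : ℤ) - d)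
    (fun t : SSYTLe mu m => (t.weight : ℤ)) fun e => by
      rw [← numTableaux, ← h e, numTableaux]
      exact Nat.card_congr (Equiv.subtypeEquivRight fun t => sub_eq_iff_eq_add)
  exact ⟨σ, fun t => by rw [hσ t]; ring⟩

/-- A bijection that shifts all weights by `d` carries the minimum to the minimum and the maximum to
the maximum. The first gives `d`; combined with the second it gives $2d$. -/
theorem numTableaux_shift_eq (hl : lam.colLen 0 ≤ l + 1) (hm : mu.colLen 0 ≤ m + 1) {d : ℤ}
    (h : ∀ e : ℤ, numTableaux (e + d) l lam = numTableaux e m mu) :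
    d = (minWeight lam : ℤ) - minWeight mu ∧ 2 * d = (l : ℤ) * lam.card - m * mu.card := by
  obtain ⟨σ, hσ⟩ := exists_weight_equiv h
  obtain ⟨t, ht⟩ := exists_weight_eq_minWeight hl
  obtain ⟨s, hs⟩ := exists_weight_eq_minWeight hm
  obtain ⟨t', ht'⟩ := exists_weight_eq_max hl
  obtain ⟨s', hs'⟩ := exists_weight_eq_max hm
  have h1 := hσ t
  have h2 := hσ (σ.symm s)
  have h3 := hσ t'
  have h4 := hσ (σ.symm s')
  rw [Equiv.apply_symm_apply] at h2 h4
  have h5 := minWeight_le_weight (σ t)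
  have h6 := minWeight_le_weight (σ.symm s)
  have h7 := weight_le (σ t')
  have h8 := weight_le (σ.symm s')
  omega

theorem charMult_eq_of_numTableaux (hl : lam.colLen 0 ≤ l + 1) (hm : mu.colLen 0 ≤ m + 1) {d : ℤ}
    (h : ∀ e : ℤ, numTableaux (e + d) l lam = numTableaux e m mu) (w : ℤ) :
    charMult lam l w = charMult mu m w := by
  obtain ⟨σ, hσ⟩ := exists_weight_equiv h
  have hd := (numTableaux_shift_eq hl hm h).2
  refine Nat.card_congr (σ.subtypeEquiv fun t => ?_)
  have := hσ t
  rw [SSYTLe.charExp, SSYTLe.charExp]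
  omega

theorem exists_numTableaux_of_charMult_eq (hl : lam.colLen 0 ≤ l + 1)
    (h : ∀ w, charMult lam l w = charMult mu m w) :
    ∃ d : ℤ, ∀ e : ℤ, numTableaux (e + d) l lam = numTableaux e m mu := by
  obtain ⟨σ, hσ⟩ := exists_equiv_of_card_fibers_eq (SSYTLe.charExp (lam := lam) (l := l))
    (SSYTLe.charExp (lam := mu) (l := m)) h
  -- Equal character exponents make the weight difference constant along `σ`, so any one tableau
  -- reveals the shift; the bound on the number of rows ensures that one exists.
  obtain ⟨t₀, -⟩ := exists_weight_eq_minWeight hl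
  refine ⟨(t₀.weight : ℤ) - (σ t₀).weight, fun e => Nat.card_congr (σ.subtypeEquiv fun t => ?_)⟩
  have h0 := hσ t₀
  have h1 := hσ t
  rw [SSYTLe.charExp, SSYTLe.charExp] at h0 h1
  omega

open LaurentPolynomial in
theorem schurSpec_T_eq_sum (lam : YoungDiagram) (l : ℕ) :
    schurSpec (T 1 : ℤ[T;T⁻¹]) lam l =
      ∑ t : SSYTLe lam l, AddMonoidAlgebra.single (t.weight : ℤ) (1 : ℤ) := by
  rw [schurSpec_eq_sum]
  exact Finset.sum_congr rfl fun t _ => by rw [T_pow, mul_one]; rfl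

open LaurentPolynomial in
theorem schurSpec_eq_T_mul_iff (d : ℤ) :
    schurSpec (T 1 : ℤ[T;T⁻¹]) lam l = T d * schurSpec (T 1) mu m ↔
      ∀ e : ℤ, numTableaux (e + d) l lam = numTableaux e m mu := by
  have hr : (T d * schurSpec (T 1) mu m : ℤ[T;T⁻¹]) =
      ∑ t : SSYTLe mu m, AddMonoidAlgebra.single ((t.weight : ℤ) + d) (1 : ℤ) := by
    rw [schurSpec_T_eq_sum, Finset.mul_sum]
    refine Finset.sum_congr rfl fun t _ => ?_
    rw [T, AddMonoidAlgebra.single_mul_single, mul_one, add_comm]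
  have hc : ∀ e, Nat.card {t : SSYTLe mu m // (t.weight : ℤ) + d = e + d} = numTableaux e m mu :=
    fun e => Nat.card_congr (Equiv.subtypeEquivRight fun t => add_left_inj d)
  rw [hr, schurSpec_T_eq_sum]
  constructor
  · intro h e
    have h1 := congrArg (fun f => f.coeff (e + d)) h
    simp only [coeff_sum_single, hc] at h1
    exact_mod_cast h1
  · intro h
    refine LaurentPolynomial.ext fun a => ?_
    obtain ⟨e, rfl⟩ : ∃ e, a = e + d := ⟨a - d, (sub_add_cancel a d).symm⟩
    rw [coeff_sum_single, coeff_sum_single, hc, ← h e, numTableaux]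

theorem centredSchur_eq_sum (lam : YoungDiagram) (l : ℕ) :
    centredSchur lam l =
      ∑ t : SSYTLe lam l, AddMonoidAlgebra.single ((t.charExp : ℚ) / 2) (1 : ℤ) := by
  rw [centredSchur, schurSpec_eq_sum, Finset.mul_sum]
  refine Finset.sum_congr rfl fun t _ => ?_
  rw [qPow, qPow, AddMonoidAlgebra.single_pow, AddMonoidAlgebra.single_mul_single, one_pow,
    mul_one, SSYTLe.charExp]
  congr 1
  push_cast
  ring

theorem coeff_centredSchur (lam : YoungDiagram) (l : ℕ) (w : ℤ) :
    (centredSchur lam l).coeff ((w : ℚ) / 2) = charMult lam l w := by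
  rw [centredSchur_eq_sum, coeff_sum_single, charMult]
  congr 1
  refine Nat.card_congr (Equiv.subtypeEquivRight fun t => ?_)
  rw [div_left_inj' two_ne_zero, Int.cast_inj]

theorem coeff_centredSchur_eq_zero (lam : YoungDiagram) (l : ℕ) {r : ℚ}
    (hr : ∀ w : ℤ, r ≠ (w : ℚ) / 2) : (centredSchur lam l).coeff r = 0 := by
  rw [centredSchur_eq_sum, coeff_sum_single]
  have : IsEmpty {t : SSYTLe lam l // (t.charExp : ℚ) / 2 = r} := ⟨fun t => hr _ t.2.symm⟩
  rw [Nat.card_of_isEmpty, Nat.cast_zero]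

theorem centredSchur_eq_iff :
    centredSchur lam l = centredSchur mu m ↔ ∀ w, charMult lam l w = charMult mu m w := by
  constructor
  · intro h w
    have := coeff_centredSchur lam l w
    rw [h, coeff_centredSchur] at this
    exact_mod_cast this.symm
  · intro h
    refine AddMonoidAlgebra.ext (Finsupp.ext fun r => ?_)
    by_cases hr : ∃ w : ℤ, r = (w : ℚ) / 2
    · obtain ⟨w, rfl⟩ := hr
      rw [coeff_centredSchur, coeff_centredSchur, h]
    · push Not at hr
      rw [coeff_centredSchur_eq_zero lam l hr, coeff_centredSchur_eq_zero mu m hr]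

theorem centrallySymmetric_centredSchur (lam : YoungDiagram) (l : ℕ) :
    CentrallySymmetric (centredSchur lam l) := by
  intro r
  by_cases hr : ∃ w : ℤ, r = (w : ℚ) / 2
  · obtain ⟨w, rfl⟩ := hr
    have : -((w : ℚ) / 2) = ((-w : ℤ) : ℚ) / 2 := by push_cast; ring
    rw [this, coeff_centredSchur, coeff_centredSchur, charMult_neg]
  · push Not at hr
    rw [coeff_centredSchur_eq_zero lam l hr, coeff_centredSchur_eq_zero lam l fun w hw => ?_]
    exact hr (-w) (by push_cast; linarith)

theorem unimodalAboutZero_centredSchur (lam : YoungDiagram) (l : ℕ) :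
    UnimodalAboutZero (centredSchur lam l) := by
  have key : ∀ r : ℚ, 0 ≤ r →
      (centredSchur lam l).coeff (r + 1) ≤ (centredSchur lam l).coeff r := fun r h0 => by
    by_cases hr : ∃ w : ℤ, r = (w : ℚ) / 2
    · obtain ⟨w, rfl⟩ := hr
      have : (w : ℚ) / 2 + 1 = ((w + 2 : ℤ) : ℚ) / 2 := by push_cast; ring
      rw [this, coeff_centredSchur, coeff_centredSchur]
      have hw : (0 : ℚ) ≤ w := by linarith
      have hw' : (0 : ℤ) ≤ w := by exact_mod_cast hw
      exact_mod_cast charMult_add_two_le lam l (by omega)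
    · push Not at hr
      rw [coeff_centredSchur_eq_zero lam l hr, coeff_centredSchur_eq_zero lam l fun w hw => ?_]
      exact hr (w - 2) (by push_cast; linarith)
  refine ⟨fun r h => ?_, key⟩
  have hs := centrallySymmetric_centredSchur lam l
  rw [← hs r, ← hs (r - 1), neg_sub, sub_eq_add_neg, add_comm 1]
  exact key (-r) (neg_nonneg.2 h)

end Comparison

end Plethysm
end

/-! ### The equivalences and the numerical consequences. -/

open Plethysm in
theorem mainTheorem12 (lam mu : YoungDiagram) (l m : ℕ)
    (hl : lam.colLen 0 ≤ l + 1) (hm : mu.colLen 0 ≤ m + 1) :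
    [ PlethysticEquiv lam l mu m,
      Nonempty ((nablaSym lam l).Equiv (nablaSym mu m)),
      ∃ Ψ : LaurentPolynomial ℂ,
        IsQCharacter (nablaSym lam l) Ψ ∧ IsQCharacter (nablaSym mu m) Ψ,
      centredSchur lam l = centredSchur mu m,
      ∃ d : ℤ, schurSpec (LaurentPolynomial.T 1 : LaurentPolynomial ℤ) lam l =
        LaurentPolynomial.T d * schurSpec (LaurentPolynomial.T 1) mu m,
      LaurentPolynomial.T (-(minWeight lam : ℤ)) *
          schurSpec (LaurentPolynomial.T 1 : LaurentPolynomial ℤ) lam l =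
        LaurentPolynomial.T (-(minWeight mu : ℤ)) * schurSpec (LaurentPolynomial.T 1) mu m,
      ∃ d : ℤ, ∀ e : ℤ, numTableaux (e + d) l lam = numTableaux e m mu,
      diffMultiset (shiftMultiset (contentMultiset lam) ((l : ℤ) + 1)) (hookMultiset lam) =
        diffMultiset (shiftMultiset (contentMultiset mu) ((m : ℤ) + 1)) (hookMultiset mu),
      diffMultiset (pyramid lam l) (staircase l) =
        diffMultiset (pyramid mu m) (staircase m) ].TFAE ∧
    (PlethysticEquiv lam l mu m →
      -((l : ℚ) * lam.card) / 2 + minWeight lam = -((m : ℚ) * mu.card) / 2 + minWeight mu) ∧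
    (UnimodalAboutZero (centredSchur lam l) ∧ CentrallySymmetric (centredSchur lam l)) ∧
    (UnimodalAboutZero (centredSchur mu m) ∧ CentrallySymmetric (centredSchur mu m)) ∧
    (∀ d : ℤ, schurSpec (LaurentPolynomial.T 1 : LaurentPolynomial ℤ) lam l =
        LaurentPolynomial.T d * schurSpec (LaurentPolynomial.T 1) mu m →
      d = (minWeight lam : ℤ) - minWeight mu) ∧
    (∀ d : ℤ, (∀ e : ℤ, numTableaux (e + d) l lam = numTableaux e m mu) →
      d = (minWeight lam : ℤ) - minWeight mu) := by
  -- Equality of all weight multiplicities is the hub through which the isomorphism, the character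
  -- and the enumerative conditions are compared.
  have hK : Nonempty ((nablaSym lam l).Equiv (nablaSym mu m)) ↔
      ∀ w, charMult lam l w = charMult mu m w := by
    refine ⟨fun ⟨φ⟩ => ?_, nonempty_equiv_of_charMult_eq⟩
    obtain ⟨Ψ, h, h'⟩ := exists_isQCharacter_of_equiv φ
    exact charMult_eq_of_isQCharacter h h'
  have hG : (∀ w, charMult lam l w = charMult mu m w) ↔
      ∃ d : ℤ, ∀ e : ℤ, numTableaux (e + d) l lam = numTableaux e m mu :=
    ⟨exists_numTableaux_of_charMult_eq hl, fun ⟨_, h⟩ => charMult_eq_of_numTableaux hl hm h⟩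
  refine ⟨?_, ?_, ⟨unimodalAboutZero_centredSchur lam l, centrallySymmetric_centredSchur lam l⟩,
    ⟨unimodalAboutZero_centredSchur mu m, centrallySymmetric_centredSchur mu m⟩,
    fun d h => (numTableaux_shift_eq hl hm ((schurSpec_eq_T_mul_iff d).1 h)).1,
    fun d h => (numTableaux_shift_eq hl hm h).1⟩
  · tfae_have 1 ↔ 2 := ⟨fun h => h.2.2, fun h => ⟨hl, hm, h⟩⟩
    tfae_have 2 → 3 := fun ⟨φ⟩ => exists_isQCharacter_of_equiv φ
    tfae_have 3 → 2 := fun ⟨_, h, h'⟩ => hK.2 (charMult_eq_of_isQCharacter h h')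
    tfae_have 2 ↔ 4 := hK.trans centredSchur_eq_iff.symm
    tfae_have 2 ↔ 7 := hK.trans hG
    tfae_have 5 ↔ 7 := exists_congr schurSpec_eq_T_mul_iff
    tfae_have 5 → 6 := fun ⟨d, h⟩ => by
      have hd := (numTableaux_shift_eq hl hm ((schurSpec_eq_T_mul_iff d).1 h)).1
      rw [h, ← mul_assoc, ← LaurentPolynomial.T_add, hd]
      congr 2
      ring
    tfae_have 6 → 5 := fun h => by
      refine ⟨(minWeight lam : ℤ) - minWeight mu, ?_⟩
      rw [sub_eq_add_neg, LaurentPolynomial.T_add, mul_assoc, ← h, ← mul_assoc,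
        ← LaurentPolynomial.T_add, add_neg_cancel, LaurentPolynomial.T_zero, one_mul]
    tfae_have 5 ↔ 9 := exists_T_mul_schurSpec_iff hl hm
    tfae_have 8 ↔ 9 := by rw [diff_content_hook lam hl, diff_content_hook mu hm]
    tfae_finish
  · rintro ⟨-, -, h⟩
    obtain ⟨d, hd⟩ := hG.1 (hK.1 h)
    obtain ⟨h1, h2⟩ := numTableaux_shift_eq hl hm hd
    have h1' : (d : ℚ) = (minWeight lam : ℚ) - minWeight mu := by exact_mod_cast h1
    have h2' : 2 * (d : ℚ) = (l : ℚ) * lam.card - m * mu.card := by exact_mod_cast h2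
    linarith
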